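/- All graphs are finite and simple. For a graph $G$ and $X\subseteq V(G)$, the cut-rank $\rho_G(X)$ is the rank over $\mathrm{GF}(2)$ of the $X\times(V(G)\setminus X)$ submatrix of the adjacency matrix of $G$. A rank-decomposition of $G$ is a pair $(T,\mu)$, where $T$ is a finite tree all of whose vertices have degree $1$ or $3$ and $\mu$ is a bijection from $V(G)$ to the set of leaves of $T$. For an edge $e$ of $T$, let $A_e$ be the set of vertices of $G$ mapped by $\mu$ into one fixed component of $T\setminus e$; the width of $e$ is $\rho_G(A_e)$, which does not depend on the chosen component. The width of $(T,\mu)$ is the maximum of the widths of the edges of $T$, and the rank-width of $G$ is the minimum width of a rank-decomposition of $G$ (it is $0$ if $|V(G)|\le 1$, when there is no rank-decomposition). Let $N(v)$ denote the set of neighbours of $v$. Pivoting an edge $vw$ of $G$ means to complement the adjacency of every pair of vertices that lie in two different ones of the sets $N(v)\setminus (N(w)\cup\{w\})$, $N(w)\setminus (N(v)\cup\{v\})$ and $N(v)\cap N(w)$, and then to exchange the labels of $v$ and $w$. A graph is pivot-equivalent to $G$ if it is obtained from $G$ by a (possibly empty) sequence of pivots, and a pivot-minor of $G$ is an induced subgraph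 of a graph that is pivot-equivalent to $G$. A pivot-minor $H$ of $G$ is proper if $V(H)\ne V(G)$. **Theorem.** If a graph $G$ has rank-width $3$, but all of its proper pivot-minors have rank-width at most $2$, then $|V(G)|\le 16$. -/

import Mathlib

namespace SimpleGraph

/-- The cut-rank `ρ_G(X)`: the rank over `GF(2)` of the submatrix of the adjacency matrix of `G`
with rows indexed by `X` and columns indexed by the complement of `X`. -/
noncomputable def cutRank {V : Type*} [Finite V] (G : SimpleGraph V) (X : Set V) : ℕ :=
  letI := Classical.decRel G.Adj
  letI := Fintype.ofFinite (Xᶜ : Set V)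
  ((G.adjMatrix (ZMod 2)).submatrix (Subtype.val : X → V) (Subtype.val : (Xᶜ : Set V) → V)).rank

/-- The pairs whose adjacency is complemented when the edge `vw` is pivoted: pairs of vertices in
two different ones of the sets `N(v) - N(w) - {w}`, `N(w) - N(v) - {v}` and `N(v) ∩ N(w)`. -/
def pivotFlips {V : Type*} (G : SimpleGraph V) (v w : V) : SimpleGraph V :=
  SimpleGraph.fromRel fun x y =>
    (x ∈ (G.neighborSet v \ G.neighborSet w) \ {w} ∧
      y ∈ (G.neighborSet w \ G.neighborSet v) \ {v}) ∨
    (x ∈ (G.neighborSet v \ G.neighborSet w) \ {w} ∧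
      y ∈ G.neighborSet v ∩ G.neighborSet w) ∨
    (x ∈ G.neighborSet v ∩ G.neighborSet w ∧
      y ∈ (G.neighborSet w \ G.neighborSet v) \ {v})

open Classical in
/-- The graph `G ∧ vw` obtained by pivoting: complement the adjacencies in `pivotFlips`, then
exchange the labels of `v` and `w`. It is only used when `vw` is an edge of `G`. -/
noncomputable def pivot {V : Type*} (G : SimpleGraph V) (v w : V) : SimpleGraph V :=
  (symmDiff G (G.pivotFlips v w)).comap (Equiv.swap v w)

/-- `G.PivotEquivalent H`: the graph `H` is obtained from `G` by a sequence of pivots on edges. -/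
def PivotEquivalent {V : Type*} (G H : SimpleGraph V) : Prop :=
  Relation.ReflTransGen
    (fun G₁ G₂ : SimpleGraph V => ∃ v w : V, G₁.Adj v w ∧ G₂ = G₁.pivot v w) G H

/-- `H` is a pivot-minor of `G`: an induced subgraph of a graph pivot-equivalent to `G`. -/
def IsPivotMinor {V : Type*} {S : Set V} (H : SimpleGraph S) (G : SimpleGraph V) : Prop :=
  ∃ G' : SimpleGraph V, G.PivotEquivalent G' ∧ H = G'.induce S

/-- A pivot-minor of `G` is proper if its vertex set is a proper subset of that of `G`. -/
def IsProperPivotMinor {V : Type*} {S : Set V} (H : SimpleGraph S) (G : SimpleGraph V) : Prop :=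
  S ≠ Set.univ ∧ H.IsPivotMinor G

/-- A rank-decomposition of a graph with vertex set `V`: a finite tree all of whose vertices have
degree `1` or `3`, with a bijection from `V` to the set of its leaves. -/
structure RankDecomposition (V : Type*) where
  /-- The vertices of the tree. -/
  Node : Type
  finite_node : Finite Node
  /-- The tree. -/
  tree : SimpleGraph Node
  isTree : tree.IsTree
  subcubic : ∀ x : Node, (tree.neighborSet x).ncard = 1 ∨ (tree.neighborSet x).ncard = 3
  /-- The bijection to the leaves. -/
  leaf : V ≃ {x : Node // (tree.neighborSet x).ncard = 1}

/-- For an edge `e` of the tree, given with an orientation, the set `A_e` of the vertices of the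
graph that are mapped into the component of `T - e` containing the first end of `e`. -/
def RankDecomposition.side {V : Type*} (D : RankDecomposition V) (e : D.tree.Dart) : Set V :=
  {u : V | (D.tree.deleteEdges {e.edge}).Reachable e.fst (D.leaf u : D.Node)}

/-- The width of a rank-decomposition of `G`: the maximum of `ρ_G(A_e)` over the edges `e`. Both
orientations of `e` occur; they yield complementary sets, which have the same cut-rank. -/
noncomputable def RankDecomposition.width {V : Type*} [Finite V] (D : RankDecomposition V)
    (G : SimpleGraph V) : ℕ :=
  ⨆ e : D.tree.Dart, G.cutRank (D.side e)

/-- The rank-width of `G`: the minimum width of a rank-decomposition of `G`. A graph with at most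
one vertex has no rank-decomposition, and then the value is `0`, which is the usual convention. -/
noncomputable def rankWidth {V : Type*} [Finite V] (G : SimpleGraph V) : ℕ :=
  sInf {k : ℕ | ∃ D : RankDecomposition V, D.width G = k}

end SimpleGraph

/-!
Let `A` be the adjacency matrix of `G` over `GF(2)`. Everything is expressed through the *label
space* of `G`, the space of all functions `v ↦ (x v, (A x) v)` from vertices to pairs of elements
of `GF(2)`, which is isotropic for the form that sums the symplectic form over the vertices. The
cut-rank of `X` is `|X|` minus the dimension of the subspace of elements supported in `X`. Pivoting
an edge exchanges the two coordinates at its ends, so that the cut-rank functions of `G - v` and of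
`G ∧ vw - v` are computed in the same way from the elements whose label at `v` is `0` or `P`, with
`P = (0, 1)` and `P = (1, 0)` respectively. Rank-decompositions are replaced by *branched* sets: a
graph has rank-width at most `k` if and only if its vertex set can be split recursively into
singletons through sets of cut-rank at most `k` (`rankWidth_le_of_branched`,
`branched_of_rankWidth_le`).

Suppose that `G` has rank-width `3` and at least `17` vertices, and that its proper pivot-minors
have rank-width at most `2` (`isExcluded`). All cuts of rank at most `1` are trivial
(`card_le_one_of_cutRank_le_one`).

The next step is that a cut of rank `2` has a side with at most four vertices (`card_le_four`).
Otherwise there is a smallest set `B` of cut-rank `2` with more than four vertices on both sides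
such that the complement of `B` is not branched. If `B.erase v` were titanic in a minor at `v` that
preserves the rank of `B`, then the decomposition of the minor could be changed into one of the
complement of `B` (`Branched.sdiff_of_titanic`). So `B.erase v` is not titanic, and this yields
elements of the label space that are supported in `B` on three vertices including `v`, with either
label at `v`. Counting dimensions shows that so many of them do not fit.

On the other hand, every minor at `v` has at least `16` vertices, and therefore a cut of rank at
most `2` with at least six vertices on both sides (`exists_cut`): a decomposition with more than
ten leaves has a part with at least six of them, so that some part has between six and ten. These
balanced cuts, by submodularity and by uncrossing, exclude successively sets of cut-rank `2` with
four elements (`rank_ne_two_of_card_eq_four`) and with three elements (`not_isTriple`; here the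
balanced cuts at the three elements are crossed with each other). Finally, the balanced cuts of the
two minors at one vertex are crossed with each other, and one of their four sides has to have at
most four elements (`rank_inter_add_rank_le`, `IsExcluded.elim`).
-/

namespace SimpleGraph

/-! ### Branched sets -/

section Branched

variable {V : Type*} [DecidableEq V]

/-- `Branched f k X`: the set `X` is the set of leaves of a rooted binary tree such that, for every
node, the set of leaves below it has `f`-value at most `k`. Empty subtrees are allowed, so that
trees can be restricted to subsets. -/
inductive Branched (f : Finset V → ℕ) (k : ℕ) : Finset V → Prop
  | empty : f ∅ ≤ k → Branched f k ∅
  | singleton (v : V) : f {v} ≤ k → Branched f k {v}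
  | union {X Y : Finset V} : Branched f k X → Branched f k Y → Disjoint X Y →
      f (X ∪ Y) ≤ k → Branched f k (X ∪ Y)

namespace Branched

variable {f g : Finset V → ℕ} {k : ℕ} {X A B S : Finset V}

theorem le (h : Branched f k X) : f X ≤ k := by
  cases h <;> assumption

theorem inter (h : Branched f k X) (A : Finset V)
    (hg : ∀ Y ⊆ X, f Y ≤ k → g (Y ∩ A) ≤ k) : Branched g k (X ∩ A) := by
  induction h with
  | empty h0 =>
    have := hg ∅ subset_rfl h0
    rw [Finset.empty_inter] at this ⊢
    exact .empty this
  | singleton v hv =>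
    have := hg {v} subset_rfl hv
    by_cases hA : v ∈ A
    · rw [Finset.singleton_inter_of_mem hA] at this ⊢
      exact .singleton v this
    · rw [Finset.singleton_inter_of_notMem hA] at this ⊢
      exact .empty this
  | @union X Y hX hY hd hf ihX ihY =>
    have := hg _ subset_rfl hf
    rw [Finset.union_inter_distrib_right] at this ⊢
    refine .union (ihX fun Z hZ => hg Z (hZ.trans Finset.subset_union_left))
      (ihY fun Z hZ => hg Z (hZ.trans Finset.subset_union_right)) ?_ this
    exact hd.mono Finset.inter_subset_left Finset.inter_subset_left

theorem of_le (h : Branched f k X) (hg : ∀ Y ⊆ X, f Y ≤ k → g Y ≤ k) : Branched g k X := by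
  have := h.inter (g := g) X fun Y hY hf => by
    rw [Finset.inter_eq_left.2 hY]; exact hg Y hY hf
  rwa [Finset.inter_self] at this

/-- In a tree for `S`, the outside of `X` consists of the outside of the parent `X ∪ Y` of `X` and
of the sibling `Y`. -/
theorem sdiff_left (hs : ∀ Y ⊆ S, f (S \ Y) = f Y) (hX : Branched f k X) (hY : Branched f k Y)
    (hd : Disjoint X Y) (hS : X ∪ Y ⊆ S) (hc : Branched f k (S \ (X ∪ Y))) :
    Branched f k (S \ X) := by
  have e : S \ X = (S \ (X ∪ Y)) ∪ Y := by
    ext z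
    have h1 : z ∈ Y → z ∈ S := fun h => hS (Finset.mem_union_right _ h)
    have h2 : z ∈ X → z ∉ Y := fun a b => Finset.disjoint_left.1 hd a b
    simp only [Finset.mem_sdiff, Finset.mem_union]
    clear hX hY hc
    tauto
  have hle : f (S \ X) ≤ k := by rw [hs X (Finset.subset_union_left.trans hS)]; exact hX.le
  rw [e] at hle ⊢
  exact .union hc hY (Finset.disjoint_left.2 fun z hz hz' =>
    (Finset.mem_sdiff.1 hz).2 (Finset.mem_union_right _ hz')) hle

theorem sdiff_right (hs : ∀ Y ⊆ S, f (S \ Y) = f Y) (hX : Branched f k X) (hY : Branched f k Y)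
    (hd : Disjoint X Y) (hS : X ∪ Y ⊆ S) (hc : Branched f k (S \ (X ∪ Y))) :
    Branched f k (S \ Y) := by
  rw [Finset.union_comm] at hS hc
  exact sdiff_left hs hY hX hd.symm hS hc

/-- A tree can be rerooted at any of its leaves, when `f` takes equal values on complementary
subsets of `S`. -/
theorem erase (hs : ∀ Y ⊆ S, f (S \ Y) = f Y) (h : Branched f k S) {b : V} (hb : b ∈ S) :
    Branched f k (S.erase b) := by
  -- The outer part of the tree is carried along while descending from the root to the leaf `b`.
  have key : ∀ X, Branched f k X → X ⊆ S → b ∈ X → Branched f k (S \ X) →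
      Branched f k (S.erase b) := by
    intro X hX
    induction hX with
    | empty _ => intro _ hb; simp at hb
    | singleton v _ =>
      intro _ hb h
      rw [Finset.mem_singleton] at hb
      subst hb
      rwa [Finset.sdiff_singleton_eq_erase] at h
    | @union X Y hX hY hd hf ihX ihY =>
      intro hXY hb hc
      have hXS := Finset.subset_union_left.trans hXY
      have hYS := Finset.subset_union_right.trans hXY
      rcases Finset.mem_union.1 hb with hb | hb
      · exact ihX hXS hb (sdiff_left hs hX hY hd hXY hc)
      · exact ihY hYS hb (sdiff_right hs hX hY hd hXY hc)
  refine key S h subset_rfl hb ?_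
  rw [Finset.sdiff_self]
  refine .empty ?_
  rw [← Finset.sdiff_self S, hs S subset_rfl]
  exact h.le

/-- Descending from the root into subtrees with at least six leaves, one meets a set of leaves whose
size lies between `6` and `10`. -/
theorem exists_card_mem_Icc (h : Branched f k X) (hX : 6 ≤ X.card) :
    ∃ Y ⊆ X, f Y ≤ k ∧ 6 ≤ Y.card ∧ Y.card ≤ 10 := by
  induction h with
  | empty _ => simp at hX
  | singleton v _ => simp at hX
  | @union X Y hX' hY' hd hf ihX ihY =>
    have hc := Finset.card_union_of_disjoint hd
    by_cases h10 : (X ∪ Y).card ≤ 10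
    · exact ⟨_, subset_rfl, hf, hX, h10⟩
    · by_cases h6 : 6 ≤ X.card
      · obtain ⟨Z, hZ, h⟩ := ihX h6
        exact ⟨Z, hZ.trans Finset.subset_union_left, h⟩
      · obtain ⟨Z, hZ, h⟩ := ihY (by omega)
        exact ⟨Z, hZ.trans Finset.subset_union_right, h⟩

/-- If `f` is symmetric and submodular on the subsets of `S`, and `B` is *titanic*, that is, every
partition of `B` into three parts has a part of value at least `f B`, then a tree for `S` yields a
tree for `S \ B`. -/
theorem sdiff_of_titanic (hs : ∀ Y ⊆ S, f (S \ Y) = f Y)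
    (hsub : ∀ Y ⊆ S, ∀ Z ⊆ S, f (Y ∩ Z) + f (Y ∪ Z) ≤ f Y + f Z)
    (h : Branched f k S) (hB : B ⊆ S) (hBk : f B ≤ k)
    (ht : ∀ Z₁ Z₂ Z₃ : Finset V, Z₁ ∪ Z₂ ∪ Z₃ = B → Disjoint Z₁ Z₂ → Disjoint Z₁ Z₃ →
      Disjoint Z₂ Z₃ → f B ≤ f Z₁ ∨ f B ≤ f Z₂ ∨ f B ≤ f Z₃) :
    Branched f k (S \ B) := by
  have hpos : ∀ Y ⊆ S, ∀ Z ⊆ S, f (Y \ Z) ≤ f Y ∨ f (Z \ Y) ≤ f Z := by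
    intro Y hY Z hZ
    have h1 := hsub Y hY (S \ Z) Finset.sdiff_subset
    have e1 : Y ∩ (S \ Z) = Y \ Z := by
      ext z; have := @hY z; simp only [Finset.mem_sdiff, Finset.mem_inter]; tauto
    have e2 : Y ∪ S \ Z = S \ (Z \ Y) := by
      ext z; have := @hY z; simp only [Finset.mem_sdiff, Finset.mem_union]; tauto
    rw [e1, e2, hs Z hZ, hs (Z \ Y) (Finset.sdiff_subset.trans hZ)] at h1
    omega
  -- Uncrossing turns a cover of `B` into a partition.
  have hdis : ∀ Z₁ ⊆ B, ∀ Z₂ ⊆ B, f Z₁ < f B → f Z₂ < f B →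
      ∃ W₁ ⊆ Z₁, ∃ W₂ ⊆ Z₂, f W₁ < f B ∧ f W₂ < f B ∧ W₁ ∪ W₂ = Z₁ ∪ Z₂ ∧ Disjoint W₁ W₂ := by
    intro Z₁ h1 Z₂ h2 hf1 hf2
    rcases hpos Z₁ (h1.trans hB) Z₂ (h2.trans hB) with h | h
    · exact ⟨Z₁ \ Z₂, Finset.sdiff_subset, Z₂, subset_rfl, h.trans_lt hf1, hf2,
        Finset.sdiff_union_self_eq_union, Finset.sdiff_disjoint⟩
    · exact ⟨Z₁, subset_rfl, Z₂ \ Z₁, Finset.sdiff_subset, hf1, h.trans_lt hf2,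
        Finset.union_sdiff_self_eq_union, Finset.disjoint_sdiff⟩
  have hcov : ∀ Z₁ ⊆ B, ∀ Z₂ ⊆ B, ∀ Z₃ ⊆ B, B ⊆ Z₁ ∪ Z₂ ∪ Z₃ →
      ¬ (f Z₁ < f B ∧ f Z₂ < f B ∧ f Z₃ < f B) := by
    rintro Z₁ h1 Z₂ h2 Z₃ h3 hc ⟨hf1, hf2, hf3⟩
    obtain ⟨W₁, a1, W₂, a2, c1, c2, e12, d12⟩ := hdis Z₁ h1 Z₂ h2 hf1 hf2
    obtain ⟨U₁, b1, W₃, b3, g1, g3, e13, d13⟩ := hdis W₁ (a1.trans h1) Z₃ h3 c1 hf3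
    obtain ⟨U₂, i2, U₃, i3, j2, j3, e23, d23⟩ := hdis W₂ (a2.trans h2) W₃ (b3.trans h3) c2 g3
    have hU : U₁ ∪ U₂ ∪ U₃ = B := by
      apply subset_antisymm
      · exact Finset.union_subset (Finset.union_subset (b1.trans (a1.trans h1))
          (i2.trans (a2.trans h2))) (i3.trans (b3.trans h3))
      · have e : U₁ ∪ U₂ ∪ U₃ = Z₁ ∪ Z₂ ∪ Z₃ := by
          calc U₁ ∪ U₂ ∪ U₃ = (U₁ ∪ W₃) ∪ W₂ := by rw [Finset.union_assoc, e23]; ac_rfl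
            _ = (W₁ ∪ W₂) ∪ Z₃ := by rw [e13]; ac_rfl
            _ = Z₁ ∪ Z₂ ∪ Z₃ := by rw [e12]
        rwa [e]
    rcases ht U₁ U₂ U₃ hU (d12.mono b1 i2) (d13.mono_right i3) d23 with h | h | h <;> omega
  -- `heavy D`: no superset of `D` inside `B` has value below `f B`.
  let heavy : Finset V → Prop := fun X => ∀ Z, X ∩ B ⊆ Z → Z ⊆ B → f B ≤ f Z
  have hlight : ∀ X ⊆ S, Branched f k X → heavy (S \ X) → Branched f k (X \ B) := by
    intro X hX hb hh
    have e : X \ B = X ∩ (S \ B) := by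
      ext z; have := @hX z; simp only [Finset.mem_sdiff, Finset.mem_inter]; tauto
    rw [e]
    refine hb.inter _ fun Y hY hf => ?_
    have hYS := hY.trans hX
    have e : Y ∩ (S \ B) = S \ ((S \ Y) ∪ B) := by
      ext z; have := @hYS z; simp only [Finset.mem_sdiff, Finset.mem_inter, Finset.mem_union]; tauto
    rw [e, hs _ (Finset.union_subset Finset.sdiff_subset hB)]
    have h1 := hsub (S \ Y) Finset.sdiff_subset B hB
    have h2 := hh ((S \ Y) ∩ B)
      (Finset.inter_subset_inter_right (Finset.sdiff_subset_sdiff subset_rfl hY))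
      Finset.inter_subset_right
    rw [hs Y hYS] at h1
    omega
  have hA : f (S \ B) ≤ k := by rwa [hs B hB]
  have hjoin : ∀ X ⊆ S, Branched f k X → Branched f k (S \ X) → heavy X → heavy (S \ X) →
      Branched f k (S \ B) := by
    intro X hX h1 h2 h3 h4
    have b1 := hlight X hX h1 h4
    have b2 := hlight (S \ X) Finset.sdiff_subset h2 (by
      rwa [Finset.sdiff_sdiff_eq_self hX])
    have e : S \ B = X \ B ∪ (S \ X) \ B := by
      ext z; have := @hX z; simp only [Finset.mem_sdiff, Finset.mem_union]; tauto
    rw [e] at hA ⊢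
    exact .union b1 b2 (Finset.disjoint_left.2 fun z hz hz' => by
      simp only [Finset.mem_sdiff] at hz hz'; tauto) hA
  have hB0 : ∀ X, f B ≤ f ∅ → heavy X := by
    intro X h0 Z _ hZ
    have h1 := hsub Z (hZ.trans hB) (S \ Z) Finset.sdiff_subset
    have e1 : Z ∩ (S \ Z) = ∅ := Finset.inter_sdiff_self _ _
    have e2 : Z ∪ S \ Z = S \ ∅ := by
      rw [Finset.union_sdiff_of_subset (hZ.trans hB), Finset.sdiff_empty]
    rw [e1, e2, hs Z (hZ.trans hB), hs ∅ (Finset.empty_subset _)] at h1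
    omega
  have key : ∀ X, Branched f k X → X ⊆ S → Branched f k (S \ X) → heavy X →
      Branched f k (S \ B) := by
    intro X hX
    induction hX with
    | empty h0 =>
      intro hXS hc hh
      exact hjoin ∅ hXS (.empty h0) hc hh
        (hB0 _ (hh ∅ (by simp) (Finset.empty_subset _)))
    | singleton v hv =>
      intro hXS hc hh
      by_cases hvB : v ∈ B
      · have := hlight _ Finset.sdiff_subset hc (by rwa [Finset.sdiff_sdiff_eq_self hXS])
        have e : (S \ {v}) \ B = S \ B := by
          ext z
          simp only [Finset.mem_sdiff, Finset.mem_singleton]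
          constructor
          · tauto
          · rintro ⟨h1, h2⟩
            exact ⟨⟨h1, fun h => h2 (h ▸ hvB)⟩, h2⟩
        rwa [e] at this
      · exact hjoin {v} hXS (.singleton v hv) hc hh (hB0 _ (hh ∅ (by
          rw [Finset.singleton_inter_of_notMem hvB]) (Finset.empty_subset _)))
    | @union X Y hX hY hd hf ihX ihY =>
      intro hXY hc hh
      have hXS := Finset.subset_union_left.trans hXY
      have hYS := Finset.subset_union_right.trans hXY
      by_cases hh' : heavy (S \ (X ∪ Y))
      · exact hjoin _ hXY (.union hX hY hd hf) hc hh hh'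
      by_cases h1 : heavy X
      · exact ihX hXS (sdiff_left hs hX hY hd hXY hc) h1
      by_cases h2 : heavy Y
      · exact ihY hYS (sdiff_right hs hX hY hd hXY hc) h2
      exfalso
      simp only [heavy, not_forall, not_le] at hh' h1 h2
      obtain ⟨Z₁, p1, q1, r1⟩ := h1
      obtain ⟨Z₂, p2, q2, r2⟩ := h2
      obtain ⟨Z₃, p3, q3, r3⟩ := hh'
      refine hcov Z₁ q1 Z₂ q2 Z₃ q3 ?_ ⟨r1, r2, r3⟩
      intro z hz
      by_cases hzX : z ∈ X
      · exact Finset.mem_union_left _ (Finset.mem_union_left _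
          (p1 (Finset.mem_inter.2 ⟨hzX, hz⟩)))
      by_cases hzY : z ∈ Y
      · exact Finset.mem_union_left _ (Finset.mem_union_right _
          (p2 (Finset.mem_inter.2 ⟨hzY, hz⟩)))
      · refine Finset.mem_union_right _ (p3 (Finset.mem_inter.2 ⟨Finset.mem_sdiff.2
          ⟨hB hz, fun h => ?_⟩, hz⟩))
        exact (Finset.mem_union.1 h).elim hzX hzY
  refine key S h subset_rfl ?_ ?_
  · rw [Finset.sdiff_self]
    refine .empty ?_
    rw [← Finset.sdiff_self S, hs S subset_rfl]
    exact h.le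
  · intro Z h1 h2
    rw [Finset.inter_eq_right.2 hB] at h1
    rw [subset_antisymm h2 h1]

end Branched

end Branched

/-! ### From rank-decompositions to branched sets -/

section Component

variable {N : Type*} {T : SimpleGraph N}

/-- The vertex set of the component of `T - xy` that contains `x`. -/
def component (T : SimpleGraph N) (x y : N) : Set N :=
  {z | (T.deleteEdges {s(x, y)}).Reachable x z}

theorem self_mem_component (x y : N) : x ∈ T.component x y :=
  Reachable.refl _

theorem mem_component_of_adj {x y z z' : N} (hz : z ∈ T.component x y) (h : T.Adj z z')
    (hne : s(z, z') ≠ s(x, y)) : z' ∈ T.component x y :=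
  Reachable.trans hz (Adj.reachable (deleteEdges_adj.2 ⟨h, hne⟩))

/-- Induction along walks of `T - xy` that start at `x`. -/
theorem component_induction {x y : N} {P : N → Prop} (h0 : P x)
    (hs : ∀ z z', z ∈ T.component x y → P z → T.Adj z z' → s(z, z') ≠ s(x, y) → P z')
    {z : N} (hz : z ∈ T.component x y) : P z := by
  have h := (reachable_iff_reflTransGen _ _).1 hz
  induction h with
  | refl => exact h0
  | @tail b c hb hbc ih =>
    have hb' : b ∈ T.component x y := (reachable_iff_reflTransGen _ _).2 hb
    have := deleteEdges_adj.1 hbc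
    exact hs b c hb' (ih hb') this.1 this.2

theorem IsAcyclic.notMem_component (hT : T.IsAcyclic) {x y : N} (h : T.Adj x y) :
    y ∉ T.component x y :=
  isBridge_iff.1 (isAcyclic_iff_forall_adj_isBridge.1 hT h)

theorem IsAcyclic.component_subset (hT : T.IsAcyclic) {x y p : N} (hp : T.Adj x p) (hpy : p ≠ y) :
    T.component p x ⊆ T.component x y := by
  intro z hz
  have hx : x ∉ T.component p x := hT.notMem_component hp.symm
  have : z ∈ T.component x y ∧ z ∈ T.component p x := by
    refine component_induction (P := fun z => z ∈ T.component x y ∧ z ∈ T.component p x)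
      ⟨?_, self_mem_component _ _⟩ ?_ hz
    · refine mem_component_of_adj (self_mem_component _ _) hp ?_
      rw [Ne, Sym2.congr_right]
      exact hpy
    · rintro z z' h1 ⟨h2, _⟩ ha hne
      have h3 := mem_component_of_adj h1 ha hne
      refine ⟨mem_component_of_adj h2 ha fun h => ?_, h3⟩
      rcases Sym2.eq_iff.1 h with ⟨rfl, _⟩ | ⟨_, rfl⟩
      · exact hx h1
      · exact hx h3
  exact this.1

theorem IsAcyclic.disjoint_component (hT : T.IsAcyclic) {x p q : N} (hp : T.Adj x p)
    (hq : T.Adj x q) (hpq : p ≠ q) : Disjoint (T.component p x) (T.component q x) := by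
  refine Set.disjoint_left.2 fun z hz hz' => ?_
  have h1 : z ∈ T.component x p := hT.component_subset hq hpq.symm hz'
  have h2 := hT.notMem_component hp.symm
  refine h2 (Reachable.trans hz ?_)
  rw [Sym2.eq_swap]
  exact Reachable.symm h1

/-- In a tree, the component of `T - xy` that contains `x` consists of `x` and of the components
behind the other neighbours of `x`. -/
theorem component_eq {x y : N} (hT : T.IsAcyclic) :
    T.component x y = {x} ∪ ⋃ p ∈ T.neighborSet x \ {y}, T.component p x := by
  apply subset_antisymm
  · intro z hz
    refine component_induction (P := fun z => z ∈ {x} ∪ ⋃ p ∈ T.neighborSet x \ {y},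
      T.component p x) (Or.inl rfl) ?_ hz
    rintro z z' - h ha hne
    rcases h with rfl | h
    · refine Or.inr (Set.mem_biUnion (x := z') ⟨ha, fun h => hne ?_⟩ (self_mem_component _ _))
      rw [Set.mem_singleton_iff] at h
      rw [h]
    · simp only [Set.mem_iUnion] at h
      obtain ⟨p, hp, hz⟩ := h
      by_cases he : s(z, z') = s(p, x)
      · rcases Sym2.eq_iff.1 he with ⟨_, rfl⟩ | ⟨_, rfl⟩
        · exact Or.inl rfl
        · exact Or.inr (Set.mem_biUnion hp (self_mem_component _ _))
      · exact Or.inr (Set.mem_biUnion hp (mem_component_of_adj hz ha he))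
  · refine Set.union_subset (Set.singleton_subset_iff.2 (self_mem_component _ _)) ?_
    refine Set.iUnion₂_subset fun p hp => hT.component_subset hp.1 hp.2

theorem Connected.mem_component_or (hT : T.Connected) (x y z : N) :
    z ∈ T.component x y ∨ z ∈ T.component y x := by
  have h := (reachable_iff_reflTransGen _ _).1 (hT.preconnected x z)
  induction h with
  | refl => exact Or.inl (self_mem_component _ _)
  | @tail b c hb hbc ih =>
    by_cases he : s(b, c) = s(x, y)
    · rcases Sym2.eq_iff.1 he with ⟨_, rfl⟩ | ⟨_, rfl⟩
      · exact Or.inr (self_mem_component _ _)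
      · exact Or.inl (self_mem_component _ _)
    · refine ih.imp (mem_component_of_adj · hbc he) (mem_component_of_adj · hbc ?_)
      rwa [Sym2.eq_swap (a := y)]

theorem IsAcyclic.disjoint_component_swap (hT : T.IsAcyclic) {x y : N} (h : T.Adj x y) :
    Disjoint (T.component x y) (T.component y x) := by
  refine Set.disjoint_left.2 fun z hz hz' => hT.notMem_component h (Reachable.trans hz ?_)
  rw [Sym2.eq_swap]
  exact Reachable.symm hz'

end Component

namespace RankDecomposition

variable {V : Type*} [Fintype V] (D : RankDecomposition V)

open Classical in
/-- The set of vertices mapped into the component of `T - xy` that contains `x`. -/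
noncomputable def part (x y : D.Node) : Finset V :=
  {u | (D.leaf u : D.Node) ∈ D.tree.component x y}

theorem mem_part {x y : D.Node} {u : V} :
    u ∈ D.part x y ↔ (D.leaf u : D.Node) ∈ D.tree.component x y := by
  simp [part]

theorem coe_part {x y : D.Node} (h : D.tree.Adj x y) :
    (D.part x y : Set V) = D.side ⟨(x, y), h⟩ := by
  ext u
  rw [Finset.mem_coe, mem_part]
  rfl

/-- The side of an edge is split at the end of the edge, into the sides of the two other edges
there. -/
theorem branched_part [DecidableEq V] {f : Finset V → ℕ} {k : ℕ}
    (hf : ∀ x y, D.tree.Adj x y → f (D.part x y) ≤ k) {x y : D.Node} (h : D.tree.Adj x y) :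
    Branched f k (D.part x y) := by
  have := D.finite_node
  have hT := D.isTree.isAcyclic
  induction hn : (D.tree.component x y).ncard using Nat.strong_induction_on generalizing x y with
  | _ n ih =>
    have hlt : ∀ p, D.tree.Adj x p → p ≠ y → Branched f k (D.part p x) := by
      intro p hp hpy
      refine ih _ ?_ hp.symm rfl
      rw [← hn]
      refine Set.ncard_lt_ncard ((hT.component_subset hp hpy).ssubset_of_mem_notMem
        (self_mem_component x y) (hT.notMem_component hp.symm))
    have hxy := hf x y h
    have hmem := component_eq (x := x) (y := y) hT
    rcases D.subcubic x with h1 | h3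
    · obtain ⟨y', hy'⟩ := Set.ncard_eq_one.1 h1
      have hy : y = y' := by
        have : y ∈ D.tree.neighborSet x := h
        rw [hy'] at this; exact this
      rw [hy', hy] at hmem
      have e : D.part x y = {D.leaf.symm ⟨x, h1⟩} := by
        ext u
        rw [mem_part, hy, hmem, Finset.mem_singleton, Equiv.eq_symm_apply, Subtype.ext_iff]
        simp
      rw [e] at hxy ⊢
      exact .singleton _ hxy
    · obtain ⟨p, q, hpy, hqy, hpq, hN⟩ : ∃ p q, p ≠ y ∧ q ≠ y ∧ p ≠ q ∧
          D.tree.neighborSet x = {y, p, q} := by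
        obtain ⟨a, b, c, hab, hac, hbc, hN⟩ := Set.ncard_eq_three.1 h3
        have : y ∈ D.tree.neighborSet x := h
        rw [hN] at this
        rcases this with rfl | rfl | rfl
        · exact ⟨b, c, hab.symm, hac.symm, hbc, hN⟩
        · exact ⟨a, c, hab, hbc.symm, hac, hN.trans (Set.insert_comm _ _ _)⟩
        · exact ⟨a, b, hac, hbc, hab, hN.trans (by ext; simp; tauto)⟩
      have hp : D.tree.Adj x p := by
        have : p ∈ D.tree.neighborSet x := by rw [hN]; simp
        exact this
      have hq : D.tree.Adj x q := by
        have : q ∈ D.tree.neighborSet x := by rw [hN]; simp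
        exact this
      have hNy : D.tree.neighborSet x \ {y} = {p, q} := by
        rw [hN]; ext z
        simp only [Set.mem_sdiff, Set.mem_insert_iff, Set.mem_singleton_iff]
        constructor
        · tauto
        · rintro (rfl | rfl) <;> tauto
      rw [hNy, Set.biUnion_pair] at hmem
      have e : D.part x y = D.part p x ∪ D.part q x := by
        ext u
        have hne : (D.leaf u : D.Node) ≠ x := by
          intro hu
          have := (D.leaf u).2
          rw [hu, h3] at this
          omega
        rw [Finset.mem_union, mem_part, mem_part, mem_part, hmem]
        simp [hne]
      rw [e] at hxy ⊢
      refine .union (hlt p hp hpy) (hlt q hq hqy) ?_ hxy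
      refine Finset.disjoint_left.2 fun u hu hu' => ?_
      rw [mem_part] at hu hu'
      exact Set.disjoint_left.1 (hT.disjoint_component hp hq hpq) hu hu'

theorem branched_univ [DecidableEq V] {f : Finset V → ℕ} {k : ℕ}
    (hf : ∀ x y, D.tree.Adj x y → f (D.part x y) ≤ k) (hu : f Finset.univ ≤ k) :
    Branched f k Finset.univ := by
  have := D.finite_node
  have hT := D.isTree
  obtain ⟨x⟩ := hT.connected.nonempty
  obtain ⟨y, h⟩ : ∃ y, D.tree.Adj x y := by
    have : (D.tree.neighborSet x).Nonempty := by
      rw [← Set.ncard_pos]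
      rcases D.subcubic x with h | h <;> omega
    exact this
  have e : (Finset.univ : Finset V) = D.part x y ∪ D.part y x := by
    ext u
    simp only [Finset.mem_univ, Finset.mem_union, mem_part, true_iff]
    exact hT.connected.mem_component_or x y _
  rw [e] at hu ⊢
  refine .union (D.branched_part hf h) (D.branched_part hf h.symm) ?_ hu
  refine Finset.disjoint_left.2 fun u hu hu' => ?_
  rw [mem_part] at hu hu'
  exact Set.disjoint_left.1 (hT.isAcyclic.disjoint_component_swap h) hu hu'

end RankDecomposition

/-! ### From branched sets to rank-decompositions -/

/-- Rooted binary trees with leaves labelled by elements of `V`. -/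
inductive LeafTree (V : Type*)
  | leaf : V → LeafTree V
  | node : LeafTree V → LeafTree V → LeafTree V

namespace LeafTree

variable {V : Type*}

/-- The nodes of a tree. They form a type in the lowest universe, whatever the universe of `V`;
in `Option (Pos l ⊕ Pos r)` the value `none` is the root. -/
def Pos : LeafTree V → Type
  | leaf _ => Unit
  | node l r => Option (Pos l ⊕ Pos r)

theorem finite_pos : ∀ t : LeafTree V, Finite t.Pos
  | leaf _ => inferInstanceAs (Finite Unit)
  | node l r => by
    have := finite_pos l
    have := finite_pos r
    exact inferInstanceAs (Finite (Option (Pos l ⊕ Pos r)))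

/-- The root of a composite tree. -/
def top {l r : LeafTree V} : (node l r).Pos := (none : Option (Pos l ⊕ Pos r))

/-- A node of the first subtree, as a node of the composite tree. -/
def left {l r : LeafTree V} (x : l.Pos) : (node l r).Pos := (some (.inl x) : Option (Pos l ⊕ Pos r))

/-- A node of the second subtree, as a node of the composite tree. -/
def right {l r : LeafTree V} (x : r.Pos) : (node l r).Pos :=
  (some (.inr x) : Option (Pos l ⊕ Pos r))

theorem pos_cases {l r : LeafTree V} :
    ∀ x : (node l r).Pos, x = top ∨ (∃ y, x = left y) ∨ ∃ y, x = right y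
  | none => Or.inl rfl
  | some (.inl y) => Or.inr (Or.inl ⟨y, rfl⟩)
  | some (.inr y) => Or.inr (Or.inr ⟨y, rfl⟩)

theorem left_injective {l r : LeafTree V} : Function.Injective (left : l.Pos → (node l r).Pos) :=
  fun _ _ h => Sum.inl_injective (Option.some_injective _ h)

theorem right_injective {l r : LeafTree V} : Function.Injective (right : r.Pos → (node l r).Pos) :=
  fun _ _ h => Sum.inr_injective (Option.some_injective _ h)

theorem left_ne_top {l r : LeafTree V} (x : l.Pos) : (left x : (node l r).Pos) ≠ top :=
  Option.some_ne_none _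

theorem right_ne_top {l r : LeafTree V} (x : r.Pos) : (right x : (node l r).Pos) ≠ top :=
  Option.some_ne_none _

theorem left_ne_right {l r : LeafTree V} (x : l.Pos) (y : r.Pos) :
    (left x : (node l r).Pos) ≠ right y :=
  fun h => Sum.inl_ne_inr (Option.some_injective _ h)

/-- The root of a tree. -/
def root : (t : LeafTree V) → t.Pos
  | leaf _ => ()
  | node _ _ => none

/-- The parent of a node; the root has none. -/
def parent : (t : LeafTree V) → t.Pos → Option t.Pos
  | leaf _, _ => none
  | node _ _, none => none
  | node l _, some (.inl x) => some ((parent l x).map .inl)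
  | node _ r, some (.inr x) => some ((parent r x).map .inr)

theorem parent_top {l r : LeafTree V} : (node l r).parent top = none := rfl

theorem parent_left_eq_some {l r : LeafTree V} {x y : l.Pos} :
    (node l r).parent (left x) = some (left y) ↔ l.parent x = some y := by
  change some ((l.parent x).map _) = some (some _) ↔ _
  cases l.parent x <;> simp

theorem parent_right_eq_some {l r : LeafTree V} {x y : r.Pos} :
    (node l r).parent (right x) = some (right y) ↔ r.parent x = some y := by
  change some ((r.parent x).map _) = some (some _) ↔ _
  cases r.parent x <;> simp

theorem parent_left_ne_right {l r : LeafTree V} {x : l.Pos} {y : r.Pos} :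
    (node l r).parent (left x) ≠ some (right y) := by
  change some ((l.parent x).map _) ≠ some (some _)
  cases l.parent x <;> simp

theorem parent_right_ne_left {l r : LeafTree V} {x : r.Pos} {y : l.Pos} :
    (node l r).parent (right x) ≠ some (left y) := by
  change some ((r.parent x).map _) ≠ some (some _)
  cases r.parent x <;> simp

theorem parent_left_eq_top {l r : LeafTree V} {x : l.Pos} :
    (node l r).parent (left x) = some top ↔ l.parent x = none := by
  change some ((l.parent x).map _) = some none ↔ _
  simp

theorem parent_right_eq_top {l r : LeafTree V} {x : r.Pos} :
    (node l r).parent (right x) = some top ↔ r.parent x = none := by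
  change some ((r.parent x).map _) = some none ↔ _
  simp

theorem parent_left_ne_none {l r : LeafTree V} {x : l.Pos} :
    (node l r).parent (left x) ≠ none :=
  Option.some_ne_none _

theorem parent_right_ne_none {l r : LeafTree V} {x : r.Pos} :
    (node l r).parent (right x) ≠ none :=
  Option.some_ne_none _

/-- The distance of a node from the root. -/
def depth : (t : LeafTree V) → t.Pos → ℕ
  | leaf _, _ => 0
  | node _ _, none => 0
  | node l _, some (.inl x) => depth l x + 1
  | node _ r, some (.inr x) => depth r x + 1

/-- The label of a node, if it is a leaf. -/
def val : (t : LeafTree V) → t.Pos → Option V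
  | leaf v, _ => some v
  | node _ _, none => none
  | node l _, some (.inl x) => val l x
  | node _ r, some (.inr x) => val r x

variable [DecidableEq V]

/-- The set of labels of the leaves of a tree. -/
def labels : LeafTree V → Finset V
  | leaf v => {v}
  | node l r => labels l ∪ labels r

/-- The set of labels of the leaves below a node. -/
def labelsBelow : (t : LeafTree V) → t.Pos → Finset V
  | leaf v, _ => {v}
  | node l r, none => labels l ∪ labels r
  | node l _, some (.inl x) => labelsBelow l x
  | node _ r, some (.inr x) => labelsBelow r x

/-- No label occurs twice. -/
def Nodup : LeafTree V → Prop
  | leaf _ => True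
  | node l r => Nodup l ∧ Nodup r ∧ Disjoint (labels l) (labels r)

omit [DecidableEq V] in
theorem depth_lt {t : LeafTree V} {x y : t.Pos} (h : t.parent x = some y) :
    t.depth y < t.depth x := by
  induction t with
  | leaf _ => exact (Option.some_ne_none _ h.symm).elim
  | node l r ihl ihr =>
    rcases pos_cases x with rfl | ⟨x, rfl⟩ | ⟨x, rfl⟩ <;>
      rcases pos_cases y with rfl | ⟨y, rfl⟩ | ⟨y, rfl⟩
    · exact (Option.some_ne_none _ h.symm).elim
    · exact (Option.some_ne_none _ h.symm).elim
    · exact (Option.some_ne_none _ h.symm).elim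
    · exact Nat.succ_pos _
    · exact Nat.succ_lt_succ (ihl (parent_left_eq_some.1 h))
    · exact (parent_left_ne_right h).elim
    · exact Nat.succ_pos _
    · exact (parent_right_ne_left h).elim
    · exact Nat.succ_lt_succ (ihr (parent_right_eq_some.1 h))

omit [DecidableEq V] in
theorem parent_eq_none {t : LeafTree V} {x : t.Pos} : t.parent x = none ↔ x = t.root := by
  cases t with
  | leaf _ => exact ⟨fun _ => rfl, fun _ => rfl⟩
  | node l r =>
    change _ ↔ x = top
    rcases pos_cases x with rfl | ⟨x, rfl⟩ | ⟨x, rfl⟩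
    · exact ⟨fun _ => rfl, fun _ => rfl⟩
    · simp [parent_left_ne_none, left_ne_top]
    · simp [parent_right_ne_none, right_ne_top]

theorem labels_nonempty : ∀ t : LeafTree V, t.labels.Nonempty
  | leaf v => ⟨v, Finset.mem_singleton_self v⟩
  | node l _ => (labels_nonempty l).mono Finset.subset_union_left

theorem labelsBelow_nonempty : ∀ (t : LeafTree V) (x : t.Pos), (t.labelsBelow x).Nonempty
  | leaf v, _ => ⟨v, Finset.mem_singleton_self v⟩
  | node l _, none => (labels_nonempty l).mono Finset.subset_union_left
  | node l _, some (.inl x) => labelsBelow_nonempty l x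
  | node _ r, some (.inr x) => labelsBelow_nonempty r x

theorem labelsBelow_subset : ∀ (t : LeafTree V) (x : t.Pos), t.labelsBelow x ⊆ t.labels
  | leaf _, _ => subset_rfl
  | node _ _, none => subset_rfl
  | node l _, some (.inl x) => (labelsBelow_subset l x).trans Finset.subset_union_left
  | node _ r, some (.inr x) => (labelsBelow_subset r x).trans Finset.subset_union_right

theorem labelsBelow_eq_of_val : ∀ {t : LeafTree V} {x : t.Pos} {v : V}, t.val x = some v →
    t.labelsBelow x = {v}
  | leaf _, _, _, h => by
    simp only [val, Option.some.injEq] at h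
    subst h; rfl
  | node _ _, none, _, h => by simp [val] at h
  | node l _, some (.inl x), _, h => labelsBelow_eq_of_val (t := l) h
  | node _ r, some (.inr x), _, h => labelsBelow_eq_of_val (t := r) h

theorem mem_labels_of_val {t : LeafTree V} {x : t.Pos} {v : V} (h : t.val x = some v) :
    v ∈ t.labels :=
  labelsBelow_subset t x (by rw [labelsBelow_eq_of_val h]; exact Finset.mem_singleton_self v)

theorem exists_val_eq : ∀ {t : LeafTree V} {v : V}, v ∈ t.labels → ∃ x, t.val x = some v
  | leaf _, _, h => ⟨(), by rw [Finset.mem_singleton.1 h]; rfl⟩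
  | node l r, v, h => by
    rcases Finset.mem_union.1 h with h | h
    · obtain ⟨x, hx⟩ := exists_val_eq h
      exact ⟨some (.inl x), hx⟩
    · obtain ⟨x, hx⟩ := exists_val_eq h
      exact ⟨some (.inr x), hx⟩

theorem val_injective : ∀ {t : LeafTree V}, t.Nodup → ∀ {x y : t.Pos} {v : V},
    t.val x = some v → t.val y = some v → x = y
  | leaf _, _, _, _, _, _, _ => rfl
  | node _ _, _, none, _, _, h, _ => by simp [val] at h
  | node _ _, _, _, none, _, _, h => by simp [val] at h
  | node l r, hn, some (.inl x), some (.inl y), v, h, h' => by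
    rw [val_injective (t := l) hn.1 h h']
  | node l r, hn, some (.inr x), some (.inr y), v, h, h' => by
    rw [val_injective (t := r) hn.2.1 h h']
  | node l r, hn, some (.inl x), some (.inr y), v, h, h' =>
    (Finset.disjoint_left.1 hn.2.2 (mem_labels_of_val (t := l) h)
      (mem_labels_of_val (t := r) h')).elim
  | node l r, hn, some (.inr x), some (.inl y), v, h, h' =>
    (Finset.disjoint_left.1 hn.2.2 (mem_labels_of_val (t := l) h')
      (mem_labels_of_val (t := r) h)).elim

theorem parent_of_labelsBelow_subset : ∀ {t : LeafTree V}, t.Nodup → ∀ {x z : t.Pos},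
    t.labelsBelow z ⊆ t.labelsBelow x → z ≠ x →
      ∃ w, t.parent z = some w ∧ t.labelsBelow w ⊆ t.labelsBelow x
  | leaf _, _, _, _, _, h => (h rfl).elim
  | node _ _, _, none, none, _, h => (h rfl).elim
  | node _ _, _, none, some (.inl _), _, _ => ⟨_, rfl, labelsBelow_subset _ _⟩
  | node _ _, _, none, some (.inr _), _, _ => ⟨_, rfl, labelsBelow_subset _ _⟩
  | node l r, hn, some (.inl x), none, h, _ => by
    obtain ⟨v, hv⟩ := labels_nonempty r
    exact (Finset.disjoint_left.1 hn.2.2 (labelsBelow_subset l x (h (Finset.mem_union_right _ hv)))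
      hv).elim
  | node l r, hn, some (.inr x), none, h, _ => by
    obtain ⟨v, hv⟩ := labels_nonempty l
    exact (Finset.disjoint_left.1 hn.2.2 hv
      (labelsBelow_subset r x (h (Finset.mem_union_left _ hv)))).elim
  | node l r, hn, some (.inl x), some (.inr z), h, _ => by
    obtain ⟨v, hv⟩ := labelsBelow_nonempty r z
    exact (Finset.disjoint_left.1 hn.2.2 (labelsBelow_subset l x (h hv))
      (labelsBelow_subset r z hv)).elim
  | node l r, hn, some (.inr x), some (.inl z), h, _ => by
    obtain ⟨v, hv⟩ := labelsBelow_nonempty l z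
    exact (Finset.disjoint_left.1 hn.2.2 (labelsBelow_subset l z hv)
      (labelsBelow_subset r x (h hv))).elim
  | node l r, hn, some (.inl x), some (.inl z), h, hne => by
    obtain ⟨w, hw, hs⟩ := parent_of_labelsBelow_subset (t := l) hn.1 (x := x) (z := z) h
      fun e => hne (by rw [e])
    exact ⟨left w, parent_left_eq_some.2 hw, hs⟩
  | node l r, hn, some (.inr x), some (.inr z), h, hne => by
    obtain ⟨w, hw, hs⟩ := parent_of_labelsBelow_subset (t := r) hn.2.1 (x := x) (z := z) h
      fun e => hne (by rw [e])
    exact ⟨right w, parent_right_eq_some.2 hw, hs⟩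

theorem labelsBelow_subset_of_parent {t : LeafTree V} {z w : t.Pos} (h : t.parent z = some w) :
    t.labelsBelow z ⊆ t.labelsBelow w := by
  induction t with
  | leaf _ => exact (Option.some_ne_none _ h.symm).elim
  | node l r ihl ihr =>
    rcases pos_cases z with rfl | ⟨x, rfl⟩ | ⟨x, rfl⟩ <;>
      rcases pos_cases w with rfl | ⟨y, rfl⟩ | ⟨y, rfl⟩
    · exact (Option.some_ne_none _ h.symm).elim
    · exact (Option.some_ne_none _ h.symm).elim
    · exact (Option.some_ne_none _ h.symm).elim
    · exact (labelsBelow_subset l x).trans Finset.subset_union_left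
    · exact ihl (parent_left_eq_some.1 h)
    · exact (parent_left_ne_right h).elim
    · exact (labelsBelow_subset r x).trans Finset.subset_union_right
    · exact (parent_right_ne_left h).elim
    · exact ihr (parent_right_eq_some.1 h)

omit [DecidableEq V] in
theorem ncard_children {t : LeafTree V} (x : t.Pos) :
    ((∃ v, t.val x = some v) ∧ {y | t.parent y = some x}.ncard = 0) ∨
      (t.val x = none ∧ {y | t.parent y = some x}.ncard = 2) := by
  induction t with
  | leaf v =>
    refine Or.inl ⟨⟨v, rfl⟩, ?_⟩
    simp [parent]
  | node l r ihl ihr =>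
    rcases pos_cases x with rfl | ⟨x, rfl⟩ | ⟨x, rfl⟩
    · refine Or.inr ⟨rfl, ?_⟩
      have e : {y | (node l r).parent y = some top} = {left l.root, right r.root} := by
        ext y
        rw [Set.mem_ofPred_eq, Set.mem_insert_iff, Set.mem_singleton_iff]
        rcases pos_cases y with rfl | ⟨y, rfl⟩ | ⟨y, rfl⟩
        · simp [parent_top, (left_ne_top _).symm, (right_ne_top _).symm]
        · simp [parent_left_eq_top, left_ne_right, left_injective.eq_iff, parent_eq_none]
        · simp [parent_right_eq_top, (left_ne_right _ _).symm, right_injective.eq_iff,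
            parent_eq_none]
      rw [e]
      exact Set.ncard_pair (left_ne_right _ _)
    · have e : {y | (node l r).parent y = some (left x)} = left '' {y | l.parent y = some x} := by
        ext y
        rw [Set.mem_ofPred_eq, Set.mem_image]
        rcases pos_cases y with rfl | ⟨y, rfl⟩ | ⟨y, rfl⟩
        · simp [parent_top, left_ne_top]
        · simp [parent_left_eq_some, left_injective.eq_iff]
        · simp [parent_right_ne_left, left_ne_right]
      rw [e, Set.ncard_image_of_injective _ left_injective]
      exact ihl x
    · have e : {y | (node l r).parent y = some (right x)} = right '' {y | r.parent y = some x} := by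
        ext y
        rw [Set.mem_ofPred_eq, Set.mem_image]
        rcases pos_cases y with rfl | ⟨y, rfl⟩ | ⟨y, rfl⟩
        · simp [parent_top, right_ne_top]
        · simp [parent_left_ne_right, (left_ne_right _ _).symm]
        · simp [parent_right_eq_some, right_injective.eq_iff]
      rw [e, Set.ncard_image_of_injective _ right_injective]
      exact ihr x

/-- The tree as a graph, with an additional vertex `none` joined to the root. -/
def graph (t : LeafTree V) : SimpleGraph (Option t.Pos) where
  Adj a b := (∃ x, a = some x ∧ b = t.parent x) ∨ (∃ x, b = some x ∧ a = t.parent x)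
  symm := ⟨fun _ _ h => h.symm⟩
  loopless := ⟨fun a h => by
    have : ∃ x, a = some x ∧ a = t.parent x := h.elim id id
    obtain ⟨x, h1, h2⟩ := this
    exact (depth_lt (h2.symm.trans h1)).false⟩

omit [DecidableEq V] in
theorem graph_adj (t : LeafTree V) (x : t.Pos) : t.graph.Adj (some x) (t.parent x) :=
  Or.inl ⟨x, rfl, rfl⟩

omit [DecidableEq V] in
theorem isTree_graph (t : LeafTree V) : t.graph.IsTree := by
  have := finite_pos t
  have hr : ∀ n, ∀ x : t.Pos, t.depth x = n → t.graph.Reachable (some x) none := by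
    intro n
    induction n using Nat.strong_induction_on with
    | _ n ih =>
      intro x hx
      cases hp : t.parent x with
      | none => rw [← hp]; exact (graph_adj t x).reachable
      | some y =>
        refine Reachable.trans (v := some y) ?_ (ih _ (hx ▸ depth_lt hp) y rfl)
        rw [← hp]; exact (graph_adj t x).reachable
  have hr' : ∀ o, t.graph.Reachable o none := by
    rintro (_ | x)
    · exact Reachable.refl _
    · exact hr _ x rfl
  have hc : t.graph.Connected :=
    { preconnected := fun a b => (hr' a).trans (hr' b).symm
      nonempty := ⟨none⟩ }
  refine isTree_iff_connected_and_card.2 ⟨hc, ?_⟩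
  have h1 := hc.card_vert_le_card_edgeSet_add_one
  have h2 : Nat.card t.graph.edgeSet ≤ Nat.card t.Pos := by
    refine Nat.card_le_card_of_surjective
      (fun x => (⟨s(some x, t.parent x), graph_adj t x⟩ : t.graph.edgeSet)) ?_
    rintro ⟨e, he⟩
    induction e using Sym2.ind with
    | _ a b =>
      have he' : t.graph.Adj a b := he
      rcases he' with ⟨x, h1, h2⟩ | ⟨x, h1, h2⟩
      · exact ⟨x, Subtype.ext (show s(some x, t.parent x) = s(a, b) by rw [h1, h2])⟩
      · exact ⟨x, Subtype.ext (show s(some x, t.parent x) = s(a, b) by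
          rw [h1, h2, Sym2.eq_swap])⟩
  have h3 : Nat.card (Option t.Pos) = Nat.card t.Pos + 1 := Finite.card_option
  omega

omit [DecidableEq V] in
theorem ncard_neighborSet_none (t : LeafTree V) : (t.graph.neighborSet none).ncard = 1 := by
  rw [Set.ncard_eq_one]
  refine ⟨some t.root, ?_⟩
  ext o
  rw [Set.mem_singleton_iff]
  constructor
  · rintro (⟨x, h, _⟩ | ⟨x, rfl, h⟩)
    · simp at h
    · rw [parent_eq_none.1 h.symm]
  · rintro rfl
    exact Or.inr ⟨_, rfl, (parent_eq_none.2 rfl).symm⟩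

omit [DecidableEq V] in
theorem ncard_neighborSet_some (t : LeafTree V) (x : t.Pos) :
    (t.graph.neighborSet (some x)).ncard = {y | t.parent y = some x}.ncard + 1 := by
  have := finite_pos t
  have e : t.graph.neighborSet (some x) =
      insert (t.parent x) (some '' {y | t.parent y = some x}) := by
    ext o
    simp only [mem_neighborSet, Set.mem_insert_iff, Set.mem_image, Set.mem_ofPred_eq]
    constructor
    · rintro (⟨y, h, rfl⟩ | ⟨y, rfl, h⟩)
      · rw [Option.some.injEq] at h
        exact Or.inl (by rw [h])
      · exact Or.inr ⟨y, h.symm, rfl⟩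
    · rintro (rfl | ⟨y, h, rfl⟩)
      · exact graph_adj t x
      · exact Or.inr ⟨y, rfl, h.symm⟩
  rw [e, Set.ncard_insert_of_notMem, Set.ncard_image_of_injective _ (Option.some_injective _)]
  rintro ⟨y, h, h'⟩
  have h1 := depth_lt (t := t) h
  have h2 := depth_lt (t := t) h'.symm
  omega

theorem component_subset_some {t : LeafTree V} (hn : t.Nodup) {x : t.Pos} {o : Option t.Pos}
    (h : o ∈ t.graph.component (some x) (t.parent x)) :
    ∃ z, o = some z ∧ t.labelsBelow z ⊆ t.labelsBelow x := by
  refine component_induction (P := fun o => ∃ z, o = some z ∧ t.labelsBelow z ⊆ t.labelsBelow x)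
    ⟨x, rfl, subset_rfl⟩ ?_ h
  rintro o o' - ⟨w, rfl, hw⟩ ha hne
  rcases ha with ⟨y, h1, rfl⟩ | ⟨y, rfl, h1⟩
  · rw [Option.some.injEq] at h1
    subst h1
    obtain ⟨w', h2, h3⟩ := parent_of_labelsBelow_subset hn hw fun e => hne (by rw [e])
    exact ⟨w', h2, h3⟩
  · exact ⟨y, rfl, (labelsBelow_subset_of_parent h1.symm).trans hw⟩

theorem mem_component_iff {t : LeafTree V} (hn : t.Nodup) {x z : t.Pos} :
    some z ∈ t.graph.component (some x) (t.parent x) ↔ t.labelsBelow z ⊆ t.labelsBelow x := by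
  constructor
  · intro h
    obtain ⟨z', e, h'⟩ := component_subset_some hn h
    rw [Option.some.injEq] at e
    rwa [e]
  · induction h : t.depth z using Nat.strong_induction_on generalizing z with
    | _ n ih =>
      intro hz
      by_cases hzx : z = x
      · rw [hzx]; exact self_mem_component _ _
      obtain ⟨w, h1, h2⟩ := parent_of_labelsBelow_subset hn hz hzx
      have hlt := depth_lt h1
      refine mem_component_of_adj (ih _ (h ▸ hlt) rfl h2)
        (Or.inr ⟨z, rfl, h1.symm⟩) fun e => ?_
      rcases Sym2.eq_iff.1 e with ⟨e1, e2⟩ | ⟨_, e2⟩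
      · rw [Option.some.injEq] at e1
        subst e1
        have := depth_lt e2.symm
        omega
      · exact hzx (Option.some.inj e2)

end LeafTree

theorem Branched.exists_leafTree {V : Type*} [DecidableEq V] {f : Finset V → ℕ} {k : ℕ}
    {X : Finset V} (h : Branched f k X) (hX : X.Nonempty) :
    ∃ t : LeafTree V, t.Nodup ∧ t.labels = X ∧ ∀ x, f (t.labelsBelow x) ≤ k := by
  induction h with
  | empty _ => simp at hX
  | singleton v hv => exact ⟨.leaf v, trivial, rfl, fun _ => hv⟩
  | @union X Y hX' hY' hd hf ihX ihY =>
    rcases X.eq_empty_or_nonempty with rfl | hX1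
    · rw [Finset.empty_union] at hX ⊢
      exact ihY hX
    rcases Y.eq_empty_or_nonempty with rfl | hY1
    · rw [Finset.union_empty] at hX ⊢
      exact ihX hX
    obtain ⟨l, h1, h2, h3⟩ := ihX hX1
    obtain ⟨r, g1, g2, g3⟩ := ihY hY1
    subst h2 g2
    refine ⟨.node l r, ⟨h1, g1, hd⟩, rfl, ?_⟩
    intro x
    rcases LeafTree.pos_cases x with rfl | ⟨x, rfl⟩ | ⟨x, rfl⟩
    · exact hf
    · exact h3 x
    · exact g3 x

/-- The tree is rerooted at a leaf `b`, which becomes the additional node `none` attached to the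
root of the tree for the remaining vertices. This makes all degrees equal to `1` or `3`. -/
theorem Branched.exists_rankDecomposition {V : Type*} [Fintype V] [DecidableEq V]
    {f : Finset V → ℕ} {k : ℕ} (hs : ∀ Y, f (Finset.univ \ Y) = f Y)
    (h : Branched f k Finset.univ) (hV : 2 ≤ Fintype.card V) :
    ∃ D : RankDecomposition V, ∀ x y, D.tree.Adj x y → f (D.part x y) ≤ k := by
  obtain ⟨b⟩ : Nonempty V := Fintype.card_pos_iff.1 (by omega)
  have h1 := h.erase (fun Y _ => hs Y) (Finset.mem_univ b)
  have hne : (Finset.univ.erase b).Nonempty := by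
    rw [← Finset.card_pos, Finset.card_erase_of_mem (Finset.mem_univ b), Finset.card_univ]
    omega
  obtain ⟨t, hn, hl, hk⟩ := h1.exists_leafTree hne
  have hval : ∀ {x : t.Pos}, (t.graph.neighborSet (some x)).ncard = 1 → ∃ v, t.val x = some v := by
    intro x hx
    rw [t.ncard_neighborSet_some] at hx
    rcases LeafTree.ncard_children x with h | h
    · exact h.1
    · omega
  have hbl : ∀ {x : t.Pos} {v : V}, t.val x = some v → v ≠ b := by
    intro x v hx
    have := LeafTree.mem_labels_of_val hx
    rw [hl] at this
    exact Finset.ne_of_mem_erase this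
  let g : {o : Option t.Pos // (t.graph.neighborSet o).ncard = 1} → V :=
    fun o => (o.1.bind t.val).getD b
  have hg : Function.Bijective g := by
    constructor
    · rintro ⟨_ | x, hx⟩ ⟨_ | y, hy⟩ hxy
      · rfl
      · obtain ⟨v, hv⟩ := hval hy
        simp only [g, Option.bind_none, Option.getD_none, Option.bind_some, hv,
          Option.getD_some] at hxy
        exact (hbl hv hxy.symm).elim
      · obtain ⟨v, hv⟩ := hval hx
        simp only [g, Option.bind_none, Option.getD_none, Option.bind_some, hv,
          Option.getD_some] at hxy
        exact (hbl hv hxy).elim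
      · obtain ⟨v, hv⟩ := hval hx
        obtain ⟨w, hw⟩ := hval hy
        simp only [g, Option.bind_some, hv, hw, Option.getD_some] at hxy
        subst hxy
        simp only [LeafTree.val_injective hn hv hw]
    · intro v
      by_cases hv : v = b
      · exact ⟨⟨none, t.ncard_neighborSet_none⟩, hv.symm⟩
      · obtain ⟨x, hx⟩ := LeafTree.exists_val_eq (t := t) (v := v) (by rw [hl]; simp [hv])
        refine ⟨⟨some x, ?_⟩, by simp [g, hx]⟩
        rw [t.ncard_neighborSet_some]
        rcases LeafTree.ncard_children x with h | h
        · omega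
        · rw [hx] at h; simp at h
  let D : RankDecomposition V :=
    { Node := Option t.Pos
      finite_node := by have := t.finite_pos; infer_instance
      tree := t.graph
      isTree := t.isTree_graph
      subcubic := by
        rintro (_ | x)
        · exact Or.inl t.ncard_neighborSet_none
        · rw [t.ncard_neighborSet_some]
          rcases LeafTree.ncard_children x with h | h <;> omega
      leaf := (Equiv.ofBijective g hg).symm }
  have hpart : ∀ x : t.Pos, D.part (some x) (t.parent x) = t.labelsBelow x := by
    intro x
    ext v
    rw [RankDecomposition.mem_part]
    obtain ⟨o, rfl⟩ := hg.2 v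
    have e : D.leaf (g o) = o := (Equiv.ofBijective g hg).symm_apply_apply o
    rw [e]
    change o.1 ∈ t.graph.component (some x) (t.parent x) ↔ _
    rcases o with ⟨_ | z, hz⟩
    · constructor
      · intro h
        obtain ⟨z, e, -⟩ := LeafTree.component_subset_some hn h
        exact (Option.some_ne_none z e.symm).elim
      · intro h
        have := t.labelsBelow_subset x h
        rw [hl] at this
        simp [g] at this
    · obtain ⟨v, hv⟩ := hval hz
      rw [LeafTree.mem_component_iff hn, LeafTree.labelsBelow_eq_of_val hv, Finset.singleton_subset_iff]
      simp [g, hv]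
  have hswap : ∀ x y, D.tree.Adj x y → D.part y x = Finset.univ \ D.part x y := by
    intro x y hxy
    ext v
    rw [Finset.mem_sdiff, RankDecomposition.mem_part, RankDecomposition.mem_part]
    have h1 := D.isTree.connected.mem_component_or x y (D.leaf v : D.Node)
    have h2 : (D.leaf v : D.Node) ∈ D.tree.component x y → (D.leaf v : D.Node) ∉ _ := fun h =>
      Set.disjoint_left.1 (D.isTree.isAcyclic.disjoint_component_swap hxy) h
    have h3 := Finset.mem_univ v
    tauto
  refine ⟨D, fun x y hxy => ?_⟩
  rcases hxy with ⟨z, rfl, rfl⟩ | ⟨z, rfl, rfl⟩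
  · rw [hpart]; exact hk z
  · rw [hswap _ _ (t.graph_adj z), hs, hpart]; exact hk z

/-! ### The label space of a graph -/

/-- Labels: pairs of elements of `GF(2)`. -/
abbrev Label := ZMod 2 × ZMod 2

section LabelSpace

variable {V : Type*}

/-- The elements of `L` that vanish outside `X`. -/
def supported (L : Submodule (ZMod 2) (V → Label)) (X : Set V) :
    Submodule (ZMod 2) (V → Label) where
  carrier := {u | u ∈ L ∧ ∀ w ∉ X, u w = 0}
  add_mem' := fun ha hb => ⟨L.add_mem ha.1 hb.1, fun w hw => by
    rw [Pi.add_apply, ha.2 w hw, hb.2 w hw, add_zero]⟩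
  zero_mem' := ⟨L.zero_mem, fun _ _ => rfl⟩
  smul_mem' := fun c _ ha => ⟨L.smul_mem c ha.1, fun w hw => by
    rw [Pi.smul_apply, ha.2 w hw, smul_zero]⟩

/-- The elements of `L` whose first coordinates vanish outside `P` and whose second coordinates
vanish on `Q`. -/
def restricted (L : Submodule (ZMod 2) (V → Label)) (P Q : Set V) :
    Submodule (ZMod 2) (V → Label) where
  carrier := {u | u ∈ L ∧ (∀ w ∉ P, (u w).1 = 0) ∧ ∀ w ∈ Q, (u w).2 = 0}
  add_mem' := fun ha hb => ⟨L.add_mem ha.1 hb.1, fun w hw => by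
    rw [Pi.add_apply, Prod.fst_add, ha.2.1 w hw, hb.2.1 w hw, add_zero], fun w hw => by
    rw [Pi.add_apply, Prod.snd_add, ha.2.2 w hw, hb.2.2 w hw, add_zero]⟩
  zero_mem' := ⟨L.zero_mem, fun _ _ => rfl, fun _ _ => rfl⟩
  smul_mem' := fun c _ ha => ⟨L.smul_mem c ha.1, fun w hw => by
    rw [Pi.smul_apply, Prod.smul_fst, ha.2.1 w hw, smul_zero], fun w hw => by
    rw [Pi.smul_apply, Prod.smul_snd, ha.2.2 w hw, smul_zero]⟩

variable [Fintype V] (G : SimpleGraph V)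

open Classical in
/-- Multiplication by the adjacency matrix. -/
noncomputable def adjMap : (V → ZMod 2) →ₗ[ZMod 2] (V → ZMod 2) :=
  (G.adjMatrix (ZMod 2)).mulVecLin

open Classical in
theorem adjMap_apply (x : V → ZMod 2) (v : V) :
    G.adjMap x v = ∑ w, G.adjMatrix (ZMod 2) v w * x w := rfl

/-- The map `x ↦ (x, A x)`, where `A` is the adjacency matrix. -/
noncomputable def labelMap : (V → ZMod 2) →ₗ[ZMod 2] (V → Label) :=
  LinearMap.pi fun v => (LinearMap.proj v).prod ((LinearMap.proj v).comp G.adjMap)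

theorem labelMap_apply (x : V → ZMod 2) (v : V) : G.labelMap x v = (x v, G.adjMap x v) := rfl

/-- The space of all `(x, A x)`, where `A` is the adjacency matrix. It is the isotropic system of
the graph, and also the row space of the matrix `(I | A)`. -/
noncomputable def labelSpace : Submodule (ZMod 2) (V → Label) := LinearMap.range G.labelMap

theorem labelMap_injective : Function.Injective G.labelMap := fun x y h => by
  funext v
  exact congrArg Prod.fst (congrFun h v)

open Classical in
/-- The elements of `restricted` are the images of the vectors in the left kernel of the submatrix.
-/
theorem rank_submatrix_add_finrank {α β : Type*} [Fintype α] [Fintype β] (p : α → V)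
    (hp : Function.Injective p) (q : β → V) :
    ((G.adjMatrix (ZMod 2)).submatrix p q).rank +
      Module.finrank (ZMod 2) (restricted G.labelSpace (Set.range p) (Set.range q)) =
      Fintype.card α := by
  set M := (G.adjMatrix (ZMod 2)).submatrix p q with hM
  let E : (α → ZMod 2) →ₗ[ZMod 2] (V → ZMod 2) := Function.ExtendByZero.linearMap (ZMod 2) p
  have hE1 : ∀ c a, E c (p a) = c a := fun c a => hp.extend_apply c 0 a
  have hE2 : ∀ c, ∀ v ∉ Set.range p, E c v = 0 := fun c v hv =>
    Function.extend_apply' _ _ _ hv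
  have hEA : ∀ c b, G.adjMap (E c) (q b) = M.transpose.mulVecLin c b := by
    intro c b
    rw [adjMap_apply, Matrix.mulVecLin_apply]
    symm
    refine Fintype.sum_of_injective p hp _ _ (fun v hv => ?_) fun a => ?_
    · rw [hE2 c v hv, mul_zero]
    · change G.adjMatrix (ZMod 2) (p a) (q b) * c a = _
      rw [hE1, adjMatrix_apply, adjMatrix_apply]
      simp only [G.adj_comm]
  have hinj : Function.Injective (G.labelMap.comp E) := by
    refine G.labelMap_injective.comp fun c d h => ?_
    funext a
    rw [← hE1 c, ← hE1 d, h]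
  have hmap : (LinearMap.ker M.transpose.mulVecLin).map (G.labelMap.comp E) =
      restricted G.labelSpace (Set.range p) (Set.range q) := by
    ext u
    constructor
    · rintro ⟨c, hc, rfl⟩
      refine ⟨⟨E c, rfl⟩, fun v hv => hE2 c v hv, ?_⟩
      rintro _ ⟨b, rfl⟩
      change G.adjMap (E c) (q b) = 0
      rw [hEA, LinearMap.mem_ker.1 hc]; rfl
    · rintro ⟨⟨x, rfl⟩, h1, h2⟩
      have hx : E (fun a => x (p a)) = x := by
        funext v
        by_cases hv : v ∈ Set.range p
        · obtain ⟨a, rfl⟩ := hv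
          rw [hE1]
        · rw [hE2 _ v hv]; exact (h1 v hv).symm
      refine ⟨fun a => x (p a), LinearMap.mem_ker.2 ?_, ?_⟩
      · funext b
        rw [← hEA, hx]
        exact h2 _ ⟨b, rfl⟩
      · rw [LinearMap.comp_apply, hx]
  have h1 := LinearMap.finrank_range_add_finrank_ker M.transpose.mulVecLin
  have h2 := (Submodule.equivMapOfInjective _ hinj
    (LinearMap.ker M.transpose.mulVecLin)).finrank_eq
  rw [hmap] at h2
  rw [h2, Module.finrank_fintype_fun_eq_card] at h1
  rw [← Matrix.rank_transpose]
  exact h1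

omit [Fintype V] in
theorem restricted_compl (L : Submodule (ZMod 2) (V → Label)) (X : Set V) :
    restricted L X Xᶜ = supported L X := by
  ext u
  exact ⟨fun h => ⟨h.1, fun w hw => Prod.ext (h.2.1 w hw) (h.2.2 w hw)⟩,
    fun h => ⟨h.1, fun w hw => by rw [h.2 w hw]; rfl, fun w hw => by rw [h.2 w hw]; rfl⟩⟩

omit [Fintype V] in
theorem cutRank_eq_rank [Finite V] [DecidableRel G.Adj] (X : Set V) [Fintype (Xᶜ : Set V)] :
    G.cutRank X = ((G.adjMatrix (ZMod 2)).submatrix (Subtype.val : X → V)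
      (Subtype.val : (Xᶜ : Set V) → V)).rank := by
  rw [cutRank]
  congr!

theorem cutRank_add_finrank (X : Finset V) :
    G.cutRank X + Module.finrank (ZMod 2) (supported G.labelSpace (X : Set V)) = X.card := by
  classical
  have h := G.rank_submatrix_add_finrank (fun z : (X : Set V) => (z : V)) Subtype.val_injective
    (fun z : ((X : Set V)ᶜ : Set V) => (z : V))
  rw [Subtype.range_coe, Subtype.range_coe, restricted_compl] at h
  rw [cutRank_eq_rank]
  exact h.trans (Fintype.card_coe X)

/-- The cut-rank in an induced subgraph ignores the second coordinates outside the subgraph. -/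
theorem cutRank_induce_add_finrank (S : Set V) (X : Finset V) (hX : (X : Set V) ⊆ S) :
    (G.induce S).cutRank (Subtype.val ⁻¹' (X : Set V)) +
      Module.finrank (ZMod 2) (restricted G.labelSpace X (S \ X)) = X.card := by
  classical
  set Y : Set S := Subtype.val ⁻¹' (X : Set V) with hY
  have h := (G.induce S).cutRank_eq_rank Y
  have e : ((G.induce S).adjMatrix (ZMod 2)).submatrix (Subtype.val : Y → S)
      (Subtype.val : (Yᶜ : Set S) → S) = (G.adjMatrix (ZMod 2)).submatrix
      (fun z : Y => ((z : S) : V)) (fun z : (Yᶜ : Set S) => ((z : S) : V)) := by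
    ext i j
    simp [adjMatrix_apply]
  replace h := h.trans (congrArg Matrix.rank e)
  have h' := G.rank_submatrix_add_finrank (fun z : Y => ((z : S) : V))
    (Subtype.val_injective.comp Subtype.val_injective) (fun z : (Yᶜ : Set S) => ((z : S) : V))
  have e1 : Set.range (fun z : Y => ((z : S) : V)) = X := by
    ext v
    constructor
    · rintro ⟨z, rfl⟩; exact z.2
    · exact fun hv => ⟨⟨⟨v, hX hv⟩, hv⟩, rfl⟩
  have e2 : Set.range (fun z : (Yᶜ : Set S) => ((z : S) : V)) = S \ X := by
    ext v
    constructor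
    · rintro ⟨z, rfl⟩; exact ⟨z.1.2, z.2⟩
    · exact fun hv => ⟨⟨⟨v, hv.1⟩, hv.2⟩, rfl⟩
  have e3 : Fintype.card Y = X.card := by
    rw [← Fintype.card_coe X]
    exact Fintype.card_congr ⟨fun z => ⟨z.1.1, z.2⟩, fun z => ⟨⟨z, hX z.2⟩, z.2⟩,
      fun _ => rfl, fun _ => rfl⟩
  rw [e1, e2, e3] at h'
  rw [← h', h]

theorem cutRank_compl (X : Set V) : G.cutRank Xᶜ = G.cutRank X := by
  classical
  have h1 := G.rank_submatrix_add_finrank (fun z : (Xᶜ : Set V) => (z : V)) Subtype.val_injective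
    (fun z : (Xᶜᶜ : Set V) => (z : V))
  have h2 := G.rank_submatrix_add_finrank (fun z : (Xᶜ : Set V) => (z : V)) Subtype.val_injective
    (fun z : X => (z : V))
  rw [Subtype.range_coe, Subtype.range_coe] at h1 h2
  have e : restricted G.labelSpace Xᶜ Xᶜᶜ = restricted G.labelSpace Xᶜ X := by rw [compl_compl]
  rw [e, ← h2] at h1
  rw [cutRank_eq_rank, cutRank_eq_rank, ← Matrix.rank_transpose ((G.adjMatrix (ZMod 2)).submatrix
    (Subtype.val : X → V) (Subtype.val : (Xᶜ : Set V) → V)), Matrix.transpose_submatrix,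
    transpose_adjMatrix]
  exact Nat.add_right_cancel h1

end LabelSpace

section Form

variable {V : Type*}

/-- The symplectic form on labels. Over `GF(2)`, two labels are orthogonal if and only if they are
equal or one of them is zero. -/
def form (a b : Label) : ZMod 2 := a.1 * b.2 + a.2 * b.1

/-- The elements `u` of `L` that vanish outside `insert v X` and have `u v ∈ {0, P}`. When `L` is
the label space of `G`, restricting them to the vertices other than `v` amounts to deleting `v` if
`P = (0, 1)`, and to pivoting an edge at `v` and deleting `v` if `P = (1, 0)`. -/
def minorSupported (L : Submodule (ZMod 2) (V → Label)) (v : V) (P : Label) (X : Set V) :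
    Submodule (ZMod 2) (V → Label) where
  carrier := {u | u ∈ L ∧ (∀ w ∉ insert v X, u w = 0) ∧ form (u v) P = 0}
  add_mem' := fun {a b} ha hb => ⟨L.add_mem ha.1 hb.1, fun w hw => by
    rw [Pi.add_apply, ha.2.1 w hw, hb.2.1 w hw, add_zero], by
    have h1 := ha.2.2
    have h2 := hb.2.2
    simp only [form, Pi.add_apply, Prod.fst_add, Prod.snd_add] at h1 h2 ⊢
    linear_combination h1 + h2⟩
  zero_mem' := ⟨L.zero_mem, fun _ _ => rfl, by simp [form]⟩
  smul_mem' := fun c a ha => ⟨L.smul_mem c ha.1, fun w hw => by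
    rw [Pi.smul_apply, ha.2.1 w hw, smul_zero], by
    have h1 := ha.2.2
    simp only [form, Pi.smul_apply, Prod.smul_fst, Prod.smul_snd, smul_eq_mul] at h1 ⊢
    linear_combination c * h1⟩

theorem restricted_eq_minorSupported (L : Submodule (ZMod 2) (V → Label)) (v : V) (X : Set V)
    (hv : v ∉ X) : restricted L X ({v}ᶜ \ X) = minorSupported L v (0, 1) X := by
  ext u
  constructor
  · rintro ⟨h1, h2, h3⟩
    refine ⟨h1, fun w hw => ?_, ?_⟩
    · rw [Set.mem_insert_iff, not_or] at hw
      exact Prod.ext (h2 w hw.2) (h3 w hw)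
    · simp [form, h2 v hv]
  · rintro ⟨h1, h2, h3⟩
    have h4 : (u v).1 = 0 := by simpa [form] using h3
    refine ⟨h1, fun w hw => ?_, fun w hw => ?_⟩
    · by_cases h : w = v
      · rw [h, h4]
      · rw [h2 w (by simp [h, hw])]; rfl
    · rw [h2 w (by simpa using hw)]; rfl

theorem sum_form_eq_zero [Fintype V] (G : SimpleGraph V) {u w : V → Label}
    (hu : u ∈ G.labelSpace) (hw : w ∈ G.labelSpace) : ∑ v, form (u v) (w v) = 0 := by
  classical
  obtain ⟨x, rfl⟩ := hu
  obtain ⟨y, rfl⟩ := hw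
  have h : ∑ v, x v * G.adjMap y v = ∑ v, G.adjMap x v * y v := by
    simp only [adjMap_apply, Finset.mul_sum, Finset.sum_mul]
    rw [Finset.sum_comm]
    refine Finset.sum_congr rfl fun v _ => Finset.sum_congr rfl fun z _ => ?_
    simp only [adjMatrix_apply, G.adj_comm z v]
    ring
  simp only [labelMap_apply, form, Finset.sum_add_distrib]
  rw [h]
  exact CharTwo.add_self_eq_zero _

open Classical in
/-- Exchange the two coordinates of the labels at `v` and at `w`. -/
noncomputable def swapLabels (v w : V) : (V → Label) →ₗ[ZMod 2] (V → Label) where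
  toFun u z := if z = v ∨ z = w then (u z).swap else u z
  map_add' a b := by
    funext z
    by_cases h : z = v ∨ z = w <;> simp [h]
  map_smul' c a := by
    funext z
    by_cases h : z = v ∨ z = w <;> simp [h]

theorem swapLabels_apply_of_mem {v w z : V} (h : z = v ∨ z = w) (u : V → Label) :
    swapLabels v w u z = (u z).swap := if_pos h

theorem swapLabels_apply_of_ne {v w z : V} (h : ¬ (z = v ∨ z = w)) (u : V → Label) :
    swapLabels v w u z = u z := if_neg h

theorem swapLabels_swapLabels (v w : V) (u : V → Label) :
    swapLabels v w (swapLabels v w u) = u := by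
  funext z
  by_cases h : z = v ∨ z = w
  · rw [swapLabels_apply_of_mem h, swapLabels_apply_of_mem h, Prod.swap_swap]
  · rw [swapLabels_apply_of_ne h, swapLabels_apply_of_ne h]

theorem swapLabels_injective (v w : V) : Function.Injective (swapLabels v w) :=
  fun a b h => by rw [← swapLabels_swapLabels v w a, h, swapLabels_swapLabels]

theorem swapLabels_eq_zero_iff {v w z : V} {u : V → Label} :
    swapLabels v w u z = 0 ↔ u z = 0 := by
  by_cases h : z = v ∨ z = w
  · rw [swapLabels_apply_of_mem h, Prod.ext_iff, Prod.ext_iff]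
    exact and_comm
  · rw [swapLabels_apply_of_ne h]

end Form

/-! ### Pivoting exchanges coordinates -/

section Pivot

variable {V : Type*} {G : SimpleGraph V} {v w : V}

theorem pivot_adj_of_ne {x y : V} (hxv : x ≠ v) (hxw : x ≠ w) (hyv : y ≠ v) (hyw : y ≠ w)
    (hxy : x ≠ y) : (G.pivot v w).Adj x y ↔
      Xor (G.Adj x y) (Xor (G.Adj x v ∧ G.Adj y w) (G.Adj x w ∧ G.Adj y v)) := by
  classical
  simp only [pivot, comap_adj, Equiv.swap_apply_of_ne_of_ne hxv hxw,
    Equiv.swap_apply_of_ne_of_ne hyv hyw, symmDiff_def, sup_adj, sdiff_adj, pivotFlips,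
    fromRel_adj, Set.mem_sdiff, mem_neighborSet, Set.mem_inter_iff, Set.mem_singleton_iff, hxv, hxw,
    hyv, hyw, G.adj_comm x v, G.adj_comm x w, G.adj_comm y v, G.adj_comm y w, ne_eq, hxy]
  by_cases h1 : G.Adj x y <;> by_cases h2 : G.Adj v x <;> by_cases h3 : G.Adj v y <;>
    by_cases h4 : G.Adj w x <;> by_cases h5 : G.Adj w y <;> simp [h1, h2, h3, h4, h5, Xor]

theorem pivot_adj_left {x : V} (hxv : x ≠ v) (hxw : x ≠ w) :
    (G.pivot v w).Adj x v ↔ G.Adj x w := by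
  classical
  simp only [pivot, comap_adj, Equiv.swap_apply_of_ne_of_ne hxv hxw, Equiv.swap_apply_left,
    symmDiff_def, sup_adj, sdiff_adj, pivotFlips, fromRel_adj, Set.mem_sdiff, mem_neighborSet,
    Set.mem_inter_iff, Set.mem_singleton_iff]
  by_cases h2 : G.Adj v x <;> by_cases h4 : G.Adj w x <;> simp [h2, h4, G.adj_comm x w]

theorem pivot_adj_right {x : V} (hxv : x ≠ v) (hxw : x ≠ w) :
    (G.pivot v w).Adj x w ↔ G.Adj x v := by
  classical
  simp only [pivot, comap_adj, Equiv.swap_apply_of_ne_of_ne hxv hxw, Equiv.swap_apply_right,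
    symmDiff_def, sup_adj, sdiff_adj, pivotFlips, fromRel_adj, Set.mem_sdiff, mem_neighborSet,
    Set.mem_inter_iff, Set.mem_singleton_iff]
  by_cases h2 : G.Adj v x <;> by_cases h4 : G.Adj w x <;> simp [h2, h4, G.adj_comm x v]

theorem pivot_adj_self (h : G.Adj v w) : (G.pivot v w).Adj v w := by
  classical
  simp only [pivot, comap_adj, Equiv.swap_apply_right, Equiv.swap_apply_left,
    symmDiff_def, sup_adj, sdiff_adj, pivotFlips, fromRel_adj, Set.mem_sdiff, mem_neighborSet,
    Set.mem_inter_iff, Set.mem_singleton_iff]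
  simp [h, h.symm]

variable [Fintype V]

/-- Solving two of the equations of `y = A x` for the variables at `v` and `w`: a pivot of the edge
`vw` exchanges the variables with the values at `v` and `w`. -/
theorem adjMap_pivot (h : G.Adj v w) {x y : V → ZMod 2}
    (hv : y v = G.adjMap x v) (hw : y w = G.adjMap x w) (hne : ∀ z, z ≠ v → z ≠ w → y z = x z) :
    (G.pivot v w).adjMap y v = x v ∧ (G.pivot v w).adjMap y w = x w ∧
      ∀ z, z ≠ v → z ≠ w → (G.pivot v w).adjMap y z = G.adjMap x z := by
  classical
  have hvw : v ≠ w := h.ne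
  have hsum : ∀ g : V → ZMod 2, ∑ z, g z = g v + (g w + ∑ z ∈ (Finset.univ.erase v).erase w, g z) := by
    intro g
    rw [Finset.add_sum_erase _ g (by simp [hvw.symm]), Finset.add_sum_erase _ g (Finset.mem_univ v)]
  have hmem : ∀ {z}, z ∈ (Finset.univ.erase v).erase w → z ≠ v ∧ z ≠ w := by
    intro z hz
    simp only [Finset.mem_erase] at hz
    exact ⟨hz.2.1, hz.1⟩
  set R := (Finset.univ.erase v).erase w with hR
  let a : V → V → ZMod 2 := fun z z' => G.adjMatrix (ZMod 2) z z'
  have ha : ∀ z z', a z z' = if G.Adj z z' then 1 else 0 := fun z z' => by simp [a]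
  have hsymm : ∀ z z', a z z' = a z' z := fun z z' => by simp only [ha, G.adj_comm]
  have hAx : ∀ z, G.adjMap x z = a z v * x v + (a z w * x w + ∑ z' ∈ R, a z z' * x z') := by
    intro z; rw [adjMap_apply, hsum]
  have hAy : ∀ z, (G.pivot v w).adjMap y z = (G.pivot v w).adjMatrix (ZMod 2) z v * y v +
      ((G.pivot v w).adjMatrix (ZMod 2) z w * y w +
        ∑ z' ∈ R, (G.pivot v w).adjMatrix (ZMod 2) z z' * y z') := by
    intro z; rw [adjMap_apply, hsum]
  have hvv : ∀ z, a z z = 0 := fun z => by simp [ha]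
  have hvw1 : a v w = 1 := by simp [ha, h]
  have hwv1 : a w v = 1 := by simp [ha, h.symm]
  have pvv : ∀ z, (G.pivot v w).adjMatrix (ZMod 2) z z = 0 := fun z => by simp
  have pvw : (G.pivot v w).adjMatrix (ZMod 2) v w = 1 := by simp [pivot_adj_self h]
  have pwv : (G.pivot v w).adjMatrix (ZMod 2) w v = 1 := by simp [(pivot_adj_self h).symm]
  have pzv : ∀ z, z ≠ v → z ≠ w → (G.pivot v w).adjMatrix (ZMod 2) z v = a z w := by
    intro z h1 h2; simp [ha, pivot_adj_left h1 h2]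
  have pzw : ∀ z, z ≠ v → z ≠ w → (G.pivot v w).adjMatrix (ZMod 2) z w = a z v := by
    intro z h1 h2; simp [ha, pivot_adj_right h1 h2]
  have pvz : ∀ z, z ≠ v → z ≠ w → (G.pivot v w).adjMatrix (ZMod 2) v z = a w z := by
    intro z h1 h2; rw [hsymm, ← pzv z h1 h2]; simp [adj_comm]
  have pwz : ∀ z, z ≠ v → z ≠ w → (G.pivot v w).adjMatrix (ZMod 2) w z = a v z := by
    intro z h1 h2; rw [hsymm, ← pzw z h1 h2]; simp [adj_comm]
  have pzz : ∀ z z', z ≠ v → z ≠ w → z' ≠ v → z' ≠ w →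
      (G.pivot v w).adjMatrix (ZMod 2) z z' = a z z' + (a z v * a w z' + a z w * a v z') := by
    intro z z' h1 h2 h3 h4
    by_cases hz : z = z'
    · subst hz
      rw [pvv, hvv, hsymm w z, hsymm v z, mul_comm (a z v), zero_add]
      exact (CharTwo.add_self_eq_zero _).symm
    · rw [hsymm w z', hsymm v z', adjMatrix_apply, pivot_adj_of_ne h1 h2 h3 h4 hz]
      simp only [ha]
      by_cases g1 : G.Adj z z' <;> by_cases g2 : G.Adj z v <;> by_cases g3 : G.Adj z w <;>
        by_cases g4 : G.Adj z' v <;> by_cases g5 : G.Adj z' w <;>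
        simp [g1, g2, g3, g4, g5, Xor] <;> decide
  have hS : ∀ z, ∑ z' ∈ R, a z z' * y z' = ∑ z' ∈ R, a z z' * x z' := fun z =>
    Finset.sum_congr rfl fun z' hz' => by rw [hne z' (hmem hz').1 (hmem hz').2]
  have h2 : ∀ t : ZMod 2, t + t = 0 := CharTwo.add_self_eq_zero
  refine ⟨?_, ?_, fun z hzv hzw => ?_⟩
  · rw [hAy, pvv, pvw, hw, hAx w, hvv w, hwv1,
      show ∑ z' ∈ R, (G.pivot v w).adjMatrix (ZMod 2) v z' * y z' = ∑ z' ∈ R, a w z' * y z' from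
        Finset.sum_congr rfl fun z' hz' => by rw [pvz z' (hmem hz').1 (hmem hz').2], hS]
    linear_combination h2 (∑ z' ∈ R, a w z' * x z')
  · rw [hAy, pvv, pwv, hv, hAx v, hvv v, hvw1,
      show ∑ z' ∈ R, (G.pivot v w).adjMatrix (ZMod 2) w z' * y z' = ∑ z' ∈ R, a v z' * y z' from
        Finset.sum_congr rfl fun z' hz' => by rw [pwz z' (hmem hz').1 (hmem hz').2], hS]
    linear_combination h2 (∑ z' ∈ R, a v z' * x z')
  · have e : ∑ z' ∈ R, (G.pivot v w).adjMatrix (ZMod 2) z z' * y z' =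
        ∑ z' ∈ R, a z z' * x z' + (a z v * ∑ z' ∈ R, a w z' * x z' +
          a z w * ∑ z' ∈ R, a v z' * x z') := by
      rw [Finset.mul_sum, Finset.mul_sum, ← Finset.sum_add_distrib, ← Finset.sum_add_distrib]
      refine Finset.sum_congr rfl fun z' hz' => ?_
      rw [pzz z z' hzv hzw (hmem hz').1 (hmem hz').2, hne z' (hmem hz').1 (hmem hz').2]
      ring
    rw [hAy, e, pzv z hzv hzw, pzw z hzv hzw, hv, hw, hAx v, hAx w, hAx z, hvv, hvv, hvw1, hwv1]
    linear_combination h2 (a z w * ∑ z' ∈ R, a v z' * x z') +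
      h2 (a z v * ∑ z' ∈ R, a w z' * x z')

theorem labelSpace_pivot (h : G.Adj v w) :
    (G.pivot v w).labelSpace = G.labelSpace.map (swapLabels v w) := by
  classical
  symm
  refine Submodule.eq_of_le_of_finrank_eq ?_ ?_
  · rintro _ ⟨_, ⟨x, rfl⟩, rfl⟩
    obtain ⟨h1, h2, h3⟩ := adjMap_pivot h (x := x)
      (y := fun z => if z = v ∨ z = w then G.adjMap x z else x z) (by simp) (by simp)
      (fun z hv hw => by simp [hv, hw])
    refine ⟨fun z => if z = v ∨ z = w then G.adjMap x z else x z, ?_⟩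
    funext z
    rw [labelMap_apply]
    by_cases hz : z = v ∨ z = w
    · rw [swapLabels_apply_of_mem hz, if_pos hz, labelMap_apply]
      rcases hz with rfl | rfl
      · rw [h1]; rfl
      · rw [h2]; rfl
    · rw [swapLabels_apply_of_ne hz, if_neg hz, labelMap_apply,
        h3 z (fun h => hz (Or.inl h)) fun h => hz (Or.inr h)]
  · rw [← (Submodule.equivMapOfInjective _ (swapLabels_injective v w) _).finrank_eq]
    rw [labelSpace, labelSpace, LinearMap.finrank_range_of_inj (labelMap_injective _),
      LinearMap.finrank_range_of_inj (labelMap_injective _)]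

theorem minorSupported_pivot (h : G.Adj v w) (X : Set V) :
    minorSupported (G.pivot v w).labelSpace v (0, 1) X =
      (minorSupported G.labelSpace v (1, 0) X).map (swapLabels v w) := by
  rw [labelSpace_pivot h]
  have hf : ∀ u : V → Label, form (swapLabels v w u v) (0, 1) = form (u v) (1, 0) := by
    intro u
    rw [swapLabels_apply_of_mem (Or.inl rfl)]
    simp [form]
  ext u
  constructor
  · rintro ⟨⟨u, hu, rfl⟩, h2, h3⟩
    exact ⟨u, ⟨hu, fun z hz => swapLabels_eq_zero_iff.1 (h2 z hz), (hf u).symm.trans h3⟩, rfl⟩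
  · rintro ⟨u, ⟨hu, h2, h3⟩, rfl⟩
    exact ⟨⟨u, hu, rfl⟩, fun z hz => swapLabels_eq_zero_iff.2 (h2 z hz), (hf u).trans h3⟩

end Pivot

/-! ### Rank-width and branched sets -/

section RankWidth

variable {V : Type*} [Fintype V] [DecidableEq V] (G : SimpleGraph V)

omit [DecidableEq V] in
theorem cutRank_empty : G.cutRank ((∅ : Finset V) : Set V) = 0 := by
  have := G.cutRank_add_finrank ∅
  rw [Finset.card_empty] at this
  omega

theorem cutRank_univ_sdiff (X : Finset V) :
    G.cutRank ((Finset.univ \ X : Finset V) : Set V) = G.cutRank (X : Set V) := by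
  rw [← G.cutRank_compl X, ← Finset.compl_eq_univ_sdiff, Finset.coe_compl]

theorem cutRank_univ : G.cutRank ((Finset.univ : Finset V) : Set V) = 0 := by
  rw [← G.cutRank_empty, ← G.cutRank_univ_sdiff ∅, Finset.sdiff_empty]

omit [DecidableEq V] in
theorem width_le_iff (D : RankDecomposition V) (k : ℕ) :
    D.width G ≤ k ↔ ∀ x y, D.tree.Adj x y → G.cutRank (D.part x y : Set V) ≤ k := by
  have := D.finite_node
  constructor
  · intro h x y hxy
    rw [D.coe_part hxy]
    refine le_trans ?_ h
    have : Finite D.tree.Dart :=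
      Finite.of_injective (fun e => e.toProd) Dart.toProd_injective
    exact le_ciSup (f := fun e : D.tree.Dart => G.cutRank (D.side e))
      (Set.finite_range _).bddAbove ⟨(x, y), hxy⟩
  · intro h
    refine ciSup_le' fun e => ?_
    have := h e.fst e.snd e.adj
    rwa [D.coe_part e.adj] at this

theorem branched_of_rankWidth_le {k : ℕ} (hV : 2 ≤ Fintype.card V) (h : G.rankWidth ≤ k) :
    Branched (fun X : Finset V => G.cutRank (X : Set V)) k Finset.univ := by
  -- A rank-decomposition exists, so that the infimum in `rankWidth` is attained.
  have h0 : ∀ X : Finset V, Branched (fun _ => 0) 0 X := by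
    intro X
    induction X using Finset.induction_on with
    | empty => exact .empty le_rfl
    | insert v X hv ih =>
      rw [Finset.insert_eq]
      exact .union (.singleton v le_rfl) ih (Finset.disjoint_singleton_left.2 hv) le_rfl
  obtain ⟨D, -⟩ := (h0 Finset.univ).exists_rankDecomposition (fun _ => rfl) hV
  obtain ⟨D', hD'⟩ := Nat.sInf_mem (s := {k | ∃ D : RankDecomposition V, D.width G = k}) ⟨_, D, rfl⟩
  refine D'.branched_univ ((G.width_le_iff D' k).1 (hD'.trans_le h)) ?_
  rw [cutRank_univ]
  exact Nat.zero_le k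

theorem rankWidth_le_of_branched {k : ℕ} (hV : 2 ≤ Fintype.card V)
    (h : Branched (fun X : Finset V => G.cutRank (X : Set V)) k Finset.univ) : G.rankWidth ≤ k := by
  obtain ⟨D, hD⟩ := h.exists_rankDecomposition (fun Y => G.cutRank_univ_sdiff Y) hV
  have h1 : G.rankWidth ≤ D.width G := Nat.sInf_le ⟨D, rfl⟩
  exact h1.trans ((G.width_le_iff D k).2 hD)

end RankWidth

theorem Branched.map {W V : Type*} [DecidableEq W] [DecidableEq V] (e : W ↪ V)
    {f : Finset W → ℕ} {g : Finset V → ℕ} {k : ℕ} {X : Finset W} (h : Branched f k X)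
    (hg : ∀ Y, g (Y.map e) = f Y) : Branched g k (X.map e) := by
  induction h with
  | empty h => rw [← hg ∅] at h; exact .empty h
  | singleton v h => rw [← hg, Finset.map_singleton] at h; rw [Finset.map_singleton]; exact .singleton _ h
  | union _ _ hd h ih1 ih2 =>
    rw [← hg, Finset.map_union] at h
    rw [Finset.map_union]
    exact .union ih1 ih2 ((Finset.disjoint_map e).2 hd) h

/-! ### Minors obtained by removing one vertex -/

section Minor

variable {V : Type*} [Fintype V] [DecidableEq V] {G : SimpleGraph V}

/-- An induced subgraph on `S` of rank-width at most `k` yields a tree for `S` whose widths are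
computed in the label space of the whole graph. -/
theorem branched_of_rankWidth_induce_le {k : ℕ} (S : Finset V) (hS : 2 ≤ S.card)
    (h : (G.induce (S : Set V)).rankWidth ≤ k) :
    ∃ f : Finset V → ℕ, (∀ X ⊆ S, f X +
        Module.finrank (ZMod 2) (restricted G.labelSpace (X : Set V) ((S : Set V) \ X)) = X.card) ∧
      (∀ X ⊆ S, f (S \ X) = f X) ∧ Branched f k S := by
  have hc : Fintype.card (S : Set V) = S.card := Fintype.card_coe S
  have hb := branched_of_rankWidth_le (G.induce (S : Set V)) (hc ▸ hS) h
  refine ⟨fun X => (G.induce (S : Set V)).cutRank (Subtype.val ⁻¹' (X : Set V)), fun X hX =>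
    G.cutRank_induce_add_finrank S X (Finset.coe_subset.2 hX), fun X hX => ?_, ?_⟩
  · change _ = (G.induce (S : Set V)).cutRank (Subtype.val ⁻¹' (X : Set V))
    rw [← cutRank_compl _ (Subtype.val ⁻¹' (X : Set V))]
    refine congrArg _ (Set.ext fun z => ?_)
    simp
  · have := hb.map (Function.Embedding.subtype _)
      (g := fun X => (G.induce (S : Set V)).cutRank (Subtype.val ⁻¹' (X : Set V))) fun Y => by
        congr 1
        ext z
        simp
    have e : (Finset.univ : Finset (S : Set V)).map (Function.Embedding.subtype _) = S := by
      ext z; simp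
    rwa [e] at this

/-- The label `(0, 1)` stands for deletion, the label `(1, 0)` for pivoting followed by deletion. -/
theorem exists_branched_minor (hV : 3 ≤ Fintype.card V)
    (hminor : ∀ (S : Set V) (H : SimpleGraph S), H.IsProperPivotMinor G → H.rankWidth ≤ 2)
    {v w : V} (hvw : G.Adj v w) {P : Label} (hP : P = (0, 1) ∨ P = (1, 0)) :
    ∃ f : Finset V → ℕ, (∀ X : Finset V, v ∉ X → f X +
        Module.finrank (ZMod 2) (minorSupported G.labelSpace v P (X : Set V)) = X.card) ∧
      (∀ X ⊆ Finset.univ.erase v, f (Finset.univ.erase v \ X) = f X) ∧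
      Branched f 2 (Finset.univ.erase v) := by
  have hcard : 2 ≤ (Finset.univ.erase v : Finset V).card := by
    rw [Finset.card_erase_of_mem (Finset.mem_univ v), Finset.card_univ]; omega
  have hne : ((Finset.univ.erase v : Finset V) : Set V) ≠ Set.univ := fun h => by
    have := Set.mem_univ v
    rw [← h] at this
    simp at this
  have hS : ((Finset.univ.erase v : Finset V) : Set V) = {v}ᶜ := by ext; simp
  have hsub : ∀ X : Finset V, v ∉ X → X ⊆ Finset.univ.erase v := fun X hX z hz =>
    Finset.mem_erase.2 ⟨fun h => hX (h ▸ hz), Finset.mem_univ z⟩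
  rcases hP with rfl | rfl
  · obtain ⟨f, h1, h2, h3⟩ := branched_of_rankWidth_induce_le (G := G) (Finset.univ.erase v) hcard
      (hminor _ _ ⟨hne, G, .refl, rfl⟩)
    refine ⟨f, fun X hX => ?_, h2, h3⟩
    rw [← h1 X (hsub X hX), hS, restricted_eq_minorSupported _ _ _ hX]
  · obtain ⟨f, h1, h2, h3⟩ := branched_of_rankWidth_induce_le (G := G.pivot v w)
      (Finset.univ.erase v) hcard
      (hminor _ _ ⟨hne, G.pivot v w, .single ⟨v, w, hvw, rfl⟩, rfl⟩)
    refine ⟨f, fun X hX => ?_, h2, h3⟩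
    rw [← h1 X (hsub X hX), hS, restricted_eq_minorSupported _ _ _ hX, minorSupported_pivot hvw]
    rw [← (Submodule.equivMapOfInjective _ (swapLabels_injective v w) _).finrank_eq]

end Minor

/-! ### Cuts of rank at most one -/

section Prime

variable {V : Type*} [Fintype V] [DecidableEq V] {G : SimpleGraph V}

/-- If the cut-rank of `A` is at most `1`, then all columns of the matrix of the cut are zero or
equal to the column of some vertex `b` outside `A`. -/
theorem exists_column (A : Finset V) (hA : G.cutRank (A : Set V) ≤ 1) (hne : A ≠ Finset.univ) :
    ∃ b ∉ A, ∀ x : V → ZMod 2, (∀ v ∉ A, x v = 0) → G.adjMap x b = 0 → ∀ w ∉ A, G.adjMap x w = 0 := by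
  classical
  obtain ⟨b₀, hb₀⟩ : ∃ b, b ∉ A := by
    by_contra! h
    exact hne (Finset.eq_univ_iff_forall.2 h)
  let M := (G.adjMatrix (ZMod 2)).submatrix (fun a : (A : Set V) => (a : V))
    (fun a : ((A : Set V)ᶜ : Set V) => (a : V))
  have hM : Module.finrank (ZMod 2) (LinearMap.range M.transpose.mulVecLin) ≤ 1 := by
    have : M.transpose.rank ≤ 1 := by
      rw [Matrix.rank_transpose]
      rwa [cutRank_eq_rank] at hA
    exact this
  obtain ⟨z, hz⟩ := finrank_le_one_iff.1 hM
  have hx : ∀ x : V → ZMod 2, (∀ v ∉ A, x v = 0) → ∃ c : ZMod 2, ∀ w (hw : w ∉ A),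
      G.adjMap x w = c * z.1 ⟨w, hw⟩ := by
    intro x hx
    obtain ⟨c, hc⟩ := hz ⟨M.transpose.mulVecLin fun a => x a, ⟨_, rfl⟩⟩
    refine ⟨c, fun w hw => ?_⟩
    have h1 := congrFun (congrArg Subtype.val hc) ⟨w, hw⟩
    change c * z.1 ⟨w, hw⟩ = ∑ a, _ at h1
    rw [h1, adjMap_apply]
    symm
    refine Fintype.sum_of_injective (fun a : (A : Set V) => (a : V)) Subtype.val_injective _ _
      (fun v hv => ?_) fun a => ?_
    · rw [Subtype.range_coe] at hv
      rw [hx v hv, mul_zero]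
    · change G.adjMatrix (ZMod 2) a w * _ = _
      simp only [adjMatrix_apply, G.adj_comm]
  by_cases hz0 : ∃ b : ((A : Set V)ᶜ : Set V), z.1 b ≠ 0
  · obtain ⟨⟨b, hb⟩, hzb⟩ := hz0
    refine ⟨b, hb, fun x h1 h2 w hw => ?_⟩
    obtain ⟨c, hc⟩ := hx x h1
    rw [hc b hb] at h2
    rw [hc w hw, (mul_eq_zero.1 h2).resolve_right hzb, zero_mul]
  · push Not at hz0
    refine ⟨b₀, hb₀, fun x h1 _ w hw => ?_⟩
    obtain ⟨c, hc⟩ := hx x h1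
    rw [hc w hw, hz0, mul_zero]

theorem branched_of_cutRank_le_one
    (hminor : ∀ (S : Set V) (H : SimpleGraph S), H.IsProperPivotMinor G → H.rankWidth ≤ 2)
    {A : Finset V} (hA : G.cutRank (A : Set V) ≤ 1) (h1 : 1 ≤ A.card)
    (h2 : 2 ≤ (Finset.univ \ A).card) : Branched (fun X : Finset V => G.cutRank (X : Set V)) 2 A := by
  obtain ⟨b, hb, hcol⟩ := exists_column A hA (by rintro rfl; simp at h2)
  have hcard : (insert b A).card = A.card + 1 := Finset.card_insert_of_notMem hb
  have hne : ((insert b A : Finset V) : Set V) ≠ Set.univ := fun h => by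
    have h' : insert b A = Finset.univ := Finset.coe_injective (by rw [h, Finset.coe_univ])
    rw [Finset.card_sdiff_of_subset (Finset.subset_univ A), ← h'] at h2
    omega
  obtain ⟨f, hf1, hf2, hf3⟩ := branched_of_rankWidth_induce_le (G := G) (insert b A) (by omega)
    (hminor _ _ ⟨hne, G, .refl, rfl⟩)
  have hbr := hf3.erase hf2 (Finset.mem_insert_self b A)
  rw [Finset.erase_insert hb] at hbr
  refine hbr.of_le fun Y hY hfY => le_trans ?_ hfY
  have e1 := hf1 Y (hY.trans (Finset.subset_insert b A))
  have e2 := G.cutRank_add_finrank Y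
  have e3 : restricted G.labelSpace (Y : Set V) (((insert b A : Finset V) : Set V) \ Y) ≤
      supported G.labelSpace (Y : Set V) := by
    rw [← restricted_compl]
    rintro _ ⟨⟨x, rfl⟩, g1, g2⟩
    refine ⟨⟨x, rfl⟩, g1, fun w hw => ?_⟩
    have hbY : b ∉ Y := fun h => hb (hY h)
    by_cases hwA : w ∈ A
    · exact g2 w ⟨by simp [hwA], hw⟩
    · exact hcol x (fun v hv => g1 v fun h => hv (hY h)) (g2 b ⟨by simp, hbY⟩) w hwA
  have e4 := Submodule.finrank_mono e3
  omega

/-- A minimal graph of rank-width greater than `2` is prime: it has no cut of rank at most `1` with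
at least two vertices on both sides. -/
theorem card_le_one_of_cutRank_le_one
    (hminor : ∀ (S : Set V) (H : SimpleGraph S), H.IsProperPivotMinor G → H.rankWidth ≤ 2)
    (hG : ¬ Branched (fun X : Finset V => G.cutRank (X : Set V)) 2 Finset.univ)
    {A : Finset V} (hA : G.cutRank (A : Set V) ≤ 1) :
    A.card ≤ 1 ∨ (Finset.univ \ A).card ≤ 1 := by
  by_contra! h
  refine hG ?_
  have h1 := branched_of_cutRank_le_one hminor hA (by omega) (by omega)
  have h2 := branched_of_cutRank_le_one hminor (A := Finset.univ \ A)
    (by rwa [G.cutRank_univ_sdiff]) (by omega)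
    (by rw [Finset.sdiff_sdiff_eq_self (Finset.subset_univ A)]; omega)
  have e : A ∪ (Finset.univ \ A) = Finset.univ := Finset.union_sdiff_of_subset (Finset.subset_univ A)
  rw [← e]
  refine .union h1 h2 Finset.disjoint_sdiff ?_
  rw [e, cutRank_univ]
  omega

end Prime

/-! ### Subspaces over `GF(2)` -/

section LinearAlgebra

variable {M : Type*} [AddCommGroup M] [Module (ZMod 2) M] [Module.Finite (ZMod 2) M]
  {S T A B : Submodule (ZMod 2) M}

omit [Module.Finite (ZMod 2) M] in
theorem add_self_eq_zero_of_zmod_two (x : M) : x + x = 0 := by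
  rw [← two_smul (ZMod 2) x, show (2 : ZMod 2) = 0 from rfl, zero_smul]

theorem finrank_add_le (h1 : S ⊓ T ≤ A) (h2 : S ⊔ T ≤ B) :
    Module.finrank (ZMod 2) S + Module.finrank (ZMod 2) T ≤
      Module.finrank (ZMod 2) A + Module.finrank (ZMod 2) B := by
  rw [← Submodule.finrank_sup_add_finrank_inf_eq S T]
  have := Submodule.finrank_mono h1
  have := Submodule.finrank_mono h2
  omega

/-- A subspace has index at most `2` if the sum of any two elements outside of it belongs to it. -/
theorem finrank_le_succ (h : ∀ a ∈ T, ∀ b ∈ T, a ∉ S → b ∉ S → a + b ∈ S) :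
    Module.finrank (ZMod 2) T ≤ Module.finrank (ZMod 2) S + 1 := by
  by_cases hTS : T ≤ S
  · exact (Submodule.finrank_mono hTS).trans (Nat.le_succ _)
  obtain ⟨a, haT, haS⟩ := Set.not_subset.1 hTS
  have h1 : T ≤ S ⊔ Submodule.span (ZMod 2) {a} := by
    intro b hb
    by_cases hbS : b ∈ S
    · exact Submodule.mem_sup_left hbS
    · have : b = (a + b) + a := by
        rw [add_right_comm, add_self_eq_zero_of_zmod_two, zero_add]
      rw [this]
      exact Submodule.add_mem_sup (h a haT b hb haS hbS) (Submodule.mem_span_singleton_self a)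
  have h2 := Submodule.finrank_mono h1
  have h3 := Submodule.finrank_add_le_finrank_add_finrank S (Submodule.span (ZMod 2) {a})
  have h4 : Module.finrank (ZMod 2) (Submodule.span (ZMod 2) {a}) ≤ 1 :=
    (finrank_span_le_card {a}).trans (by simp)
  omega

theorem one_le_finrank {a : M} (ha : a ∈ S) (h : a ≠ 0) : 1 ≤ Module.finrank (ZMod 2) S :=
  Submodule.one_le_finrank_iff.2 fun hS => h (by rw [hS] at ha; exact ha)

theorem two_le_finrank {a b : M} (ha : a ∈ S) (hb : b ∈ S) (ha0 : a ≠ 0) (hb0 : b ≠ 0)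
    (hab : a ≠ b) : 2 ≤ Module.finrank (ZMod 2) S := by
  have hlt : Submodule.span (ZMod 2) {a} < S := by
    refine lt_of_le_of_ne ((Submodule.span_singleton_le_iff_mem _ _).2 ha) fun h => ?_
    rw [← h] at hb
    obtain ⟨c, rfl⟩ := Submodule.mem_span_singleton.1 hb
    have h01 : ∀ c : ZMod 2, c = 0 ∨ c = 1 := by decide
    rcases h01 c with rfl | rfl <;> simp at hb0 hab
  have h1 := Submodule.finrank_lt_finrank_of_lt hlt
  have h2 := one_le_finrank (Submodule.mem_span_singleton_self (R := ZMod 2) a) ha0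
  omega

theorem exists_ne_of_two_le_finrank (h : 2 ≤ Module.finrank (ZMod 2) S) :
    ∃ a ∈ S, ∃ b ∈ S, a ≠ 0 ∧ b ≠ 0 ∧ a ≠ b := by
  obtain ⟨a, ha, ha0⟩ := Submodule.exists_mem_ne_zero_of_ne_bot
    (Submodule.one_le_finrank_iff.1 (by omega : 1 ≤ Module.finrank (ZMod 2) S))
  by_contra! hc
  have h1 : S ≤ Submodule.span (ZMod 2) {a} := by
    intro b hb
    by_cases hb0 : b = 0
    · rw [hb0]; exact Submodule.zero_mem _
    · rw [← hc a ha b hb ha0 hb0]; exact Submodule.mem_span_singleton_self a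
  have h2 := Submodule.finrank_mono h1
  have h4 : Module.finrank (ZMod 2) (Submodule.span (ZMod 2) {a}) ≤ 1 :=
    (finrank_span_le_card {a}).trans (by simp)
  omega

end LinearAlgebra

/-! ### Labels -/

theorem form_eq_zero_iff : ∀ {a b : Label}, b ≠ 0 → (form a b = 0 ↔ a = 0 ∨ a = b) := by decide

theorem form_comm : ∀ a b : Label, form a b = form b a := by decide

theorem form_self : ∀ a : Label, form a a = 0 := by decide

theorem form_zero_left (a : Label) : form 0 a = 0 := by simp [form]

theorem form_zero_right (a : Label) : form a 0 = 0 := by simp [form]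

theorem form_eq_one : ∀ {a b : Label}, a ≠ 0 → b ≠ 0 → a + b ≠ 0 → form a b = 1 := by decide

theorem form_ne_zero_of_ne : ∀ {a b : Label}, a ≠ 0 → b ≠ 0 → a ≠ b → form a b ≠ 0 := by decide

theorem form_add_eq_zero : ∀ {a b c : Label}, form a c ≠ 0 → form b c ≠ 0 → form (a + b) c = 0 := by
  decide

/-- The labels `(0, 1)` and `(1, 0)`, standing for deletion and contraction. -/
def IsAxis (P : Label) : Prop := P = (0, 1) ∨ P = (1, 0)

theorem IsAxis.ne_zero {P : Label} (h : IsAxis P) : P ≠ 0 := by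
  rcases h with rfl | rfl <;> decide

theorem IsAxis.exists_ne {P : Label} (h : IsAxis P) : ∃ Q, IsAxis Q ∧ Q ≠ P := by
  rcases h with rfl | rfl
  · exact ⟨(1, 0), Or.inr rfl, by decide⟩
  · exact ⟨(0, 1), Or.inl rfl, by decide⟩

theorem exists_isAxis_ne (a : Label) : ∃ P, IsAxis P ∧ P ≠ a := by
  by_cases h : a = (0, 1)
  · exact ⟨(1, 0), Or.inr rfl, by rw [h]; decide⟩
  · exact ⟨(0, 1), Or.inl rfl, fun h' => h h'.symm⟩

/-! ### Cut-rank functions of a minimal graph -/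

variable {V : Type*} [Fintype V] [DecidableEq V] {L : Submodule (ZMod 2) (V → Label)}
  {ρ : Finset V → ℕ}

/-- `f` is the cut-rank function of the graph obtained by deleting `v` (if `P = (0, 1)`) or by
pivoting at `v` and deleting `v` (if `P = (1, 0)`), as a function of sets that avoid `v`. -/
def IsMinorRank (L : Submodule (ZMod 2) (V → Label)) (v : V) (P : Label) (f : Finset V → ℕ) :
    Prop :=
  ∀ X : Finset V, v ∉ X →
    f X + Module.finrank (ZMod 2) (minorSupported L v P (X : Set V)) = X.card

/-- The properties, in terms of the label space `L` and the cut-rank function `ρ`, that hold in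
every counterexample. -/
structure IsExcluded (L : Submodule (ZMod 2) (V → Label)) (ρ : Finset V → ℕ) : Prop where
  isotropic : ∀ u ∈ L, ∀ w ∈ L, ∑ v, form (u v) (w v) = 0
  rank_add : ∀ X, ρ X + Module.finrank (ZMod 2) (supported L (X : Set V)) = X.card
  symm : ∀ X, ρ (Finset.univ \ X) = ρ X
  prime : ∀ X, ρ X ≤ 1 → X.card ≤ 1 ∨ (Finset.univ \ X).card ≤ 1
  not_branched : ¬ Branched ρ 2 Finset.univ
  minor : ∀ v P, IsAxis P → ∃ f : Finset V → ℕ, IsMinorRank L v P f ∧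
    (∀ X ⊆ Finset.univ.erase v, f (Finset.univ.erase v \ X) = f X) ∧
    Branched f 2 (Finset.univ.erase v)
  card_ge : 17 ≤ Fintype.card V

/-- `w` is an element of `L` whose support is the three-element set `T`, provided that `L` has no
nonzero element of smaller support. -/
def IsTriple (L : Submodule (ZMod 2) (V → Label)) (T : Finset V) (w : V → Label) : Prop :=
  T.card = 3 ∧ w ∈ supported L (T : Set V) ∧ w ≠ 0

omit [Fintype V] [DecidableEq V] in
theorem supported_mono {X Y : Set V} (h : X ⊆ Y) : supported L X ≤ supported L Y :=
  fun _ hu => ⟨hu.1, fun w hw => hu.2 w fun h' => hw (h h')⟩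

omit [Fintype V] [DecidableEq V] in
theorem minorSupported_le (v : V) (P : Label) (X : Set V) :
    minorSupported L v P X ≤ supported L (insert v X) :=
  fun _ hu => ⟨hu.1, hu.2.1⟩

omit [Fintype V] [DecidableEq V] in
theorem minorSupported_mono (v : V) (P : Label) {X Y : Set V} (h : X ⊆ Y) :
    minorSupported L v P X ≤ minorSupported L v P Y :=
  fun _ hu => ⟨hu.1, fun w hw => hu.2.1 w fun h' => hw (Set.insert_subset_insert h h'), hu.2.2⟩

namespace IsMinorRank

variable {v : V} {P : Label} {f : Finset V → ℕ}

theorem submodular (hf : IsMinorRank L v P f) {X Y : Finset V} (hX : v ∉ X) (hY : v ∉ Y) :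
    f (X ∩ Y) + f (X ∪ Y) ≤ f X + f Y := by
  have h1 := hf X hX
  have h2 := hf Y hY
  have h3 := hf (X ∩ Y) (fun h => hX (Finset.mem_inter.1 h).1)
  have h4 := hf (X ∪ Y) (fun h => (Finset.mem_union.1 h).elim hX hY)
  have h5 := Finset.card_union_add_card_inter X Y
  have h6 := finrank_add_le (S := minorSupported L v P (X : Set V))
    (T := minorSupported L v P (Y : Set V)) (A := minorSupported L v P ((X ∩ Y : Finset V) : Set V))
    (B := minorSupported L v P ((X ∪ Y : Finset V) : Set V)) ?_ ?_
  · omega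
  · rintro u ⟨⟨a1, a2, a3⟩, -, b2, -⟩
    refine ⟨a1, fun w hw => ?_, a3⟩
    by_cases hwX : w ∈ X
    · refine b2 w fun h => hw ?_
      rcases h with rfl | h
      · exact (hX hwX).elim
      · exact Or.inr (by rw [Finset.coe_inter]; exact ⟨hwX, h⟩)
    · refine a2 w fun h => ?_
      rcases h with rfl | h
      · exact hw (Or.inl rfl)
      · exact hwX h
  · exact sup_le (minorSupported_mono _ _ (Finset.coe_subset.2 Finset.subset_union_left))
      (minorSupported_mono _ _ (Finset.coe_subset.2 Finset.subset_union_right))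

end IsMinorRank

namespace IsExcluded

variable {v : V} {P : Label} {f : Finset V → ℕ} {X Y B T T' : Finset V} {u w w' : V → Label}

theorem submodular (h : IsExcluded L ρ) (X Y : Finset V) :
    ρ (X ∩ Y) + ρ (X ∪ Y) ≤ ρ X + ρ Y := by
  have h1 := h.rank_add X
  have h2 := h.rank_add Y
  have h3 := h.rank_add (X ∩ Y)
  have h4 := h.rank_add (X ∪ Y)
  have h5 := Finset.card_union_add_card_inter X Y
  have h6 := finrank_add_le (S := supported L (X : Set V)) (T := supported L (Y : Set V))
    (A := supported L ((X ∩ Y : Finset V) : Set V)) (B := supported L ((X ∪ Y : Finset V) : Set V))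
    ?_ ?_
  · omega
  · rintro u ⟨⟨a1, a2⟩, -, b2⟩
    refine ⟨a1, fun w hw => ?_⟩
    by_cases hwX : w ∈ X
    · exact b2 w fun h => hw (by rw [Finset.coe_inter]; exact ⟨hwX, h⟩)
    · exact a2 w hwX
  · exact sup_le (supported_mono (Finset.coe_subset.2 Finset.subset_union_left))
      (supported_mono (Finset.coe_subset.2 Finset.subset_union_right))

theorem rank_univ (h : IsExcluded L ρ) : ρ Finset.univ = 0 := by
  have h1 := h.symm ∅
  have h2 := h.rank_add ∅
  rw [Finset.sdiff_empty] at h1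
  rw [Finset.card_empty] at h2
  omega

theorem card_compl (_h : IsExcluded L ρ) (X : Finset V) :
    (Finset.univ \ X).card + X.card = Fintype.card V := by
  rw [Finset.card_sdiff_add_card_eq_card (Finset.subset_univ X), Finset.card_univ]

theorem two_le_rank (h : IsExcluded L ρ) (h1 : 2 ≤ X.card) (h2 : 2 ≤ (Finset.univ \ X).card) :
    2 ≤ ρ X := by
  by_contra hc
  rcases h.prime X (by omega) with h3 | h3 <;> omega

theorem eq_zero_of_card_le_two (h : IsExcluded L ρ) (hu : u ∈ supported L (X : Set V))
    (hX : X.card ≤ 2) : u = 0 := by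
  by_contra hne
  obtain ⟨Y, hXY, hY⟩ := Finset.exists_superset_card_eq hX
    (by have := h.card_ge; omega : 2 ≤ Fintype.card V)
  have h1 := one_le_finrank (supported_mono (Finset.coe_subset.2 hXY) hu) hne
  have h2 := h.rank_add Y
  have h3 := h.card_compl Y
  have h4 := h.card_ge
  have h5 := h.two_le_rank (X := Y) (by omega) (by omega)
  omega

theorem _root_.SimpleGraph.IsTriple.apply_ne_zero (hw : IsTriple L T w) (h : IsExcluded L ρ)
    (hv : v ∈ T) : w v ≠ 0 := by
  intro h0
  refine hw.2.2 (h.eq_zero_of_card_le_two (X := T.erase v) ⟨hw.2.1.1, fun z hz => ?_⟩ ?_)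
  · by_cases hzT : z ∈ T
    · have : z = v := by
        by_contra hzv
        exact hz (Finset.mem_coe.2 (Finset.mem_erase.2 ⟨hzv, hzT⟩))
      rw [this, h0]
    · exact hw.2.1.2 z hzT
  · rw [Finset.card_erase_of_mem hv, hw.1]

theorem form_eq_zero_of_single (h : IsExcluded L ρ) (hu : u ∈ L) (hw : w ∈ L)
    (hz : ∀ z, z ≠ v → u z = 0 ∨ w z = 0) : form (u v) (w v) = 0 := by
  rw [← h.isotropic u hu w hw]
  symm
  refine Finset.sum_eq_single v (fun z _ hzv => ?_) fun hv => (hv (Finset.mem_univ v)).elim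
  rcases hz z hzv with h | h <;> rw [h]
  · exact form_zero_left _
  · exact form_zero_right _

/-! ### Comparison of the cut-rank functions of a graph and of its minors -/

theorem rank_insert_le (h : IsExcluded L ρ) (hf : IsMinorRank L v P f) (hv : v ∉ X) :
    ρ (insert v X) ≤ f X + 1 := by
  have h1 := hf X hv
  have h2 := h.rank_add (insert v X)
  rw [Finset.card_insert_of_notMem hv, Finset.coe_insert] at h2
  have h3 := Submodule.finrank_mono (minorSupported_le (L := L) v P (X : Set V))
  omega

/-- A vector with a label at `v` different from `0` and `P` witnesses that removing `v` does not
decrease the cut-rank. -/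
theorem rank_insert_le_of_form_ne_zero (h : IsExcluded L ρ) (hf : IsMinorRank L v P f) (hv : v ∉ X)
    (hu : u ∈ supported L (B : Set V)) (hB : B ⊆ insert v X) (huP : form (u v) P ≠ 0) :
    ρ (insert v X) ≤ f X := by
  have h1 := hf X hv
  have h2 := h.rank_add (insert v X)
  rw [Finset.card_insert_of_notMem hv, Finset.coe_insert] at h2
  have h3 : minorSupported L v P (X : Set V) < supported L (insert v (X : Set V)) := by
    refine lt_of_le_of_ne (minorSupported_le _ _ _) fun e => ?_
    have : u ∈ supported L (insert v (X : Set V)) :=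
      supported_mono (by rw [← Finset.coe_insert]; exact Finset.coe_subset.2 hB) hu
    rw [← e] at this
    exact huP this.2.2
  have h4 := Submodule.finrank_lt_finrank_of_lt h3
  omega

theorem le_rank_insert (h : IsExcluded L ρ) (hf : IsMinorRank L v P f) (hv : v ∉ X) :
    f X ≤ ρ (insert v X) := by
  have h1 := hf X hv
  have h2 := h.rank_add (insert v X)
  rw [Finset.card_insert_of_notMem hv, Finset.coe_insert] at h2
  have h3 := finrank_le_succ (S := minorSupported L v P (X : Set V))
    (T := supported L (insert v (X : Set V))) fun a ha b hb ha' hb' => by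
      refine ⟨L.add_mem ha.1 hb.1, fun z hz => by
        rw [Pi.add_apply, ha.2 z hz, hb.2 z hz, add_zero], ?_⟩
      have e1 : form (a v) P ≠ 0 := fun e => ha' ⟨ha.1, ha.2, e⟩
      have e2 : form (b v) P ≠ 0 := fun e => hb' ⟨hb.1, hb.2, e⟩
      exact form_add_eq_zero e1 e2
  omega

theorem rank_le_of_disjoint (h : IsExcluded L ρ) (hP : P ≠ 0) (hf : IsMinorRank L v P f)
    (hv : v ∉ X) (hu : u ∈ supported L (B : Set V)) (hB : Disjoint X B)
    (huP : form (u v) P ≠ 0) : ρ X ≤ f X := by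
  have h1 := hf X hv
  have h2 := h.rank_add X
  have h3 : minorSupported L v P (X : Set V) ≤ supported L (X : Set V) := by
    rintro x ⟨a1, a2, a3⟩
    have h4 : form (x v) (u v) = 0 := h.form_eq_zero_of_single a1 hu.1 fun z hz => by
      by_cases hzX : z ∈ X
      · exact Or.inr (hu.2 z fun h => Finset.disjoint_left.1 hB hzX h)
      · exact Or.inl (a2 z fun h => h.elim hz hzX)
    have h5 : x v = 0 := by
      rcases (form_eq_zero_iff hP).1 a3 with h | h
      · exact h
      · rw [h, form_comm] at h4
        exact (huP h4).elim
    refine ⟨a1, fun z hz => ?_⟩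
    by_cases hzv : z = v
    · rw [hzv, h5]
    · exact a2 z fun h => h.elim hzv hz
  have h4 := Submodule.finrank_mono h3
  omega

/-! ### Vectors with three-element support -/

/-- If the labels at `v` of two vectors with three-element supports are different, then the supports
share another element. -/
theorem exists_mem_inter_ne (h : IsExcluded L ρ) (hw : IsTriple L T w) (hw' : IsTriple L T' w')
    (hv : v ∈ T) (hv' : v ∈ T') (hne : w v ≠ w' v) : ∃ z ∈ T, z ∈ T' ∧ z ≠ v := by
  by_contra! hc
  refine form_ne_zero_of_ne (hw.apply_ne_zero h hv) (hw'.apply_ne_zero h hv') hne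
    (h.form_eq_zero_of_single hw.2.1.1 hw'.2.1.1 fun z hz => ?_)
  by_cases hzT : z ∈ T
  · exact Or.inr (hw'.2.1.2 z fun hz' => hz (hc z hzT hz'))
  · exact Or.inl (hw.2.1.2 z hzT)

theorem exists_triple_of_card_eq_two (hP : P ≠ 0) (h : IsExcluded L ρ)
    (hf : IsMinorRank L v P f) (hv : v ∉ X) (hX : X.card = 2) (hfX : f X ≤ 1) :
    ∃ w, IsTriple L (insert v X) w ∧ w v = P := by
  have h1 := hf X hv
  obtain ⟨w, ⟨a1, a2, a3⟩, hw0⟩ := Submodule.exists_mem_ne_zero_of_ne_bot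
    (Submodule.one_le_finrank_iff.1 (by omega :
      1 ≤ Module.finrank (ZMod 2) (minorSupported L v P (X : Set V))))
  have hw : IsTriple L (insert v X) w :=
    ⟨by rw [Finset.card_insert_of_notMem hv, hX], ⟨a1, by rwa [Finset.coe_insert]⟩, hw0⟩
  exact ⟨w, hw, ((form_eq_zero_iff hP).1 a3).resolve_left
    (hw.apply_ne_zero h (Finset.mem_insert_self v X))⟩

/-- A set of cut-rank at most `1` and size `2` or `3` in the minor comes from a vector with
three-element support. For size `3`, two independent vectors of the minor with full support on the
set would have to be non-orthogonal at each of the three elements, which contradicts isotropy. -/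
theorem exists_triple (hP : P ≠ 0) (h : IsExcluded L ρ) (hf : IsMinorRank L v P f) (hv : v ∉ X)
    (h2 : 2 ≤ X.card) (h3 : X.card ≤ 3) (hfX : f X ≤ 1) :
    ∃ T w, IsTriple L T w ∧ v ∈ T ∧ T ⊆ insert v X ∧ w v = P := by
  by_cases hX : X.card = 2
  · obtain ⟨w, hw, hwv⟩ := exists_triple_of_card_eq_two hP h hf hv hX hfX
    exact ⟨_, w, hw, Finset.mem_insert_self v X, subset_rfl, hwv⟩
  have h1 := hf X hv
  obtain ⟨w, ⟨a1, a2, a3⟩, hw0, z, hz, hwz⟩ : ∃ w ∈ minorSupported L v P (X : Set V), w ≠ 0 ∧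
      ∃ z ∈ X, w z = 0 := by
    by_contra! hc
    obtain ⟨a, ha, b, hb, ha0, hb0, hab⟩ := exists_ne_of_two_le_finrank (by omega :
      2 ≤ Module.finrank (ZMod 2) (minorSupported L v P (X : Set V)))
    have hab0 : a + b ≠ 0 := fun e => hab (by
      rw [← add_zero a, ← add_self_eq_zero_of_zmod_two b, ← add_assoc, e, zero_add])
    have hs := h.isotropic a ha.1 b hb.1
    rw [← Finset.sum_subset (Finset.subset_univ (insert v X)) fun z _ hz => by
      rw [ha.2.1 z (by rwa [← Finset.coe_insert]), form_zero_left], Finset.sum_insert hv] at hs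
    have hv0 : form (a v) (b v) = 0 := by
      rcases (form_eq_zero_iff hP).1 ha.2.2 with e | e <;>
        rcases (form_eq_zero_iff hP).1 hb.2.2 with e' | e' <;> rw [e, e'] <;>
        simp [form_zero_left, form_zero_right, form_self]
    have hX1 : ∑ z ∈ X, form (a z) (b z) = ∑ z ∈ X, 1 := Finset.sum_congr rfl fun z hz =>
      form_eq_one (hc a ha ha0 z hz) (hc b hb hb0 z hz)
        (hc (a + b) (Submodule.add_mem _ ha hb) hab0 z hz)
    rw [hv0, hX1, Finset.sum_const, show X.card = 3 by omega] at hs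
    exact absurd hs (by decide)
  have hvz : v ∉ X.erase z := fun h => hv (Finset.mem_of_mem_erase h)
  have hw : IsTriple L (insert v (X.erase z)) w := by
    refine ⟨?_, ⟨a1, fun y hy => ?_⟩, hw0⟩
    · rw [Finset.card_insert_of_notMem hvz, Finset.card_erase_of_mem hz]; omega
    · by_cases hyz : y = z
      · rw [hyz, hwz]
      · refine a2 y fun h => hy ?_
        rcases h with h | h
        · exact Finset.mem_coe.2 (Finset.mem_insert.2 (Or.inl h))
        · exact Finset.mem_coe.2 (Finset.mem_insert_of_mem (Finset.mem_erase.2 ⟨hyz, h⟩))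
  exact ⟨_, w, hw, Finset.mem_insert_self _ _,
    Finset.insert_subset_insert _ (Finset.erase_subset _ _),
    ((form_eq_zero_iff hP).1 a3).resolve_left (hw.apply_ne_zero h (Finset.mem_insert_self _ _))⟩

/-- It suffices to find the vectors with three-element support for those labels that are not
orthogonal to all of the labels at `v`. -/
theorem forall_exists_triple (h : IsExcluded L ρ) (hB : ρ B = 2) (h3 : 3 ≤ B.card)
    (hB' : 2 ≤ (Finset.univ \ B).card)
    (hall : ∀ v ∈ B, ∀ P, IsAxis P → (∃ u ∈ supported L (B : Set V), form (u v) P ≠ 0) →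
      ∃ T w, IsTriple L T w ∧ v ∈ T ∧ T ⊆ B ∧ w v = P) :
    ∀ v ∈ B, ∀ P, IsAxis P → ∃ T w, IsTriple L T w ∧ v ∈ T ∧ T ⊆ B ∧ w v = P := by
  intro v hv P hP
  obtain ⟨u, hu, huv⟩ : ∃ u ∈ supported L (B : Set V), u v ≠ 0 := by
    by_contra! hc
    have h1 : supported L (B : Set V) ≤ supported L ((B.erase v : Finset V) : Set V) := by
      intro u hu
      refine ⟨hu.1, fun z hz => ?_⟩
      by_cases hzv : z = v
      · rw [hzv, hc u hu]
      · exact hu.2 z fun h => hz (Finset.mem_coe.2 (Finset.mem_erase.2 ⟨hzv, h⟩))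
    have h2 := Submodule.finrank_mono h1
    have h3 := h.rank_add B
    have h4 := h.rank_add (B.erase v)
    have h5 := Finset.card_erase_of_mem hv
    have h6 := h.card_compl B
    have h7 := h.card_compl (B.erase v)
    have h8 := h.two_le_rank (X := B.erase v) (by omega) (by omega)
    omega
  by_cases huP : form (u v) P = 0
  · have e := ((form_eq_zero_iff hP.ne_zero).1 huP).resolve_left huv
    obtain ⟨Q, hQ, hne⟩ := hP.exists_ne
    obtain ⟨T, w, hw, hvT, hTB, hwv⟩ := hall v hv Q hQ
      ⟨u, hu, by rw [e]; exact form_ne_zero_of_ne hP.ne_zero hQ.ne_zero hne.symm⟩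
    exact hall v hv P hP ⟨w, supported_mono (Finset.coe_subset.2 hTB) hw.2.1, by
      rw [hwv]; exact form_ne_zero_of_ne hQ.ne_zero hP.ne_zero hne⟩
  · exact hall v hv P hP ⟨u, hu, huP⟩

theorem finrank_erase_add_two_le {s : V} (hs : s ∈ B)
    (hall : ∀ P, IsAxis P → ∃ T w, IsTriple L T w ∧ s ∈ T ∧ T ⊆ B ∧ w s = P) :
    Module.finrank (ZMod 2) (supported L ((B.erase s : Finset V) : Set V)) + 2 ≤
      Module.finrank (ZMod 2) (supported L (B : Set V)) := by
  obtain ⟨T, w, hw, hsT, hTB, hws⟩ := hall (0, 1) (Or.inl rfl)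
  obtain ⟨T', w', hw', hsT', hTB', hws'⟩ := hall (1, 0) (Or.inr rfl)
  have e : insert s ((B.erase s : Finset V) : Set V) = B := by
    rw [← Finset.coe_insert, Finset.insert_erase hs]
  have h1 : supported L ((B.erase s : Finset V) : Set V) <
      minorSupported L s (0, 1) ((B.erase s : Finset V) : Set V) := by
    refine lt_of_le_of_ne (fun u hu => ⟨hu.1, fun z hz => hu.2 z fun h => hz (Or.inr h), ?_⟩)
      fun e' => ?_
    · rw [hu.2 s (by simp), form_zero_left]
    · have : w ∈ minorSupported L s (0, 1) ((B.erase s : Finset V) : Set V) :=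
        ⟨hw.2.1.1, by rw [e]; exact (supported_mono (Finset.coe_subset.2 hTB) hw.2.1).2, by
          rw [hws, form_self]⟩
      rw [← e'] at this
      have h0 := this.2 s (by simp)
      rw [hws] at h0
      exact absurd h0 (by decide)
  have h2 : minorSupported L s (0, 1) ((B.erase s : Finset V) : Set V) <
      supported L (B : Set V) := by
    refine lt_of_le_of_ne (by rw [← e]; exact minorSupported_le _ _ _) fun e' => ?_
    have : w' ∈ supported L (B : Set V) := supported_mono (Finset.coe_subset.2 hTB') hw'.2.1
    rw [← e'] at this
    have h0 := this.2.2
    rw [hws'] at h0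
    exact absurd h0 (by decide)
  have h3 := Submodule.finrank_lt_finrank_of_lt h1
  have h4 := Submodule.finrank_lt_finrank_of_lt h2
  omega

/-- A vector with three-element support misses an element `s` of `B`, and deleting `s` from `B`
removes two dimensions, which leaves none for that vector. -/
theorem card_ne_four (h : IsExcluded L ρ) (hB : ρ B = 2)
    (hall : ∀ v ∈ B, ∀ P, IsAxis P → ∃ T w, IsTriple L T w ∧ v ∈ T ∧ T ⊆ B ∧ w v = P) :
    B.card ≠ 4 := by
  intro h4
  obtain ⟨v, hv⟩ : B.Nonempty := Finset.card_pos.1 (by omega)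
  obtain ⟨T, w, hw, -, hTB, -⟩ := hall v hv (0, 1) (Or.inl rfl)
  obtain ⟨s, hs, hsT⟩ := Finset.exists_mem_notMem_of_card_lt_card (by rw [hw.1, h4]; omega :
    T.card < B.card)
  have h1 := finrank_erase_add_two_le hs (hall s hs)
  have h2 := one_le_finrank (supported_mono (L := L) (Finset.coe_subset.2
    (fun z hz => Finset.mem_erase.2 ⟨fun e => hsT (e ▸ hz), hTB hz⟩ : T ⊆ B.erase s)) hw.2.1) hw.2.2
  have h3 := h.rank_add B
  omega

/-- The same count as for four elements, with two vectors. -/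
theorem card_ne_five (h : IsExcluded L ρ) (hB : ρ B = 2)
    (hall : ∀ v ∈ B, ∀ P, IsAxis P → ∃ T w, IsTriple L T w ∧ v ∈ T ∧ T ⊆ B ∧ w v = P) :
    B.card ≠ 5 := by
  intro h5
  obtain ⟨v, hv⟩ : B.Nonempty := Finset.card_pos.1 (by omega)
  obtain ⟨T, w, hw, hvT, hTB, hwv⟩ := hall v hv (0, 1) (Or.inl rfl)
  obtain ⟨T', w', hw', hvT', hTB', hwv'⟩ := hall v hv (1, 0) (Or.inr rfl)
  have hne : w v ≠ w' v := by rw [hwv, hwv']; decide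
  -- The two supports share two elements, so that some `s` in `B` is in neither of them.
  obtain ⟨z, hzT, hzT', hzv⟩ := h.exists_mem_inter_ne hw hw' hvT hvT' hne
  have h1 : 2 ≤ (T ∩ T').card := by
    have : ({z, v} : Finset V) ⊆ T ∩ T' := by
      intro y hy
      rcases Finset.mem_insert.1 hy with rfl | hy
      · exact Finset.mem_inter.2 ⟨hzT, hzT'⟩
      · rw [Finset.mem_singleton.1 hy]; exact Finset.mem_inter.2 ⟨hvT, hvT'⟩
    have := Finset.card_le_card this
    rwa [Finset.card_pair hzv] at this
  have h2 := Finset.card_union_add_card_inter T T'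
  rw [hw.1, hw'.1] at h2
  obtain ⟨s, hs, hsT⟩ := Finset.exists_mem_notMem_of_card_lt_card (by omega :
    (T ∪ T').card < B.card)
  have h3 := finrank_erase_add_two_le hs (hall s hs)
  have h4 := two_le_finrank
    (supported_mono (L := L) (Finset.coe_subset.2 (fun z hz => Finset.mem_erase.2
      ⟨fun e => hsT (e ▸ Finset.mem_union_left _ hz), hTB hz⟩ : T ⊆ B.erase s)) hw.2.1)
    (supported_mono (L := L) (Finset.coe_subset.2 (fun z hz => Finset.mem_erase.2
      ⟨fun e => hsT (e ▸ Finset.mem_union_right _ hz), hTB' hz⟩ : T' ⊆ B.erase s)) hw'.2.1)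
    hw.2.2 hw'.2.2 fun e => hne (by rw [e])
  have h5 := h.rank_add B
  omega

end IsExcluded

omit [Fintype V] in
theorem card_inter_add_card_inter {X Y Z : Finset V} (hd : Disjoint Y Z) (hX : X ⊆ Y ∪ Z) :
    (X ∩ Y).card + (X ∩ Z).card = X.card := by
  rw [← Finset.card_union_of_disjoint (hd.mono Finset.inter_subset_right Finset.inter_subset_right),
    ← Finset.inter_union_distrib_left, Finset.inter_eq_left.2 hX]

namespace IsExcluded

variable {a b c v : V} {P Q : Label} {f g : Finset V → ℕ} {X Y A A' B T T' : Finset V}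
  {u w w' : V → Label}

/-! ### Sets of cut-rank two -/

theorem branched_of_subset (h : IsExcluded L ρ) (hA' : Branched ρ 2 A') (hAA : A ⊆ A')
    (hA : ρ A ≤ 2) (h2 : 2 ≤ (Finset.univ \ A').card) : Branched ρ 2 A := by
  have key := hA'.inter (g := ρ) A fun Y hY hf => by
    have h1 := h.submodular Y A
    by_cases hc : 2 ≤ (Y ∪ A).card
    · have h3 := h.two_le_rank hc (h2.trans (Finset.card_le_card
        (Finset.sdiff_subset_sdiff subset_rfl (Finset.union_subset hY hAA))))
      omega
    · have h3 := h.rank_add (Y ∩ A)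
      have h4 := Finset.card_le_card (Finset.inter_subset_union : Y ∩ A ⊆ Y ∪ A)
      omega
  rwa [Finset.inter_eq_right.2 hAA] at key

/-- If the complement of a set `B` of cut-rank `2` has no tree, then `B.erase v` is not titanic in
those minors at `v` that preserve the rank of `B`. -/
theorem exists_partition (h : IsExcluded L ρ) (hB : ρ B = 2) (hv : v ∈ B) (hP : IsAxis P)
    (hu : u ∈ supported L (B : Set V)) (huP : form (u v) P ≠ 0)
    (hnb : ¬ Branched ρ 2 (Finset.univ \ B)) :
    ∃ f, IsMinorRank L v P f ∧ f (B.erase v) = 2 ∧ ∃ Z₁ Z₂ Z₃, Z₁ ∪ Z₂ ∪ Z₃ = B.erase v ∧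
      Disjoint Z₁ Z₂ ∧ Disjoint Z₁ Z₃ ∧ Disjoint Z₂ Z₃ ∧ f Z₁ ≤ 1 ∧ f Z₂ ≤ 1 ∧ f Z₃ ≤ 1 := by
  obtain ⟨f, hf, hs, hbr⟩ := h.minor v P hP
  have hvB : v ∉ B.erase v := Finset.notMem_erase v B
  have hfB : f (B.erase v) = 2 := by
    have h1 := h.rank_insert_le_of_form_ne_zero hf hvB hu
      (by rw [Finset.insert_erase hv]) huP
    have h2 := h.le_rank_insert hf hvB
    rw [Finset.insert_erase hv] at h1 h2
    omega
  refine ⟨f, hf, hfB, ?_⟩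
  by_contra! hc
  have hbr' := hbr.sdiff_of_titanic hs (fun Y hY Z hZ =>
    hf.submodular (fun h => Finset.notMem_erase v _ (hY h))
      fun h => Finset.notMem_erase v _ (hZ h))
    (Finset.erase_subset_erase v (Finset.subset_univ B)) hfB.le fun Z₁ Z₂ Z₃ e h1 h2 h3 => by
      have := hc Z₁ Z₂ Z₃ e h1 h2 h3
      omega
  have e : Finset.univ.erase v \ B.erase v = Finset.univ \ B := by
    ext z
    by_cases hz : z = v
    · subst hz; simp [hv]
    · simp [hz]
  rw [e] at hbr'
  refine hnb (hbr'.of_le fun Y hY hle => le_trans ?_ hle)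
  exact h.rank_le_of_disjoint hP.ne_zero hf (fun h => (Finset.mem_sdiff.1 (hY h)).2 hv) hu
    (Finset.disjoint_left.2 fun z hz => (Finset.mem_sdiff.1 (hY hz)).2) huP

/-- Every set of cut-rank at most `2` has at most four elements or at most four non-elements.
In a minimal set `B` that violates this and whose complement has no tree, all the parts of a
partition that shows `B.erase v` not to be titanic have at most three elements, which provides
vectors with three-element support inside `B` and with both kinds of labels at `v`. -/
theorem card_le_four (h : IsExcluded L ρ) (hX : ρ X ≤ 2) :
    X.card ≤ 4 ∨ (Finset.univ \ X).card ≤ 4 := by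
  by_contra! hX4
  have hn := h.card_ge
  let bad : Finset V → Prop := fun B => ρ B ≤ 2 ∧ 5 ≤ B.card ∧ 5 ≤ (Finset.univ \ B).card ∧
    ¬ Branched ρ 2 (Finset.univ \ B)
  have hex : ∃ B, bad B := by
    by_contra! hc
    have e : Finset.univ \ (Finset.univ \ X) = X := Finset.sdiff_sdiff_eq_self (Finset.subset_univ X)
    have h1 : Branched ρ 2 (Finset.univ \ X) := by
      by_contra hb
      exact hc X ⟨hX, hX4.1, hX4.2, hb⟩
    have h2 : Branched ρ 2 X := by
      by_contra hb
      exact hc (Finset.univ \ X) ⟨by rwa [h.symm], hX4.2, by rw [e]; exact hX4.1, by rwa [e]⟩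
    have h3 := Branched.union h2 h1 Finset.disjoint_sdiff (by
      rw [Finset.union_sdiff_of_subset (Finset.subset_univ X), h.rank_univ]; omega)
    rw [Finset.union_sdiff_of_subset (Finset.subset_univ X)] at h3
    exact h.not_branched h3
  obtain ⟨B, ⟨hB2, hB5, hBc, hnb⟩, hmin⟩ := exists_minimal_of_wellFoundedLT bad hex
  have hB : ρ B = 2 := le_antisymm hB2 (h.two_le_rank (by omega) (by omega))
  have hsmall : ∀ Z ⊂ B, ρ Z ≤ 2 → Z.card ≤ 4 := by
    intro Z hZ hρ
    by_contra! h5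
    have h6 : Finset.univ \ B ⊆ Finset.univ \ Z := Finset.sdiff_subset_sdiff subset_rfl hZ.1
    have h7 : Branched ρ 2 (Finset.univ \ Z) := by
      by_contra hb
      exact hZ.2 (hmin ⟨hρ, h5, hBc.trans (Finset.card_le_card h6), hb⟩ hZ.1)
    refine hnb (h.branched_of_subset h7 h6 (by rw [h.symm, hB]) ?_)
    rw [Finset.sdiff_sdiff_eq_self (Finset.subset_univ Z)]
    omega
  have hpart : ∀ v ∈ B, ∀ P, IsAxis P → (∃ u ∈ supported L (B : Set V), form (u v) P ≠ 0) →
      ∃ f, IsMinorRank L v P f ∧ ∃ Z₁ Z₂ Z₃, (Z₁ ⊆ B.erase v ∧ Z₂ ⊆ B.erase v ∧ Z₃ ⊆ B.erase v) ∧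
        (Disjoint Z₁ Z₂ ∧ Disjoint Z₁ Z₃ ∧ Disjoint Z₂ Z₃) ∧ (f Z₁ ≤ 1 ∧ f Z₂ ≤ 1 ∧ f Z₃ ≤ 1) ∧
        (Z₁.card ≤ 3 ∧ Z₂.card ≤ 3 ∧ Z₃.card ≤ 3) ∧ Z₁.card + Z₂.card + Z₃.card + 1 = B.card := by
    rintro v hv P hP ⟨u, hu, huP⟩
    obtain ⟨f, hf, hfB, Z₁, Z₂, Z₃, e, d12, d13, d23, f1, f2, f3⟩ :=
      h.exists_partition hB hv hP hu huP hnb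
    have hcard : ∀ Z ⊆ B.erase v, f Z ≤ 1 → Z.card ≤ 3 := by
      intro Z hZ hfZ
      have hvZ : v ∉ Z := fun h => Finset.notMem_erase v B (hZ h)
      have h1 := h.rank_insert_le hf hvZ
      have h2 : insert v Z ⊂ B := by
        refine (Finset.ssubset_iff_subset_ne).2 ⟨Finset.insert_subset hv
          (hZ.trans (Finset.erase_subset v B)), fun e => ?_⟩
        rw [← e, Finset.erase_insert hvZ] at hfB
        omega
      have h3 := hsmall _ h2 (by omega)
      rw [Finset.card_insert_of_notMem hvZ] at h3
      omega
    have s1 : Z₁ ⊆ B.erase v := e ▸ fun z hz => by simp [hz]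
    have s2 : Z₂ ⊆ B.erase v := e ▸ fun z hz => by simp [hz]
    have s3 : Z₃ ⊆ B.erase v := e ▸ fun z hz => by simp [hz]
    refine ⟨f, hf, Z₁, Z₂, Z₃, ⟨s1, s2, s3⟩, ⟨d12, d13, d23⟩, ⟨f1, f2, f3⟩,
      ⟨hcard _ s1 f1, hcard _ s2 f2, hcard _ s3 f3⟩, ?_⟩
    rw [← Finset.card_union_of_disjoint d12, ← Finset.card_union_of_disjoint
      (Finset.disjoint_union_left.2 ⟨d13, d23⟩), e, Finset.card_erase_add_one hv]
  have htri : ∀ v ∈ B, ∀ P, IsAxis P → ∀ f, IsMinorRank L v P f → ∀ Z ⊆ B.erase v, f Z ≤ 1 →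
      Z.card ≤ 3 → 2 ≤ Z.card → ∃ T w, IsTriple L T w ∧ v ∈ T ∧ T ⊆ insert v Z ∧ w v = P :=
    fun v hv P hP f hf Z hZ hfZ h3 h2 => h.exists_triple hP.ne_zero hf
      (fun h => Finset.notMem_erase v B (hZ h)) h2 h3 hfZ
  have hins : ∀ v ∈ B, ∀ Z ⊆ B.erase v, insert v Z ⊆ B := fun v hv Z hZ =>
    Finset.insert_subset hv (hZ.trans (Finset.erase_subset v B))
  have hall := h.forall_exists_triple hB (by omega) (by omega) fun v hv P hP hu => by
    obtain ⟨f, hf, Z₁, Z₂, Z₃, ⟨s1, s2, s3⟩, -, ⟨f1, f2, f3⟩, ⟨c1, c2, c3⟩, hc⟩ := hpart v hv P hP hu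
    obtain ⟨Z, hZ, hfZ, hZ3, hZ2⟩ : ∃ Z ⊆ B.erase v, f Z ≤ 1 ∧ Z.card ≤ 3 ∧ 2 ≤ Z.card := by
      by_cases h1 : 2 ≤ Z₁.card
      · exact ⟨Z₁, s1, f1, c1, h1⟩
      by_cases h2 : 2 ≤ Z₂.card
      · exact ⟨Z₂, s2, f2, c2, h2⟩
      · exact ⟨Z₃, s3, f3, c3, by omega⟩
    obtain ⟨T, w, hw, hvT, hTZ, hwv⟩ := htri v hv P hP f hf Z hZ hfZ hZ3 hZ2
    exact ⟨T, w, hw, hvT, hTZ.trans (hins v hv Z hZ), hwv⟩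
  have hB6 : 6 ≤ B.card := lt_of_le_of_ne hB5 (h.card_ne_five hB hall).symm
  obtain ⟨v, hv⟩ : B.Nonempty := Finset.card_pos.1 (by omega)
  obtain ⟨T, w, hw, hvT, hTB, hwv⟩ := hall v hv (0, 1) (Or.inl rfl)
  have hne : ∀ w' : V → Label, w' v = (1, 0) → w v ≠ w' v := fun w' e => by rw [hwv, e]; decide
  -- Two vectors with the label `(1, 0)` at `v` whose supports share only `v`.
  obtain ⟨T₁, w₁, T₂, w₂, hw₁, hw₂, hv₁, hv₂, hT₁, hT₂, e₁, e₂, hmeet⟩ : ∃ T₁ w₁ T₂ w₂,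
      IsTriple L T₁ w₁ ∧ IsTriple L T₂ w₂ ∧ v ∈ T₁ ∧ v ∈ T₂ ∧ T₁ ⊆ B ∧ T₂ ⊆ B ∧
        w₁ v = (1, 0) ∧ w₂ v = (1, 0) ∧ ∀ z ∈ T₁, z ∈ T₂ → z = v := by
    obtain ⟨f, hf, Z₁, Z₂, Z₃, ⟨s1, s2, s3⟩, ⟨d12, d13, d23⟩, ⟨f1, f2, f3⟩, ⟨c1, c2, c3⟩, hc⟩ :=
      hpart v hv (1, 0) (Or.inr rfl) ⟨w, supported_mono (Finset.coe_subset.2 hTB) hw.2.1, by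
        rw [hwv]; decide⟩
    -- A part with three elements would span, together with `T`, a set of five elements and
    -- cut-rank `2`, which contradicts the minimality of `B`.
    have hle : ∀ Z ⊆ B.erase v, f Z ≤ 1 → Z.card ≤ 3 → Z.card ≤ 2 := by
      intro Z hZ hfZ hZ3
      by_contra! hlt
      have hvZ : v ∉ Z := fun h => Finset.notMem_erase v B (hZ h)
      obtain ⟨T₁, w₁, hw₁, hv₁, hT₁, e₁⟩ :=
        htri v hv _ (Or.inr rfl) f hf Z hZ hfZ hZ3 hlt.le
      obtain ⟨z, hz, hz', hzv⟩ := h.exists_mem_inter_ne hw hw₁ hvT hv₁ (hne _ e₁)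
      have g1 := Finset.card_union_add_card_inter (insert v Z) T
      have g2 : 2 ≤ (insert v Z ∩ T).card := by
        rw [← Finset.card_pair hzv]
        refine Finset.card_le_card fun y hy => ?_
        simp only [Finset.mem_insert, Finset.mem_singleton] at hy
        rcases hy with rfl | rfl
        · exact Finset.mem_inter.2 ⟨hT₁ hz', hz⟩
        · exact Finset.mem_inter.2 ⟨hT₁ hv₁, hvT⟩
      have g3 : minorSupported L v (1, 0) (Z : Set V) <
          supported L ((insert v Z ∪ T : Finset V) : Set V) := by
        refine lt_of_le_of_ne ((minorSupported_le _ _ _).trans (supported_mono ?_)) fun e => ?_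
        · rw [← Finset.coe_insert]
          exact Finset.coe_subset.2 Finset.subset_union_left
        · have hwD := supported_mono (L := L) (Finset.coe_subset.2
            (Finset.subset_union_right : T ⊆ insert v Z ∪ T)) hw.2.1
          rw [← e] at hwD
          have h0 := hwD.2.2
          rw [hwv] at h0
          exact absurd h0 (by decide)
      have g4 := Submodule.finrank_lt_finrank_of_lt g3
      have g5 := h.rank_add (insert v Z ∪ T)
      have g6 := hf Z hvZ
      have g7 := Finset.card_le_card
        (Finset.subset_union_left : insert v Z ⊆ insert v Z ∪ T)
      have g8 := h.card_compl (insert v Z ∪ T)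
      rw [Finset.card_insert_of_notMem hvZ] at g1 g7
      rw [hw.1] at g1
      have g9 := hsmall (insert v Z ∪ T) (Finset.ssubset_iff_subset_ne.2
        ⟨Finset.union_subset (hins v hv Z hZ) hTB, fun e => by rw [e] at g1; omega⟩) (by omega)
      have g10 := h.two_le_rank (X := insert v Z ∪ T) (by omega) (by omega)
      omega
    replace c1 := hle _ s1 f1 c1
    replace c2 := hle _ s2 f2 c2
    replace c3 := hle _ s3 f3 c3
    obtain ⟨Y, Z, sY, sZ, hd, fY, fZ, cY, cZ, bY, bZ⟩ : ∃ Y Z, Y ⊆ B.erase v ∧ Z ⊆ B.erase v ∧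
        Disjoint Y Z ∧ f Y ≤ 1 ∧ f Z ≤ 1 ∧ Y.card ≤ 2 ∧ Z.card ≤ 2 ∧ 2 ≤ Y.card ∧ 2 ≤ Z.card := by
      by_cases h1 : 2 ≤ Z₁.card
      · by_cases h2 : 2 ≤ Z₂.card
        · exact ⟨Z₁, Z₂, s1, s2, d12, f1, f2, c1, c2, h1, h2⟩
        · exact ⟨Z₁, Z₃, s1, s3, d13, f1, f3, c1, c3, h1, by omega⟩
      · exact ⟨Z₂, Z₃, s2, s3, d23, f2, f3, c2, c3, by omega, by omega⟩
    obtain ⟨T₁, w₁, hw₁, hv₁, hT₁, e₁⟩ := htri v hv _ (Or.inr rfl) f hf Y sY fY (by omega) bY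
    obtain ⟨T₂, w₂, hw₂, hv₂, hT₂, e₂⟩ := htri v hv _ (Or.inr rfl) f hf Z sZ fZ (by omega) bZ
    refine ⟨T₁, w₁, T₂, w₂, hw₁, hw₂, hv₁, hv₂, hT₁.trans (hins v hv Y sY),
      hT₂.trans (hins v hv Z sZ), e₁, e₂, fun z h1 h2 => ?_⟩
    by_contra hz
    exact Finset.disjoint_left.1 hd ((Finset.mem_insert.1 (hT₁ h1)).resolve_left hz)
      ((Finset.mem_insert.1 (hT₂ h2)).resolve_left hz)
  obtain ⟨z₁, hz₁, hz₁', hz₁v⟩ := h.exists_mem_inter_ne hw hw₁ hvT hv₁ (hne _ e₁)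
  obtain ⟨z₂, hz₂, hz₂', hz₂v⟩ := h.exists_mem_inter_ne hw hw₂ hvT hv₂ (hne _ e₂)
  have hz12 : z₁ ≠ z₂ := fun e => hz₁v (hmeet z₁ hz₁' (e ▸ hz₂'))
  have hT : T ⊆ T₁ ∪ T₂ := by
    have e : ({v, z₁, z₂} : Finset V) = T := by
      refine Finset.eq_of_subset_of_card_le (fun z hz => ?_) ?_
      · simp only [Finset.mem_insert, Finset.mem_singleton] at hz
        rcases hz with rfl | rfl | rfl <;> assumption
      · rw [hw.1, Finset.card_eq_three.2 ⟨v, z₁, z₂, hz₁v.symm, hz₂v.symm, hz12, rfl⟩]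
    rw [← e]
    intro z hz
    simp only [Finset.mem_insert, Finset.mem_singleton] at hz
    rcases hz with rfl | rfl | rfl
    · exact Finset.mem_union_left _ hv₁
    · exact Finset.mem_union_left _ hz₁'
    · exact Finset.mem_union_right _ hz₂'
  have hD5 : (T₁ ∪ T₂).card = 5 := by
    have h1 := Finset.card_union_add_card_inter T₁ T₂
    have h2 : T₁ ∩ T₂ = {v} := by
      ext z
      simp only [Finset.mem_inter, Finset.mem_singleton]
      exact ⟨fun hz => hmeet z hz.1 hz.2, fun e => e ▸ ⟨hv₁, hv₂⟩⟩
    rw [h2, Finset.card_singleton, hw₁.1, hw₂.1] at h1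
    omega
  have hvD : v ∈ T₁ ∪ T₂ := Finset.mem_union_left _ hv₁
  have e : insert v (((T₁ ∪ T₂).erase v : Finset V) : Set V) = ((T₁ ∪ T₂ : Finset V) : Set V) := by
    rw [← Finset.coe_insert, Finset.insert_erase hvD]
  have hm : ∀ T' w', T' ⊆ T₁ ∪ T₂ → IsTriple L T' w' → w' v = (1, 0) →
      w' ∈ minorSupported L v (1, 0) (((T₁ ∪ T₂).erase v : Finset V) : Set V) :=
    fun T' w' hT' hw' e' => ⟨hw'.2.1.1, by
      rw [e]; exact (supported_mono (Finset.coe_subset.2 hT') hw'.2.1).2, by rw [e', form_self]⟩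
  have h1 := two_le_finrank (hm T₁ w₁ Finset.subset_union_left hw₁ e₁)
    (hm T₂ w₂ Finset.subset_union_right hw₂ e₂) hw₁.2.2 hw₂.2.2 fun e' =>
      hw₁.apply_ne_zero h hz₁' (by
        rw [e']; exact hw₂.2.1.2 z₁ fun hz => hz₁v (hmeet z₁ hz₁' hz))
  have h2 : minorSupported L v (1, 0) (((T₁ ∪ T₂).erase v : Finset V) : Set V) <
      supported L ((T₁ ∪ T₂ : Finset V) : Set V) := by
    refine lt_of_le_of_ne (by rw [← e]; exact minorSupported_le _ _ _) fun e' => ?_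
    have hwD := supported_mono (L := L) (Finset.coe_subset.2 hT) hw.2.1
    rw [← e'] at hwD
    have h0 := hwD.2.2
    rw [hwv] at h0
    exact absurd h0 (by decide)
  have h3 := Submodule.finrank_lt_finrank_of_lt h2
  have h4 := h.rank_add (T₁ ∪ T₂)
  have h5 : T₁ ∪ T₂ ⊂ B := Finset.ssubset_iff_subset_ne.2 ⟨Finset.union_subset hT₁ hT₂,
    fun e => by rw [e] at hD5; omega⟩
  have h6 := hsmall _ h5 (by omega)
  omega

/-! ### Balanced cuts of the minors -/

/-- Each minor has a cut of rank at most `2` with at least six vertices on both sides. -/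
theorem exists_cut (h : IsExcluded L ρ) (v : V) (hP : IsAxis P) :
    ∃ f, IsMinorRank L v P f ∧ ∃ X Y : Finset V, v ∉ X ∧ v ∉ Y ∧ Disjoint X Y ∧
      (∀ z, z ≠ v → z ∈ X ∨ z ∈ Y) ∧ f X ≤ 2 ∧ f Y ≤ 2 ∧ 6 ≤ X.card ∧ 6 ≤ Y.card := by
  obtain ⟨f, hf, hs, hbr⟩ := h.minor v P hP
  have hn := h.card_ge
  have hc : (Finset.univ.erase v).card + 1 = Fintype.card V := by
    rw [Finset.card_erase_add_one (Finset.mem_univ v), Finset.card_univ]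
  obtain ⟨X, hX, hfX, h6, h10⟩ := hbr.exists_card_mem_Icc (by omega)
  have h1 := Finset.card_sdiff_add_card_eq_card hX
  refine ⟨f, hf, X, Finset.univ.erase v \ X, fun h => Finset.notMem_erase v _ (hX h),
    fun h => Finset.notMem_erase v _ (Finset.mem_sdiff.1 h).1, Finset.disjoint_sdiff,
    fun z hz => ?_, hfX, by rwa [hs X hX], h6, by omega⟩
  by_cases hzX : z ∈ X
  · exact Or.inl hzX
  · exact Or.inr (Finset.mem_sdiff.2 ⟨Finset.mem_erase.2 ⟨hz, Finset.mem_univ z⟩, hzX⟩)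

theorem rank_ne_two_of_card_eq_four (h : IsExcluded L ρ) (h4 : B.card = 4) : ρ B ≠ 2 := by
  intro hB
  have hn := h.card_ge
  have hcB := h.card_compl B
  obtain ⟨v, hv, P, hP, ⟨u, hu, huP⟩, hno⟩ : ∃ v ∈ B, ∃ P, IsAxis P ∧
      (∃ u ∈ supported L (B : Set V), form (u v) P ≠ 0) ∧
      ¬ ∃ T w, IsTriple L T w ∧ v ∈ T ∧ T ⊆ B ∧ w v = P := by
    by_contra hc
    refine h.card_ne_four hB (h.forall_exists_triple hB (by omega) (by omega) ?_) h4
    intro v hv P hP hu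
    by_contra hno
    exact hc ⟨v, hv, P, hP, hu, hno⟩
  obtain ⟨f, hf, X, Y, hvX, hvY, hd, hXY, hfX, hfY, hX6, hY6⟩ := h.exists_cut v hP
  have hvE := Finset.notMem_erase v B
  have hE3 : (B.erase v).card = 3 := by rw [Finset.card_erase_of_mem hv, h4]
  have hsum := card_inter_add_card_inter (X := B.erase v) hd fun z hz =>
    Finset.mem_union.2 (hXY z (Finset.ne_of_mem_erase hz))
  -- The side of the cut that contains most of `B.erase v` can be enlarged by all of `B`.
  have key : ∀ X Y : Finset V, v ∉ X → v ∉ Y → Disjoint X Y → f X ≤ 2 → 6 ≤ X.card → 6 ≤ Y.card →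
      2 ≤ (B.erase v ∩ X).card → (B.erase v ∩ Y).card ≤ 1 → False := by
    intro X Y hvX hvY hd hfX hX6 hY6 hEX hEY
    have h1 := hf.submodular hvE hvX
    have h2 : 2 ≤ f (B.erase v ∩ X) := by
      by_contra! hlt
      obtain ⟨T, w, hw, hvT, hTE, hwv⟩ := h.exists_triple hP.ne_zero hf
        (fun h => hvE (Finset.mem_inter.1 h).1) hEX
        (hE3 ▸ Finset.card_le_card Finset.inter_subset_left) (by omega)
      exact hno ⟨T, w, hw, hvT, hTE.trans (Finset.insert_subset hv
        (Finset.inter_subset_left.trans (Finset.erase_subset v B))), hwv⟩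
    have h3 := h.le_rank_insert hf hvE
    rw [Finset.insert_erase hv] at h3
    have hvU : v ∉ B.erase v ∪ X := fun h => (Finset.mem_union.1 h).elim hvE hvX
    have h4 := h.rank_insert_le_of_form_ne_zero hf hvU hu (fun z hz => by
      by_cases hzv : z = v
      · exact Finset.mem_insert.2 (Or.inl hzv)
      · exact Finset.mem_insert_of_mem (Finset.mem_union_left _ (Finset.mem_erase.2 ⟨hzv, hz⟩))) huP
    have h5 : Y \ (B.erase v ∩ Y) ⊆ Finset.univ \ insert v (B.erase v ∪ X) := by
      intro z hz
      obtain ⟨hzY, hzE⟩ := Finset.mem_sdiff.1 hz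
      refine Finset.mem_sdiff.2 ⟨Finset.mem_univ z, fun hz' => ?_⟩
      rcases Finset.mem_insert.1 hz' with rfl | hz'
      · exact hvY hzY
      · rcases Finset.mem_union.1 hz' with hz' | hz'
        · exact hzE (Finset.mem_inter.2 ⟨hz', hzY⟩)
        · exact Finset.disjoint_left.1 hd hz' hzY
    have h6 := Finset.card_le_card h5
    have h7 := Finset.card_sdiff_add_card_eq_card
      (Finset.inter_subset_right : B.erase v ∩ Y ⊆ Y)
    have h8 := Finset.card_le_card (Finset.subset_union_right.trans
      (Finset.subset_insert v _) : X ⊆ insert v (B.erase v ∪ X))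
    rcases h.card_le_four (X := insert v (B.erase v ∪ X)) (by omega) with h9 | h9 <;> omega
  by_cases h2 : 2 ≤ (B.erase v ∩ X).card
  · exact key X Y hvX hvY hd hfX hX6 hY6 h2 (by omega)
  · exact key Y X hvY hvX hd.symm hfY hY6 hX6 (by omega) (by omega)

theorem card_le_three (h : IsExcluded L ρ) (hX : ρ X ≤ 2) :
    X.card ≤ 3 ∨ (Finset.univ \ X).card ≤ 3 := by
  have hn := h.card_ge
  have hc := h.card_compl X
  by_contra! h3
  have h2 := h.two_le_rank (X := X) (by omega) (by omega)
  rcases h.card_le_four hX with h4 | h4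
  · exact h.rank_ne_two_of_card_eq_four (B := X) (by omega) (by omega)
  · exact h.rank_ne_two_of_card_eq_four (B := Finset.univ \ X) (by omega) (by rw [h.symm]; omega)

end IsExcluded

/-! ### Vectors with three-element support do not exist -/

/-- A cut of rank at most `2` of the minor given by `a` and `P`, with sides `insert b X` and
`insert c Y`, where `{a, b, c}` contains the support of a vector `u` that witnesses that this minor
preserves the cut-rank of the sets containing `{a, b, c}`. -/
structure IsSplit (L : Submodule (ZMod 2) (V → Label)) (u : V → Label) (a b c : V) (P : Label)
    (f : Finset V → ℕ) (X Y : Finset V) : Prop where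
  isMinorRank : IsMinorRank L a P f
  axis : IsAxis P
  form_ne_zero : form (u a) P ≠ 0
  mem_supported : u ∈ supported L ({a, b, c} : Set V)
  ne₁ : a ≠ b
  ne₂ : a ≠ c
  ne₃ : b ≠ c
  disjoint : Disjoint X Y
  mem_iff : ∀ z, z ∈ X ∨ z ∈ Y ↔ z ≠ a ∧ z ≠ b ∧ z ≠ c
  left : f (insert b X) ≤ 2
  right : f (insert c Y) ≤ 2

namespace IsSplit

variable {a b c : V} {P Q : Label} {f g : Finset V → ℕ} {X Y Z W : Finset V} {u : V → Label}

omit [Fintype V] in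
theorem symm (h : IsSplit L u a b c P f X Y) : IsSplit L u a c b P f Y X where
  isMinorRank := h.isMinorRank
  axis := h.axis
  form_ne_zero := h.form_ne_zero
  mem_supported := by rw [Set.pair_comm c b]; exact h.mem_supported
  ne₁ := h.ne₂
  ne₂ := h.ne₁
  ne₃ := h.ne₃.symm
  disjoint := h.disjoint.symm
  mem_iff z := by rw [or_comm, h.mem_iff, and_comm (a := z ≠ b)]
  left := h.right
  right := h.left

omit [Fintype V] in
theorem notMem_left (h : IsSplit L u a b c P f X Y) : a ∉ X ∧ b ∉ X ∧ c ∉ X :=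
  ⟨fun hz => ((h.mem_iff a).1 (Or.inl hz)).1 rfl, fun hz => ((h.mem_iff b).1 (Or.inl hz)).2.1 rfl,
    fun hz => ((h.mem_iff c).1 (Or.inl hz)).2.2 rfl⟩

omit [Fintype V] in
theorem notMem_right (h : IsSplit L u a b c P f X Y) : a ∉ Y ∧ b ∉ Y ∧ c ∉ Y :=
  ⟨h.symm.notMem_left.1, h.symm.notMem_left.2.2, h.symm.notMem_left.2.1⟩

omit [Fintype V] in
theorem mem_right_iff (h : IsSplit L u a b c P f X Y) {z : V} (ha : z ≠ a) (hb : z ≠ b)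
    (hc : z ≠ c) : z ∈ Y ↔ z ∉ X :=
  ⟨fun h1 h2 => Finset.disjoint_left.1 h.disjoint h2 h1,
    ((h.mem_iff z).2 ⟨ha, hb, hc⟩).resolve_left⟩

theorem card_add_card (h : IsSplit L u a b c P f X Y) :
    X.card + Y.card + 3 = Fintype.card V := by
  have e : X ∪ Y = Finset.univ \ {a, b, c} := by
    ext z
    simp [h.mem_iff]
  have h1 : ({a, b, c} : Finset V).card = 3 :=
    Finset.card_eq_three.2 ⟨a, b, c, h.ne₁, h.ne₂, h.ne₃, rfl⟩
  have h2 := Finset.card_sdiff_add_card_eq_card (Finset.subset_univ ({a, b, c} : Finset V))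
  rw [← Finset.card_union_of_disjoint h.disjoint, e, ← h1, h2, Finset.card_univ]

/-- Uncrossing of the sides of two splits that lie apart from each other. -/
theorem rank_add_rank_le_four (hL : IsExcluded L ρ) (h : IsSplit L u a b c P f X Y)
    (h' : IsSplit L u b c a Q g Z W) : ρ (X ∩ Z) + ρ (Y ∩ W) ≤ 4 := by
  obtain ⟨haX, hbX, hcX⟩ := h.notMem_left
  obtain ⟨haY, hbY, hcY⟩ := h.notMem_right
  obtain ⟨hbZ, hcZ, haZ⟩ := h'.notMem_left
  obtain ⟨hbW, hcW, haW⟩ := h'.notMem_right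
  have hbcZ : b ∉ insert c Z := by simp [h.ne₃, hbZ]
  have habX : a ∉ insert b X := by simp [h.ne₁, haX]
  have haE : a ∉ insert b (insert c (X ∪ Z)) := by simp [h.ne₁, h.ne₂, haX, haZ]
  have hcE : (insert b (insert c (X ∪ Z))).card = (X ∪ Z).card + 2 := by
    rw [Finset.card_insert_of_notMem (by simp [h.ne₃, hbX, hbZ]),
      Finset.card_insert_of_notMem (by simp [hcX, hcZ])]
  have key := finrank_add_le (S := minorSupported L a P ((insert b X : Finset V) : Set V))
    (T := minorSupported L b Q ((insert c Z : Finset V) : Set V))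
    (A := supported L ((X ∩ Z : Finset V) : Set V))
    (B := minorSupported L a P ((insert b (insert c (X ∪ Z)) : Finset V) : Set V)) ?_ ?_
  · have h1 := h.isMinorRank _ habX
    have h2 := h'.isMinorRank _ hbcZ
    have h3 := hL.rank_add (X ∩ Z)
    have h4 := h.isMinorRank _ haE
    have h5 := hL.rank_insert_le_of_form_ne_zero h.isMinorRank haE
      (B := {a, b, c}) (by simpa using h.mem_supported) (by
        intro z hz
        simp only [Finset.mem_insert, Finset.mem_singleton] at hz ⊢
        tauto) h.form_ne_zero
    have e : insert a (insert b (insert c (X ∪ Z))) = Finset.univ \ (Y ∩ W) := by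
      ext z
      simp only [Finset.mem_insert, Finset.mem_union, Finset.mem_sdiff, Finset.mem_univ, true_and,
        Finset.mem_inter]
      by_cases hza : z = a
      · simp [hza, haY]
      by_cases hzb : z = b
      · simp [hzb, hbY]
      by_cases hzc : z = c
      · simp [hzc, hcW]
      rw [h.mem_right_iff hza hzb hzc, h'.mem_right_iff hzb hzc hza]
      simp only [hza, hzb, hzc, false_or]
      tauto
    rw [e, hL.symm] at h5
    have h6 := h.left
    have h7 := h'.left
    have h8 := Finset.card_union_add_card_inter X Z
    rw [Finset.card_insert_of_notMem hbX] at h1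
    rw [Finset.card_insert_of_notMem hcZ] at h2
    omega
  · rintro x ⟨⟨a1, a2, -⟩, -, b2, b3⟩
    have hz : ∀ z, z ≠ b → z ∉ X ∩ Z → x z = 0 := by
      intro z hzb hz
      by_cases hzX : z ∈ X
      · refine b2 z fun hz' => ?_
        rcases hz' with hz' | hz'
        · exact hzb hz'
        · rcases Finset.mem_insert.1 hz' with rfl | hz'
          · exact hcX hzX
          · exact hz (Finset.mem_inter.2 ⟨hzX, hz'⟩)
      · by_cases hza : z = a
        · rw [hza]
          refine b2 a fun hz' => ?_
          rcases hz' with hz' | hz'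
          · exact h.ne₁ hz'
          · exact (Finset.mem_insert.1 hz').elim h.ne₂ haZ
        · refine a2 z fun hz' => ?_
          rcases hz' with hz' | hz'
          · exact hza hz'
          · exact (Finset.mem_insert.1 hz').elim hzb hzX
    have hb : form (x b) (u b) = 0 := hL.form_eq_zero_of_single a1 h.mem_supported.1 fun z hzb => by
      by_cases hzT : z ∈ ({a, b, c} : Set V)
      · refine Or.inl (hz z hzb fun hz' => ?_)
        obtain ⟨hzX, -⟩ := Finset.mem_inter.1 hz'
        rcases hzT with rfl | rfl | rfl <;> contradiction
      · exact Or.inr (h.mem_supported.2 z hzT)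
    have hb0 : x b = 0 := by
      refine ((form_eq_zero_iff h'.axis.ne_zero).1 b3).resolve_right fun e => h'.form_ne_zero ?_
      rwa [e, form_comm] at hb
    refine ⟨a1, fun z hz' => ?_⟩
    by_cases hzb : z = b
    · rw [hzb, hb0]
    · exact hz z hzb hz'
  · refine sup_le (minorSupported_mono _ _ (Finset.coe_subset.2 fun z hz => ?_)) ?_
    · simp only [Finset.mem_insert, Finset.mem_union] at hz ⊢
      tauto
    · rintro x ⟨a1, a2, -⟩
      refine ⟨a1, fun z hz => a2 z fun hz' => hz (Or.inr ?_), ?_⟩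
      · rcases hz' with rfl | hz'
        · simp
        · have hz' : z ∈ insert c Z := hz'
          refine Finset.mem_coe.2 ?_
          simp only [Finset.mem_insert, Finset.mem_union] at hz' ⊢
          tauto
      · rw [a2 a fun hz' => ?_, form_zero_left]
        rcases hz' with hz' | hz'
        · exact h.ne₁ hz'
        · exact (Finset.mem_insert.1 hz').elim h.ne₂ haZ

/-- Uncrossing of the sides of two splits that contain each other's base points. -/
theorem rank_add_rank_insert_le_five (hL : IsExcluded L ρ) (h : IsSplit L u a b c P f X Y)
    (h' : IsSplit L u b c a Q g Z W) : ρ (X ∩ W) + ρ (insert c (Y ∩ Z)) ≤ 5 := by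
  obtain ⟨haX, hbX, hcX⟩ := h.notMem_left
  obtain ⟨haY, hbY, hcY⟩ := h.notMem_right
  obtain ⟨hbZ, hcZ, haZ⟩ := h'.notMem_left
  obtain ⟨hbW, hcW, haW⟩ := h'.notMem_right
  have habX : a ∉ insert b X := by simp [h.ne₁, haX]
  have hbaW : b ∉ insert a W := by simp [h.ne₁.symm, hbW]
  have key := finrank_add_le (S := minorSupported L a P ((insert b X : Finset V) : Set V))
    (T := minorSupported L b Q ((insert a W : Finset V) : Set V))
    (A := minorSupported L a P ((insert b X : Finset V) : Set V) ⊓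
      minorSupported L b Q ((insert a W : Finset V) : Set V))
    (B := supported L ((insert a (insert b (X ∪ W)) : Finset V) : Set V)) le_rfl ?_
  · have h1 := h.isMinorRank _ habX
    have h2 := h'.isMinorRank _ hbaW
    have h3 := hL.rank_add (X ∩ W)
    have h4 := hL.rank_add (insert a (insert b (X ∪ W)))
    have e : insert a (insert b (X ∪ W)) = Finset.univ \ insert c (Y ∩ Z) := by
      ext z
      simp only [Finset.mem_insert, Finset.mem_union, Finset.mem_sdiff, Finset.mem_univ, true_and,
        Finset.mem_inter]
      by_cases hza : z = a
      · simp [hza, haY, h.ne₂]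
      by_cases hzb : z = b
      · simp [hzb, hbY, h.ne₃]
      by_cases hzc : z = c
      · simp [hzc, h.ne₂.symm, h.ne₃.symm, hcX, hcW]
      rw [h.mem_right_iff hza hzb hzc, h'.symm.mem_right_iff hzb hza hzc]
      simp only [hza, hzb, hzc, false_or]
      tauto
    have hc : (insert a (insert b (X ∪ W))).card = (X ∪ W).card + 2 := by
      rw [Finset.card_insert_of_notMem (by simp [h.ne₁, haX, haW]),
        Finset.card_insert_of_notMem (by simp [hbX, hbW])]
    have hr : ρ (insert a (insert b (X ∪ W))) = ρ (insert c (Y ∩ Z)) := by rw [e, hL.symm]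
    have h6 := h.left
    have h7 := h'.right
    have h8 := Finset.card_union_add_card_inter X W
    rw [Finset.card_insert_of_notMem hbX] at h1
    rw [Finset.card_insert_of_notMem haW] at h2
    -- The labels at `a` and `b` of a vector of the intersection are both zero, or `P` and `Q`.
    have h9 := finrank_le_succ (S := supported L ((X ∩ W : Finset V) : Set V))
      (T := minorSupported L a P ((insert b X : Finset V) : Set V) ⊓
        minorSupported L b Q ((insert a W : Finset V) : Set V)) fun x hx y hy hx' hy' => by
      have hz : ∀ x ∈ minorSupported L a P ((insert b X : Finset V) : Set V) ⊓
          minorSupported L b Q ((insert a W : Finset V) : Set V),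
          ∀ z, z ≠ a → z ≠ b → z ∉ X ∩ W → x z = 0 := by
        rintro x ⟨⟨-, a2, -⟩, -, b2, -⟩ z hza hzb hz
        by_cases hzX : z ∈ X
        · refine b2 z fun hz' => ?_
          rcases hz' with hz' | hz'
          · exact hzb hz'
          · exact (Finset.mem_insert.1 hz').elim hza fun hz' => hz (Finset.mem_inter.2 ⟨hzX, hz'⟩)
        · refine a2 z fun hz' => ?_
          rcases hz' with hz' | hz'
          · exact hza hz'
          · exact (Finset.mem_insert.1 hz').elim hzb hzX
      have hlab : ∀ x ∈ minorSupported L a P ((insert b X : Finset V) : Set V) ⊓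
          minorSupported L b Q ((insert a W : Finset V) : Set V),
          x ∉ supported L ((X ∩ W : Finset V) : Set V) → x a = P ∧ x b = Q := by
        intro x hx hx'
        have hc0 : c ∉ X ∩ W := fun h => hcX (Finset.mem_inter.1 h).1
        have hoff : ∀ z, z ≠ a → z ≠ b → x z = 0 ∨ u z = 0 := by
          intro z hza hzb
          by_cases hzT : z ∈ ({a, b, c} : Set V)
          · rcases hzT with rfl | rfl | rfl
            · exact (hza rfl).elim
            · exact (hzb rfl).elim
            · exact Or.inl (hz x hx _ hza hzb hc0)
          · exact Or.inr (h.mem_supported.2 z hzT)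
        have ha : x a = 0 → x b = 0 := fun e => by
          refine ((form_eq_zero_iff h'.axis.ne_zero).1 hx.2.2.2).resolve_right
            fun e' => h'.form_ne_zero ?_
          rw [← e', form_comm]
          refine hL.form_eq_zero_of_single hx.1.1 h.mem_supported.1 fun z hzb => ?_
          by_cases hza : z = a
          · exact Or.inl (by rw [hza, e])
          · exact hoff z hza hzb
        have hb : x b = 0 → x a = 0 := fun e => by
          refine ((form_eq_zero_iff h.axis.ne_zero).1 hx.1.2.2).resolve_right
            fun e' => h.form_ne_zero ?_
          rw [← e', form_comm]
          refine hL.form_eq_zero_of_single hx.1.1 h.mem_supported.1 fun z hza => ?_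
          by_cases hzb : z = b
          · exact Or.inl (by rw [hzb, e])
          · exact hoff z hza hzb
        have hab : ¬ (x a = 0 ∧ x b = 0) := fun ⟨e, e'⟩ => hx' ⟨hx.1.1, fun z hz' => by
          by_cases hza : z = a
          · rw [hza, e]
          by_cases hzb : z = b
          · rw [hzb, e']
          · exact hz x hx z hza hzb hz'⟩
        exact ⟨((form_eq_zero_iff h.axis.ne_zero).1 hx.1.2.2).resolve_left
            fun e => hab ⟨e, ha e⟩,
          ((form_eq_zero_iff h'.axis.ne_zero).1 hx.2.2.2).resolve_left fun e => hab ⟨hb e, e⟩⟩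
      obtain ⟨xa, xb⟩ := hlab x hx hx'
      obtain ⟨ya, yb⟩ := hlab y hy hy'
      refine ⟨L.add_mem hx.1.1 hy.1.1, fun z hz' => ?_⟩
      rw [Pi.add_apply]
      by_cases hza : z = a
      · rw [hza, xa, ya, add_self_eq_zero_of_zmod_two]
      by_cases hzb : z = b
      · rw [hzb, xb, yb, add_self_eq_zero_of_zmod_two]
      · rw [hz x hx z hza hzb hz', hz y hy z hza hzb hz', add_zero]
    omega
  · refine sup_le ((minorSupported_le _ _ _).trans (supported_mono ?_))
      ((minorSupported_le _ _ _).trans (supported_mono ?_)) <;>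
    · rw [← Finset.coe_insert]
      refine Finset.coe_subset.2 fun z hz => ?_
      simp only [Finset.mem_insert, Finset.mem_union] at hz ⊢
      tauto

/-- The four intersections of the sides of two splits at different base points are small, because
the two sums of cut-ranks are bounded and all sets of cut-rank at most `2` are small. -/
theorem card_le (hL : IsExcluded L ρ) (h : IsSplit L u a b c P f X Y)
    (h' : IsSplit L u b c a Q g Z W) (hX : 5 ≤ X.card) (hY : 5 ≤ Y.card) (hZ : 5 ≤ Z.card)
    (hW : 5 ≤ W.card) :
    (X.card ≤ 6 ∧ W.card ≤ 6) ∨ (Y.card ≤ 5 ∧ Z.card ≤ 5) := by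
  have hsub : ∀ S T : Finset V, Disjoint S T → S.card + T.card ≤ Fintype.card V := by
    intro S T hd
    rw [← Finset.card_union_of_disjoint hd]
    exact Finset.card_le_univ _
  have small : ∀ S : Finset V, ρ S ≤ 2 → S.card + 4 ≤ Fintype.card V → S.card ≤ 3 := by
    intro S hS hc
    have := hL.card_compl S
    rcases hL.card_le_three hS with h | h <;> omega
  have tiny : ∀ S : Finset V, ρ S ≤ 1 → S.card + 4 ≤ Fintype.card V → S.card ≤ 1 := by
    intro S hS hc
    have := hL.card_compl S
    rcases hL.prime S hS with h | h <;> omega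
  have e := h.card_add_card
  have e' := h'.card_add_card
  have hXZW : X ⊆ Z ∪ W := by
    intro z hz
    have e2 := h'.mem_iff z
    have e1 := (h.mem_iff z).1 (Or.inl hz)
    exact Finset.mem_union.2 (e2.2 ⟨e1.2.1, e1.2.2, e1.1⟩)
  have hYZW : Y ⊆ Z ∪ W := by
    intro z hz
    have e2 := h'.mem_iff z
    have e1 := (h.mem_iff z).1 (Or.inr hz)
    exact Finset.mem_union.2 (e2.2 ⟨e1.2.1, e1.2.2, e1.1⟩)
  have p1 := card_inter_add_card_inter h'.disjoint hXZW
  have p2 := card_inter_add_card_inter h'.disjoint hYZW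
  have p3 : (X ∩ Z).card + (Y ∩ Z).card ≤ Z.card := by
    rw [← Finset.card_union_of_disjoint
      (h.disjoint.mono Finset.inter_subset_left Finset.inter_subset_left)]
    exact Finset.card_le_card (Finset.union_subset Finset.inter_subset_right
      Finset.inter_subset_right)
  have p4 : (X ∩ W).card + (Y ∩ W).card ≤ W.card := by
    rw [← Finset.card_union_of_disjoint
      (h.disjoint.mono Finset.inter_subset_left Finset.inter_subset_left)]
    exact Finset.card_le_card (Finset.union_subset Finset.inter_subset_right
      Finset.inter_subset_right)
  have hc : c ∉ Y ∩ Z := fun hc => h.notMem_right.2.2 (Finset.mem_inter.1 hc).1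
  have d1 := rank_add_rank_le_four hL h h'
  have d2 := rank_add_rank_insert_le_five hL h h'
  have s1 := small (X ∩ Z)
  have s2 := small (Y ∩ W)
  have s3 := small (X ∩ W)
  have s4 := small (insert c (Y ∩ Z))
  have t1 := tiny (X ∩ Z)
  have t2 := tiny (Y ∩ W)
  rw [Finset.card_insert_of_notMem hc] at s4
  have c1 : (X ∩ Z).card ≤ 3 ∧ (Y ∩ W).card ≤ 3 ∨ (X ∩ Z).card ≤ 1 ∨ (Y ∩ W).card ≤ 1 := by
    by_cases g1 : ρ (X ∩ Z) ≤ 1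
    · exact Or.inr (Or.inl (t1 g1 (by omega)))
    by_cases g2 : ρ (Y ∩ W) ≤ 1
    · exact Or.inr (Or.inr (t2 g2 (by omega)))
    · exact Or.inl ⟨s1 (by omega) (by omega), s2 (by omega) (by omega)⟩
  have c2 : (X ∩ W).card ≤ 3 ∨ (Y ∩ Z).card ≤ 2 := by
    by_cases g1 : ρ (X ∩ W) ≤ 2
    · exact Or.inl (s3 g1 (by omega))
    · have := s4 (by omega) (by omega)
      omega
  omega

end IsSplit

namespace IsExcluded

variable {a b c : V} {u : V → Label}

/-- At an element `a` of the support of a vector with support `{a, b, c}`, the balanced cut of the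
minor separates `b` from `c`: otherwise it could be enlarged by `a`. -/
theorem exists_isSplit (h : IsExcluded L ρ) (hab : a ≠ b) (hac : a ≠ c) (hbc : b ≠ c)
    (hu : u ∈ supported L ({a, b, c} : Set V)) (hua : u a ≠ 0) :
    ∃ P f X Y, IsSplit L u a b c P f X Y ∧ 5 ≤ X.card ∧ 5 ≤ Y.card := by
  obtain ⟨P, hP, hPa⟩ := exists_isAxis_ne (u a)
  have huP := form_ne_zero_of_ne hua hP.ne_zero hPa.symm
  obtain ⟨f, hf, X, Y, haX, haY, hd, hXY, hfX, hfY, hX6, hY6⟩ := h.exists_cut a hP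
  have hsame : ∀ X Y : Finset V, a ∉ X → a ∉ Y → Disjoint X Y → f X ≤ 2 → 6 ≤ X.card →
      6 ≤ Y.card → b ∈ X → c ∈ X → False := by
    intro X Y haX haY hd hfX hX6 hY6 hb hc
    have h1 := h.rank_insert_le_of_form_ne_zero hf haX (B := {a, b, c}) (by simpa using hu)
      (by
        intro z hz
        simp only [Finset.mem_insert, Finset.mem_singleton] at hz ⊢
        rcases hz with rfl | rfl | rfl
        · exact Or.inl rfl
        · exact Or.inr hb
        · exact Or.inr hc) huP
    have h2 : Y ⊆ Finset.univ \ insert a X := by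
      intro z hz
      refine Finset.mem_sdiff.2 ⟨Finset.mem_univ z, fun hz' => ?_⟩
      rcases Finset.mem_insert.1 hz' with rfl | hz'
      · exact haY hz
      · exact Finset.disjoint_left.1 hd hz' hz
    have h3 := Finset.card_le_card h2
    have h4 := Finset.card_insert_of_notMem haX
    rcases h.card_le_four (X := insert a X) (by omega) with h5 | h5 <;> omega
  have hsplit : ∀ X Y : Finset V, a ∉ X → a ∉ Y → Disjoint X Y → (∀ z, z ≠ a → z ∈ X ∨ z ∈ Y) →
      f X ≤ 2 → f Y ≤ 2 → 6 ≤ X.card → 6 ≤ Y.card → b ∈ X → c ∈ Y →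
      ∃ P f X Y, IsSplit L u a b c P f X Y ∧ 5 ≤ X.card ∧ 5 ≤ Y.card := by
    intro X Y haX haY hd hXY hfX hfY hX6 hY6 hb hc
    refine ⟨P, f, X.erase b, Y.erase c, ⟨hf, hP, huP, hu, hab, hac, hbc,
      hd.mono (Finset.erase_subset _ _) (Finset.erase_subset _ _), fun z => ?_,
      by rwa [Finset.insert_erase hb], by rwa [Finset.insert_erase hc]⟩, ?_, ?_⟩
    · have e1 := hXY z
      have e2 : z ∈ X → z ≠ a ∧ z ≠ c := fun hz => ⟨fun e => haX (e ▸ hz),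
        fun e => Finset.disjoint_left.1 hd (e ▸ hz) hc⟩
      have e3 : z ∈ Y → z ≠ a ∧ z ≠ b := fun hz => ⟨fun e => haY (e ▸ hz),
        fun e => Finset.disjoint_left.1 hd hb (e ▸ hz)⟩
      simp only [Finset.mem_erase]
      clear hXY h
      tauto
    · rw [Finset.card_erase_of_mem hb]; omega
    · rw [Finset.card_erase_of_mem hc]; omega
  rcases hXY b hab.symm with hb | hb <;> rcases hXY c hac.symm with hc | hc
  · exact (hsame X Y haX haY hd hfX hX6 hY6 hb hc).elim
  · exact hsplit X Y haX haY hd hXY hfX hfY hX6 hY6 hb hc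
  · exact hsplit Y X haY haX hd.symm (fun z hz => (hXY z hz).symm) hfY hfX hY6 hX6 hb hc
  · exact (hsame Y X haY haX hd.symm hfY hY6 hX6 hb hc).elim

/-- The three balanced cuts at the elements of the support would have to be too small. -/
theorem not_isTriple (h : IsExcluded L ρ) (T : Finset V) : ¬ IsTriple L T u := by
  intro hu
  have hn := h.card_ge
  obtain ⟨a, b, c, hab, hac, hbc, rfl⟩ := Finset.card_eq_three.1 hu.1
  have hua := hu.apply_ne_zero h (v := a) (by simp)
  have hub := hu.apply_ne_zero h (v := b) (by simp)
  have huc := hu.apply_ne_zero h (v := c) (by simp)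
  have hs : u ∈ supported L ({a, b, c} : Set V) := by simpa using hu.2.1
  have e1 : ({a, b, c} : Set V) = {b, c, a} := by ext; simp; tauto
  have e2 : ({a, b, c} : Set V) = {c, a, b} := by ext; simp; tauto
  obtain ⟨P, f, Xb, Xc, hX, h1, h2⟩ := h.exists_isSplit hab hac hbc hs hua
  obtain ⟨Q, g, Yc, Ya, hY, h3, h4⟩ := h.exists_isSplit hbc hab.symm hac.symm (e1 ▸ hs) hub
  obtain ⟨R, k, Za, Zb, hZ, h5, h6⟩ := h.exists_isSplit hac.symm hbc.symm hab (e2 ▸ hs) huc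
  have i1 := hX.card_le h hY h1 h2 h3 h4
  have i2 := hY.card_le h hZ h3 h4 h5 h6
  have i3 := hZ.card_le h hX h5 h6 h1 h2
  have j1 := hX.card_add_card
  have j2 := hY.card_add_card
  have j3 := hZ.card_add_card
  omega

/-- A set of three elements and cut-rank at most `2` supports a nonzero vector. -/
theorem card_le_two (h : IsExcluded L ρ) {X : Finset V} (hX : ρ X ≤ 2) :
    X.card ≤ 2 ∨ (Finset.univ \ X).card ≤ 2 := by
  have h3 : ∀ X : Finset V, ρ X ≤ 2 → X.card ≠ 3 := by
    intro X hX hc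
    have h1 := h.rank_add X
    obtain ⟨u, hu, hu0⟩ := Submodule.exists_mem_ne_zero_of_ne_bot
      (Submodule.one_le_finrank_iff.1 (by omega :
        1 ≤ Module.finrank (ZMod 2) (supported L (X : Set V))))
    exact h.not_isTriple X ⟨hc, hu, hu0⟩
  have h4 := h3 X hX
  have h5 := h3 (Finset.univ \ X) (by rwa [h.symm])
  rcases h.card_le_three hX with h6 | h6 <;> omega

/-! ### Crossing the cuts of the two minors at a vertex -/

/-- A common element of the spaces of the two minors at `v` vanishes at `v`, since its label there
is orthogonal to `(0, 1)` and to `(1, 0)`. -/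
theorem rank_inter_add_rank_le {v : V} {f g : Finset V → ℕ} {X Y Z W : Finset V}
    (h : IsExcluded L ρ) (hf : IsMinorRank L v (0, 1) f) (hg : IsMinorRank L v (1, 0) g)
    (hvX : v ∉ X) (hvY : v ∉ Y) (hvZ : v ∉ Z) (hd : Disjoint X Y) (hd' : Disjoint Z W)
    (hXY : ∀ z, z ≠ v → z ∈ X ∨ z ∈ Y) (hZW : ∀ z, z ≠ v → z ∈ Z ∨ z ∈ W)
    (hfX : f X ≤ 2) (hgZ : g Z ≤ 2) : ρ (X ∩ Z) + ρ (Y ∩ W) ≤ 5 := by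
  have key := finrank_add_le (S := minorSupported L v (0, 1) (X : Set V))
    (T := minorSupported L v (1, 0) (Z : Set V))
    (A := supported L ((X ∩ Z : Finset V) : Set V))
    (B := supported L ((insert v (X ∪ Z) : Finset V) : Set V)) ?_ ?_
  · have h1 := hf X hvX
    have h2 := hg Z hvZ
    have h3 := h.rank_add (X ∩ Z)
    have h4 := h.rank_add (insert v (X ∪ Z))
    have hvU : v ∉ X ∪ Z := fun h => (Finset.mem_union.1 h).elim hvX hvZ
    have e : insert v (X ∪ Z) = Finset.univ \ (Y ∩ W) := by
      ext z
      have e1 := hXY z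
      have e2 := hZW z
      have e3 : z ∈ X → z ∉ Y := fun h1 h2 => Finset.disjoint_left.1 hd h1 h2
      have e4 : z ∈ Z → z ∉ W := fun h1 h2 => Finset.disjoint_left.1 hd' h1 h2
      have e5 : z = v → z ∉ Y := fun e => e ▸ hvY
      simp only [Finset.mem_insert, Finset.mem_union, Finset.mem_sdiff, Finset.mem_univ, true_and,
        Finset.mem_inter]
      clear key h
      tauto
    have hr : ρ (insert v (X ∪ Z)) = ρ (Y ∩ W) := by rw [e, h.symm]
    rw [Finset.card_insert_of_notMem hvU] at h4
    have h8 := Finset.card_union_add_card_inter X Z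
    omega
  · rintro x ⟨⟨a1, a2, a3⟩, -, b2, b3⟩
    refine ⟨a1, fun z hz => ?_⟩
    by_cases hzv : z = v
    · rw [hzv]
      have : ∀ p : Label, form p (0, 1) = 0 → form p (1, 0) = 0 → p = 0 := by decide
      exact this _ a3 b3
    · by_cases hzX : z ∈ X
      · exact b2 z fun hz' => hz'.elim hzv fun hz' => hz (by
          rw [Finset.coe_inter]; exact ⟨hzX, hz'⟩)
      · exact a2 z fun hz' => hz'.elim hzv hzX
  · refine sup_le ((minorSupported_le _ _ _).trans (supported_mono ?_))
      ((minorSupported_le _ _ _).trans (supported_mono ?_)) <;>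
    · rw [Finset.coe_insert, Finset.coe_union]
      refine Set.insert_subset_insert ?_
      first | exact Set.subset_union_left | exact Set.subset_union_right

/-- The inequalities for the cuts of the two minors at a vertex `v` bound one of two opposite
intersections by `2`, in both ways of pairing the sides. Together the two intersections form a
side. -/
theorem elim (h : IsExcluded L ρ) : False := by
  have hn := h.card_ge
  obtain ⟨v⟩ : Nonempty V := Fintype.card_pos_iff.1 (by omega)
  obtain ⟨f, hf, X, Y, hvX, hvY, hd, hXY, hfX, hfY, hX6, hY6⟩ := h.exists_cut v (Or.inl rfl)
  obtain ⟨g, hg, Z, W, hvZ, hvW, hd', hZW, hgZ, hgW, hZ6, hW6⟩ := h.exists_cut v (Or.inr rfl)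
  have hXZ := card_inter_add_card_inter (X := X) hd' fun z hz =>
    Finset.mem_union.2 (hZW z fun e => hvX (e ▸ hz))
  have hYZ := card_inter_add_card_inter (X := Y) hd' fun z hz =>
    Finset.mem_union.2 (hZW z fun e => hvY (e ▸ hz))
  have hZX := card_inter_add_card_inter (X := Z) hd fun z hz =>
    Finset.mem_union.2 (hXY z fun e => hvZ (e ▸ hz))
  have hWX := card_inter_add_card_inter (X := W) hd fun z hz =>
    Finset.mem_union.2 (hXY z fun e => hvW (e ▸ hz))
  rw [Finset.inter_comm Z X, Finset.inter_comm Z Y] at hZX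
  rw [Finset.inter_comm W X, Finset.inter_comm W Y] at hWX
  have h1 := h.rank_inter_add_rank_le hf hg hvX hvY hvZ hd hd' hXY hZW hfX hgZ
  have h2 := h.rank_inter_add_rank_le hf hg hvX hvY hvW hd hd'.symm hXY
    (fun z hz => (hZW z hz).symm) hfX hgW
  have small : ∀ S T U : Finset V, S ∩ T = U → 6 ≤ (Finset.univ \ S).card → ρ U ≤ 2 →
      U.card ≤ 2 := by
    rintro S T U rfl h6 hU
    have := Finset.card_le_card (Finset.sdiff_subset_sdiff (subset_refl Finset.univ)
      (Finset.inter_subset_left : S ∩ T ⊆ S))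
    rcases h.card_le_two hU with h7 | h7 <;> omega
  have cX : 6 ≤ (Finset.univ \ X).card := hY6.trans (Finset.card_le_card fun z hz =>
    Finset.mem_sdiff.2 ⟨Finset.mem_univ z, Finset.disjoint_right.1 hd hz⟩)
  have cY : 6 ≤ (Finset.univ \ Y).card := hX6.trans (Finset.card_le_card fun z hz =>
    Finset.mem_sdiff.2 ⟨Finset.mem_univ z, Finset.disjoint_left.1 hd hz⟩)
  have s1 := small X Z _ rfl cX
  have s2 := small Y W _ rfl cY
  have s3 := small X W _ rfl cX
  have s4 := small Y Z _ rfl cY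
  have c1 : (X ∩ Z).card ≤ 2 ∨ (Y ∩ W).card ≤ 2 := by
    by_cases g1 : ρ (X ∩ Z) ≤ 2
    · exact Or.inl (s1 g1)
    · exact Or.inr (s2 (by omega))
  have c2 : (X ∩ W).card ≤ 2 ∨ (Y ∩ Z).card ≤ 2 := by
    by_cases g1 : ρ (X ∩ W) ≤ 2
    · exact Or.inl (s3 g1)
    · exact Or.inr (s4 (by omega))
  omega

end IsExcluded

/-! ### Minimal graphs -/

section Minimal

variable {V : Type*} [Fintype V] [DecidableEq V] {G : SimpleGraph V}

/-- An isolated vertex, together with another vertex, would be a set of cut-rank at most `1`. -/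
theorem exists_adj_of_prime (hV : 4 ≤ Fintype.card V)
    (hprime : ∀ A : Finset V, G.cutRank (A : Set V) ≤ 1 →
      A.card ≤ 1 ∨ (Finset.univ \ A).card ≤ 1) (v : V) : ∃ w, G.Adj v w := by
  classical
  by_contra! hv
  obtain ⟨A, hvA, hA⟩ := Finset.exists_superset_card_eq (s := {v}) (n := 2) (by simp) (by omega)
  have h1 : G.labelMap (Pi.single v 1) ∈ supported G.labelSpace (A : Set V) := by
    refine ⟨⟨_, rfl⟩, fun z hz => ?_⟩
    have hzv : z ≠ v := fun e => hz (Finset.mem_coe.2 (hvA (by simp [e])))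
    have h2 : G.adjMap (Pi.single v 1) z = 0 := by
      rw [adjMap_apply]
      refine Finset.sum_eq_zero fun w _ => ?_
      by_cases hw : w = v
      · rw [hw, adjMatrix_apply, if_neg fun h => hv z h.symm, zero_mul]
      · rw [Pi.single_eq_of_ne hw, mul_zero]
    rw [labelMap_apply, h2, Pi.single_eq_of_ne hzv]
    rfl
  have h3 := one_le_finrank h1 fun h0 => by
    have := congrArg Prod.fst (congrFun h0 v)
    rw [labelMap_apply] at this
    simp at this
  have h4 := G.cutRank_add_finrank A
  have h5 := Finset.card_sdiff_add_card_eq_card (Finset.subset_univ A)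
  rw [Finset.card_univ] at h5
  rcases hprime A (by omega) with h | h <;> omega

theorem isExcluded (hV : 17 ≤ Fintype.card V) (hG : 2 < G.rankWidth)
    (hminor : ∀ (S : Set V) (H : SimpleGraph S), H.IsProperPivotMinor G → H.rankWidth ≤ 2) :
    IsExcluded G.labelSpace fun X : Finset V => G.cutRank (X : Set V) := by
  have hb : ¬ Branched (fun X : Finset V => G.cutRank (X : Set V)) 2 Finset.univ := fun hb =>
    
    absurd (G.rankWidth_le_of_branched (by omega) hb) (by omega)
  have hprime : ∀ A : Finset V, G.cutRank (A : Set V) ≤ 1 →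
      A.card ≤ 1 ∨ (Finset.univ \ A).card ≤ 1 := fun A hA =>
    card_le_one_of_cutRank_le_one hminor hb hA
  refine ⟨fun u hu w hw => G.sum_form_eq_zero hu hw, G.cutRank_add_finrank, G.cutRank_univ_sdiff,
    hprime, hb, fun v P hP => ?_, hV⟩
  obtain ⟨w, hvw⟩ := exists_adj_of_prime (by omega) hprime v
  exact exists_branched_minor (by omega) hminor hvw hP

end Minimal

end SimpleGraph

theorem theorem7p6 {V : Type*} [Finite V] (G : SimpleGraph V)
    (hG : G.rankWidth = 3)
    (hminor : ∀ (S : Set V) (H : SimpleGraph S), H.IsProperPivotMinor G → H.rankWidth ≤ 2) :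
    Nat.card V ≤ 16 := by
  classical
  have := Fintype.ofFinite V
  rw [Nat.card_eq_fintype_card]
  by_contra! hV
  exact (SimpleGraph.isExcluded hV (by omega) hminor).elim
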